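/- **Conventions.** A *circuit* over $n$ inputs is a directed acyclic graph whose sources are the $n$ inputs and whose $M$ other nodes are AND, OR and NOT gates (AND, OR of arbitrary fan-in $\ge 1$, NOT of fan-in $1$); exactly one gate, the output, feeds no other gate. Its size is $M$ and its depth is the length of a longest path from an input to the output. Number the inputs $0,\dots,n-1$ and the gates (in any order) $n,\dots,n+M-1$, and let $\langle v\rangle$ be the $\lceil\log_2(n+M)\rceil$-bit binary expansion of the number of a node $v$. The serialization of $C$ is $\langle C\rangle=\mathtt X^n\langle G_1\rangle\cdots\langle G_M\rangle$, where a gate $G$ with arguments $g_1,\dots,g_K$ is written $\mathrm{type}(G)\ \&\langle g_1\rangle\#\langle G\rangle\cdots\&\langle g_K\rangle\#\langle G\rangle$. *Circuit evaluation* for a set of circuits asks, on input $w\circ\langle C\rangle$ with $w\in\{0,1\}^n$ and $C$ in the set, for $C(w)$; other inputs are not constrained. *Wide-$\mathsf{AC}^d$ circuit evaluation* is the case of the circuits for which some $c>0$ satisfies $\mathrm{depth}(C)\le c\log_2^d n$ and $\mathrm{size}(C)\ge n^c$. Throughout, $N$ is the length of the input $w\circ\langle C\rangle$. A *transformer family*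 has one transformer $\mathcal T_N$ per input length. It has unmasked single-head attention, ReLU feed-forward networks, residual connections, layer normalization applied to the parts of a partition of the coordinates, and a linear threshold classifier at the last position. All scalars are fixed-point numbers $\pm a2^{-b}$, $0\le a<2^{2b}$, and every operation, including each addition of an iterated sum, is rounded to the nearest such number (saturating at the extremes); division by zero is an error. Attention is either softmax attention with a temperature, or average hard attention. The input is followed by a number of padding symbols polynomially bounded in $N$. A transformer is a bounded number of blocks of boundedly many layers, each block having its own iteration count (which may depend on $N$); the *loop count* is the sum of these counts. The family is *$\mathsf L$-uniform* if a logspace Turing machine outputs a description of $\mathcal T_N$ on input $1^N$ and a logspace Turing machine outputs the positional encoding of position $p$ on input $(1^N,p)$, $p$ in binary. $\mathsf L$-uniform $\mathsf{LPT}_d[\mathtt c,\mathtt l]$ denotes the $\mathsf L$-uniform families with precision $b=\Theta(1)$, width $D=\Theta(\log N)$, polynomial padding and loop count $\Theta(\log^d N)$. **Statement.** For softmax attention, and likewise for average hard attention, the following hold. (A) There are $\mathsf L$-uniform constant-precision log-width families $\{\mathcal T^{\mathrm{read}}_N\}$ in $\mathsf{LPT}_1[\mathtt c,\mathtt l]$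 and $\{\mathcal T^{\mathrm{step}}_N\}$ in $\mathsf{LPT}_0[\mathtt c,\mathtt l]$, with the same precision, width, temperature and layer-normalization stabilizer, such that: 1. On every input $w\circ\langle C\rangle$ of length $N$, the final residual stream of $\mathcal T^{\mathrm{read}}_N$ holds, at the last position of every argument pointer, the binary expansion of the number of that argument and the binary expansion of the number of the gate the argument belongs to, in two disjoint sub-blocks of $\lceil\log_2 N\rceil$ coordinates that depend only on $N$. (This takes $\Theta(\log N)$ loop iterations.) 2. For every circuit $C$, every $w$ and every $t\ge\mathrm{depth}(C)$ (in particular $t=\mathrm{depth}(C)$), the composition that runs $\mathcal T^{\mathrm{read}}_N$ and then $t$ times the layers of $\mathcal T^{\mathrm{step}}_N$, followed by the output layer of $\mathcal T^{\mathrm{step}}_N$, outputs $C(w)$ on $w\circ\langle C\rangle$. 3. For all $d\ge1$ and $c\in\mathbb N$ there is $t\colon\mathbb N\to\mathbb N$ such that the composed family with $t(N)$ repetitions is in $\mathsf L$-uniform $\mathsf{LPT}_d[\mathtt c,\mathtt l]$ and outputs $C(w)$ on every $w\circ\langle C\rangle$ with $\mathrm{depth}(C)\le c\log_2^d N$. (B)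 For every $d\ge1$, wide-$\mathsf{AC}^d$ circuit evaluation is solved by a family in $\mathsf L$-uniform $\mathsf{LPT}_d[\mathtt c,\mathtt l]$, i.e. by $\mathsf L$-uniform constant-precision log-width padded transformers with $\Theta(\log^d N)$ loops. -/

import Mathlib

open Filter Asymptotics

namespace LPT

/-! ### Boolean circuits and their evaluation -/

/-- Gate types of an AC circuit. -/
inductive GateKind
  | and
  | or
  | not

/-- The value of a gate on the list of its argument values (a `not` gate has one argument). -/
def GateKind.op : GateKind → List Bool → Bool
  | .and, l => l.all id
  | .or, l => l.any id
  | .not, l => l.all fun v => !v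

/-- A boolean circuit over `n` inputs: a directed acyclic graph whose nodes are the inputs
(`Sum.inl`) and `size` gates (`Sum.inr`).  Gates are not sources, fan-in is unbounded, the gates
may be listed in any order, and the output is the only gate that feeds no other gate. -/
structure Circuit (n : ℕ) where
  size : ℕ
  kind : Fin size → GateKind
  args : Fin size → List (Fin n ⊕ Fin size)
  args_ne_nil : ∀ g, args g ≠ []
  not_unary : ∀ g, kind g = GateKind.not → (args g).length = 1
  acyclic : WellFounded fun h g : Fin size => Sum.inr h ∈ args g
  out : Fin size
  out_sink : ∀ g, (∀ h, Sum.inr g ∉ args h) ↔ g = out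

namespace Circuit

variable {n : ℕ} (C : Circuit n)

/-- The value of gate `g` on the input `w`. -/
def gateVal (w : Fin n → Bool) : Fin C.size → Bool :=
  C.acyclic.fix fun g ih =>
    (C.kind g).op <| (C.args g).attach.map fun v =>
      match v with
      | ⟨Sum.inl i, _⟩ => w i
      | ⟨Sum.inr h, hv⟩ => ih h hv

/-- The value of a node (input or gate) on the input `w`. -/
def nodeVal (w : Fin n → Bool) : Fin n ⊕ Fin C.size → Bool :=
  Sum.elim w (C.gateVal w)

/-- The output `C(w)`. -/
def eval (w : Fin n → Bool) : Bool :=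
  C.gateVal w C.out

/-- The number of edges of a longest path from an input to gate `g`. -/
def gateDepth : Fin C.size → ℕ :=
  C.acyclic.fix fun g ih =>
    1 + ((C.args g).attach.map fun v =>
      match v with
      | ⟨Sum.inl _, _⟩ => 0
      | ⟨Sum.inr h, hv⟩ => ih h hv).foldr max 0

/-- The number of edges of a longest path from an input to a node. -/
def nodeDepth : Fin n ⊕ Fin C.size → ℕ :=
  Sum.elim (fun _ => 0) C.gateDepth

/-- The depth of the circuit: the length of a longest path from an input to the output. -/
def depth : ℕ :=
  C.gateDepth C.out

theorem gateVal_eq (w : Fin n → Bool) (g : Fin C.size) :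
    C.gateVal w g = (C.kind g).op ((C.args g).map (C.nodeVal w)) := by
  rw [gateVal, WellFounded.fix_eq]
  conv_rhs => rw [← List.attach_map_subtype_val (C.args g), List.map_map]
  congr 1
  apply List.map_congr_left
  rintro ⟨v | v, hv⟩ _ <;> rfl

theorem gateDepth_eq (g : Fin C.size) :
    C.gateDepth g = 1 + ((C.args g).map C.nodeDepth).foldr max 0 := by
  rw [gateDepth, WellFounded.fix_eq]
  conv_rhs => rw [← List.attach_map_subtype_val (C.args g), List.map_map]
  congr 2
  apply List.map_congr_left
  rintro ⟨v | v, hv⟩ _ <;> rfl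

end Circuit

/-! ### Serialization of circuits with binary pointers -/

/-- The input alphabet: bits, the placeholder `X`, gate types, and the two pointer markers. -/
inductive Tok
  | zero
  | one
  | X
  | and
  | or
  | not
  | amp
  | hash

/-- All symbols of the alphabet. -/
def Tok.all : List Tok := [.zero, .one, .X, .and, .or, .not, .amp, .hash]

/-- The symbol of a bit. -/
def Tok.bit (v : Bool) : Tok := if v then .one else .zero

/-- The symbol of a gate type. -/
def Tok.gate : GateKind → Tok
  | .and => .and
  | .or => .or
  | .not => .not

/-- The `W`-bit binary expansion of `k`, most significant bit first. -/
def binary (W k : ℕ) : List Bool :=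
  (List.range W).reverse.map fun i => k.testBit i

namespace Circuit

variable {n : ℕ} (C : Circuit n)

/-- The index of a node: the inputs are numbered `0, …, n-1`, the gates `n, n+1, …`. -/
def index : Fin n ⊕ Fin C.size → ℕ :=
  Sum.elim (fun i => (i : ℕ)) (fun g => n + (g : ℕ))

/-- The number of bits of a pointer: `⌈log₂ (number of nodes)⌉`. -/
def ptrWidth : ℕ := Nat.clog 2 (n + C.size)

/-- A pointer field: the binary expansion of the index of a node. -/
def ptr (v : Fin n ⊕ Fin C.size) : List Tok :=
  (binary C.ptrWidth (C.index v)).map Tok.bit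

/-- The serialization `type & ⟨arg₁⟩ # ⟨g⟩ … & ⟨arg_K⟩ # ⟨g⟩` of gate `g`. -/
def serializeGate (g : Fin C.size) : List Tok :=
  Tok.gate (C.kind g) ::
    (C.args g).flatMap fun v => Tok.amp :: (C.ptr v ++ Tok.hash :: C.ptr (Sum.inr g))

/-- The serialization `X … X ⟨G₁⟩ … ⟨G_M⟩` of the circuit. -/
def serialize : List Tok :=
  List.replicate n Tok.X ++ (List.finRange C.size).flatMap C.serializeGate

/-- The input `w ∘ ⟨C⟩` of the circuit evaluation problem. -/
def instanceOf (w : Fin n → Bool) : List Tok :=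
  (List.ofFn w).map Tok.bit ++ C.serialize

/-- The length `N` of the input `w ∘ ⟨C⟩` (the same for all `w`). -/
def inputLength : ℕ := n + C.serialize.length

/-- The (zero-based) position in `w ∘ ⟨C⟩` of the last bit of the `k`-th (zero-based) argument
pointer of gate `g`. -/
def argEnd (g : Fin C.size) (k : ℕ) : ℕ :=
  2 * n + (((List.finRange C.size).take g).flatMap C.serializeGate).length +
    1 + k * (2 * C.ptrWidth + 2) + C.ptrWidth

/-- `C` is large relative to its depth: for some `c > 0` the depth is at most `c (log₂ n)^d` and
the size is at least `n ^ c`. -/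
def IsWide (d : ℕ) : Prop :=
  ∃ c : ℝ, 0 < c ∧ (C.depth : ℝ) ≤ c * Real.logb 2 n ^ d ∧ (n : ℝ) ^ c ≤ (C.size : ℝ)

end Circuit

/-- A decision problem with a prescribed set of inputs: the set of pairs of an input and the
correct answer on it. -/
abbrev Problem := Set (List Tok × Bool)

/-- The circuit evaluation problem for the circuits that satisfy `F`: on input `w ∘ ⟨C⟩`,
output `C(w)`. -/
def circuitEvaluation (F : ∀ n : ℕ, Circuit n → Prop) : Problem :=
  {xy | ∃ (n : ℕ) (C : Circuit n) (w : Fin n → Bool),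
    F n C ∧ xy.1 = C.instanceOf w ∧ xy.2 = C.eval w}

/-- The wide-AC^d circuit evaluation problem. -/
def wideACEvaluation (d : ℕ) : Problem :=
  circuitEvaluation fun _ C => C.IsWide d

/-- Evaluation of circuits of depth at most `c (log₂ N)^d`, where `N` is the input length. -/
def boundedDepthEvaluation (c d : ℕ) : Problem :=
  circuitEvaluation fun _ C => (C.depth : ℝ) ≤ c * Real.logb 2 C.inputLength ^ d

/-! ### Fixed-point arithmetic -/

/-- The fixed-point numbers `± a · 2^(-b)` with `0 ≤ a < 2^(2b)`, given by the signed integer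
`± a`. -/
@[ext]
structure Fixed (b : ℕ) where
  mant : ℤ
  bound : |mant| < 4 ^ b

namespace Fixed

variable {b : ℕ}

/-- The real number that `x` stands for. -/
noncomputable def val (x : Fixed b) : ℝ := (x.mant : ℝ) / 2 ^ b

/-- The integer closest to `y`; of two closest ones, that of larger absolute value. -/
noncomputable def nearestInt (y : ℝ) : ℤ :=
  if 0 ≤ y then ⌊y + 1 / 2⌋ else ⌈y - 1 / 2⌉

/-- Rounding to the closest fixed-point number (ties away from zero); numbers out of range are
rounded to the extreme value. -/
noncomputable def round (b : ℕ) (x : ℝ) : Fixed b :=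
  ⟨max (-(4 ^ b - 1)) (min (4 ^ b - 1) (nearestInt (x * 2 ^ b))), by
    have h : (1 : ℤ) ≤ 4 ^ b := one_le_pow₀ (by norm_num)
    rw [abs_lt]
    constructor
    · exact lt_of_lt_of_le (by omega) (le_max_left _ _)
    · exact max_lt (by omega) (lt_of_le_of_lt (min_le_left _ _) (by omega))⟩

noncomputable instance : Zero (Fixed b) := ⟨round b 0⟩
noncomputable instance : One (Fixed b) := ⟨round b 1⟩

/-- Every operation is the exact operation followed by rounding. -/
noncomputable def add (x y : Fixed b) : Fixed b := round b (x.val + y.val)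
noncomputable def sub (x y : Fixed b) : Fixed b := round b (x.val - y.val)
noncomputable def mul (x y : Fixed b) : Fixed b := round b (x.val * y.val)
noncomputable def div (x y : Fixed b) : Fixed b := round b (x.val / y.val)
noncomputable def exp (x : Fixed b) : Fixed b := round b (Real.exp x.val)
noncomputable def sqrt (x : Fixed b) : Fixed b := round b (Real.sqrt x.val)
noncomputable def relu (x : Fixed b) : Fixed b := round b (max 0 x.val)

/-- Summation from left to right with rounding after every addition. -/
noncomputable def sum (l : List (Fixed b)) : Fixed b := l.foldl add 0

/-- The fixed-point inner product. -/
noncomputable def dot {D : ℕ} (x y : Fin D → Fixed b) : Fixed b :=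
  sum (List.ofFn fun i => mul (x i) (y i))

end Fixed

/-! ### Transformers -/

/-- Softmax attention, or average hard attention. -/
inductive AttnKind
  | soft
  | hard

/-- The residual stream of a string of length `m`: one vector of width `D` per position. -/
abbrev Hidden (b D m : ℕ) := Fin m → Fin D → Fixed b

/-- The parameters of a transformer layer with one attention head and a ReLU network with one
hidden layer.  Coordinates with the same `part` are layer-normalized together; the parts cover all
coordinates. -/
structure Layer (b D : ℕ) where
  WQ : Fin D → Fin D → Fixed b
  WK : Fin D → Fin D → Fixed b
  WV : Fin D → Fin D → Fixed b
  W₁ : Fin D → Fin D → Fixed b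
  bias₁ : Fin D → Fixed b
  W₂ : Fin D → Fin D → Fixed b
  bias₂ : Fin D → Fixed b
  part : Fin D → Fin D

/-- The product `x W` of a row vector and a matrix. -/
noncomputable def vecMul {b D : ℕ} (x : Fin D → Fixed b) (W : Fin D → Fin D → Fixed b) :
    Fin D → Fixed b :=
  fun j => Fixed.dot x fun i => W i j

/-- Unnormalized attention weights: `exp (s / τ)` for softmax attention with temperature `τ`; the
indicator of the maximal scores for average hard attention. -/
noncomputable def rawWeights {b m : ℕ} (κ : AttnKind) (τ : Fixed b) (s : Fin m → Fixed b) :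
    Fin m → Fixed b :=
  open Classical in
  match κ with
  | .soft => fun j => Fixed.exp (Fixed.div (s j) τ)
  | .hard => fun j => if ∀ j', (s j').val ≤ (s j).val then 1 else 0

/-- Layer normalization `(x - μ) / √(σ² + ε)` of each part of the vector. -/
noncomputable def layerNorm {b D : ℕ} (part : Fin D → Fin D) (ε : Fixed b) (x : Fin D → Fixed b) :
    Fin D → Fixed b := fun i =>
  let idx := (List.finRange D).filter fun j => decide (part j = part i)
  let k : Fixed b := Fixed.round b (idx.length : ℝ)
  let μ := Fixed.div (Fixed.sum (idx.map x)) k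
  let y : Fin D → Fixed b := fun j => Fixed.sub (x j) μ
  let σsq := Fixed.div (Fixed.sum (idx.map fun j => Fixed.mul (y j) (y j))) k
  Fixed.div (y i) (Fixed.sqrt (Fixed.add σsq ε))

namespace Layer

variable {b D m : ℕ} (l : Layer b D)

/-- Self-attention (without a mask).  The value is `none` if a normalizer is zero: division by zero
is an error. -/
noncomputable def attend (κ : AttnKind) (τ : Fixed b) (H : Hidden b D m) :
    Option (Hidden b D m) :=
  open Classical in
  let Q : Hidden b D m := fun i => vecMul (H i) l.WQ
  let K : Hidden b D m := fun i => vecMul (H i) l.WK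
  let V : Hidden b D m := fun i => vecMul (H i) l.WV
  let e : Fin m → Fin m → Fixed b := fun i => rawWeights κ τ fun j => Fixed.dot (Q i) (K j)
  let Z : Fin m → Fixed b := fun i => Fixed.sum (List.ofFn (e i))
  if ∀ i, Z i ≠ 0 then
    some fun i c => Fixed.sum (List.ofFn fun j => Fixed.mul (Fixed.div (e i j) (Z i)) (V j c))
  else none

/-- The position-wise feed-forward network. -/
noncomputable def feedForward (x : Fin D → Fixed b) : Fin D → Fixed b :=
  let h : Fin D → Fixed b := fun j => Fixed.relu (Fixed.add (vecMul x l.W₁ j) (l.bias₁ j))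
  fun j => Fixed.add (vecMul h l.W₂ j) (l.bias₂ j)

/-- One layer: attention and feed-forward sub-layers, each followed by layer normalization and
added to the residual stream. -/
noncomputable def apply (κ : AttnKind) (τ ε : Fixed b) (H : Hidden b D m) :
    Option (Hidden b D m) :=
  (l.attend κ τ H).map fun A =>
    let G : Hidden b D m := fun i c => Fixed.add (layerNorm l.part ε (A i) c) (H i c)
    fun i c => Fixed.add (G i c) (layerNorm l.part ε (l.feedForward (G i)) c)

end Layer

/-- A looped padded transformer for strings of one length over the alphabet `Tok` (`none` is the
padding symbol): symbol embedding, positional encoding, a sequence of blocks of layers with the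
number of times each of them is applied, a linear threshold classifier as output layer, the
temperature, the stabilizer of layer normalization, and the number of padding symbols. -/
structure Transformer (b D : ℕ) where
  embed : Option Tok → Fin D → Fixed b
  pos : ℕ → Fin D → Fixed b
  blocks : List (ℕ × List (Layer b D))
  outWeight : Fin D → Fixed b
  outBias : Fixed b
  τ : Fixed b
  τ_pos : 0 < τ.val
  ε : Fixed b
  ε_pos : 0 < ε.val
  pad : ℕ

namespace Transformer

variable {b D : ℕ} (T : Transformer b D)

/-- Apply a list of layers, the first one first. -/
noncomputable def runLayers (κ : AttnKind) {m : ℕ} (ls : List (Layer b D)) (H : Hidden b D m) :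
    Option (Hidden b D m) :=
  ls.foldlM (fun H l => l.apply κ T.τ T.ε H) H

/-- Apply a block of layers `t` times. -/
noncomputable def runLoop (κ : AttnKind) {m : ℕ} (ls : List (Layer b D)) :
    ℕ → Hidden b D m → Option (Hidden b D m)
  | 0, H => some H
  | t + 1, H => (T.runLayers κ ls H).bind (runLoop κ ls t)

/-- Apply all blocks of the transformer, each of them as often as it says. -/
noncomputable def run (κ : AttnKind) {m : ℕ} (H : Hidden b D m) : Option (Hidden b D m) :=
  T.blocks.foldlM (fun H B => T.runLoop κ B.2 B.1 H) H

/-- The length of the padded input. -/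
def paddedLength (x : List Tok) : ℕ := x.length + T.pad

/-- The initial residual stream on the padded input `x □ … □`. -/
noncomputable def init (x : List Tok) : Hidden b D (T.paddedLength x) :=
  fun i c => Fixed.add (T.embed x[(i : ℕ)]? c) (T.pos i c)

/-- The final residual stream on input `x`. -/
noncomputable def hidden (κ : AttnKind) (x : List Tok) :
    Option (Hidden b D (T.paddedLength x)) :=
  T.run κ (T.init x)

/-- The output layer. -/
noncomputable def classify (h : Fin D → Fixed b) : Bool :=
  open Classical in
  decide (0 < (Fixed.add (Fixed.dot h T.outWeight) T.outBias).val)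

/-- The decision on input `x`, read off at the last position of the padded input; `none` if an
error occurs. -/
noncomputable def output (κ : AttnKind) (x : List Tok) : Option Bool :=
  if h : 0 < T.paddedLength x then
    (T.hidden κ x).map fun H => T.classify (H ⟨T.paddedLength x - 1, Nat.sub_lt h one_pos⟩)
  else none

/-- The total number of loop iterations. -/
def loopCount : ℕ := (T.blocks.map Prod.fst).sum

/-- The sequence of layers that the transformer applies, with all loops unrolled. -/
def layerSeq : List (Layer b D) :=
  T.blocks.flatMap fun B => (List.replicate B.1 B.2).flatten

/-- The composition that runs `R` and then the whole layer sequence of `S` in a loop, `t` times,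
and classifies with the output layer of `S`. -/
def comp (R S : Transformer b D) (t : ℕ) : Transformer b D :=
  { R with
    blocks := R.blocks ++ [(t, S.layerSeq)]
    outWeight := S.outWeight
    outBias := S.outBias }

end Transformer

/-! ### Descriptions of transformers as strings -/

/-- The alphabet of the input and output tapes of Turing machines. -/
inductive TapeSym
  | zero
  | one
  | sep

/-- The tape symbol of a bit. -/
def TapeSym.bit (v : Bool) : TapeSym := if v then .one else .zero

/-- A natural number in unary, with an end marker. -/
def descNat (k : ℕ) : List TapeSym := List.replicate k .one ++ [.sep]

/-- A fixed-point number is described by its sign and the `2b` bits of its absolute value. -/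
def descFixed {b : ℕ} (x : Fixed b) : List TapeSym :=
  TapeSym.bit (decide (x.mant < 0)) :: (binary (2 * b) x.mant.natAbs).map TapeSym.bit

/-- Description of a vector. -/
def descVec {b D : ℕ} (v : Fin D → Fixed b) : List TapeSym :=
  (List.ofFn v).flatMap descFixed

/-- Description of a matrix, row by row. -/
def descMat {b D : ℕ} (W : Fin D → Fin D → Fixed b) : List TapeSym :=
  (List.ofFn W).flatMap descVec

/-- Description of a layer. -/
def descLayer {b D : ℕ} (l : Layer b D) : List TapeSym :=
  descMat l.WQ ++ descMat l.WK ++ descMat l.WV ++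
    descMat l.W₁ ++ descVec l.bias₁ ++ descMat l.W₂ ++ descVec l.bias₂ ++
    (List.ofFn l.part).flatMap fun i => descNat i

/-- Description of a block with its number of iterations. -/
def descBlock {b D : ℕ} (B : ℕ × List (Layer b D)) : List TapeSym :=
  descNat B.1 ++ descNat B.2.length ++ B.2.flatMap descLayer

/-- Description of a transformer: everything but the positional encoding. -/
def Transformer.desc {b D : ℕ} (T : Transformer b D) : List TapeSym :=
  descNat b ++ descNat D ++ descNat T.pad ++ descFixed T.τ ++ descFixed T.ε ++
    descVec (T.embed none) ++ (Tok.all.flatMap fun a => descVec (T.embed (some a))) ++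
    descNat T.blocks.length ++ T.blocks.flatMap descBlock ++
    descVec T.outWeight ++ descFixed T.outBias

/-! ### Logspace Turing machines -/

/-- Head movements. -/
inductive Move
  | left
  | stay
  | right

/-- Moving a head on a one-way infinite tape. -/
def Move.apply : Move → ℕ → ℕ
  | .left, i => i - 1
  | .stay, i => i
  | .right, i => i + 1

/-- A deterministic Turing machine with a two-way read-only input tape, `k` work tapes and a
one-way write-only output tape.  The transition function sees the state, the input symbol under the
head (`none` on the two cells next to the input) and the scanned work symbols; it gives the new
state, the move of the input head, the symbols written to and the moves on the work tapes, and the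
symbol that is output, if any.  The machine halts where it gives `none`. -/
structure Machine where
  State : Type
  Work : Type
  [finState : Finite State]
  [finWork : Finite Work]
  k : ℕ
  start : State
  blank : Work
  δ : State → Option TapeSym → (Fin k → Work) →
    Option (State × Move × (Fin k → Work × Move) × Option TapeSym)

namespace Machine

variable (M : Machine)

/-- Configurations. -/
structure Cfg where
  state : M.State
  inputHead : ℕ
  heads : Fin M.k → ℕ
  tapes : Fin M.k → ℕ → M.Work
  out : List TapeSym

/-- The initial configuration: the input head is on the first input cell, all work tapes are
blank. -/
def initCfg : M.Cfg where
  state := M.start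
  inputHead := 1
  heads := fun _ => 0
  tapes := fun _ _ => M.blank
  out := []

/-- The symbol in cell `i` of the input tape; the input occupies the cells `1, …, |x|`. -/
def inputAt (x : List TapeSym) (i : ℕ) : Option TapeSym :=
  if i = 0 then none else x[i - 1]?

/-- One step on input `x`; the input head stays within the cells `0, …, |x| + 1`. -/
def step (x : List TapeSym) (c : M.Cfg) : Option M.Cfg :=
  (M.δ c.state (inputAt x c.inputHead) fun i => c.tapes i (c.heads i)).map fun r =>
    { state := r.1
      inputHead := min (r.2.1.apply c.inputHead) (x.length + 1)
      heads := fun i => (r.2.2.1 i).2.apply (c.heads i)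
      tapes := fun i => Function.update (c.tapes i) (c.heads i) (r.2.2.1 i).1
      out := c.out ++ r.2.2.2.toList }

/-- On input `x` the machine reaches the configuration `c`. -/
def Reaches (x : List TapeSym) (c : M.Cfg) : Prop :=
  Relation.ReflTransGen (fun c₁ c₂ => M.step x c₁ = some c₂) M.initCfg c

/-- On input `x` the machine halts with output `y`, and only ever visits the first `s` cells of
each work tape. -/
def OutputsInSpace (s : ℕ) (x y : List TapeSym) : Prop :=
  (∀ c, M.Reaches x c → ∀ i, c.heads i < s) ∧
    ∃ c, M.Reaches x c ∧ M.step x c = none ∧ c.out = y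

end Machine

/-- Some Turing machine outputs `f i` on input `x i`, for all `i`, in space
`O(log (length of the input))`. -/
def LogspaceOutputs {ι : Type} (x f : ι → List TapeSym) : Prop :=
  ∃ (M : Machine) (c : ℕ), ∀ i, M.OutputsInSpace (c * (Nat.log 2 (x i).length + 1)) (x i) (f i)

/-! ### Transformer families and the class of looped padded transformers -/

/-- A family with one transformer for every input length `N`, of precision `b N` and width `D N`. -/
abbrev Family (b D : ℕ → ℕ) := ∀ N : ℕ, Transformer (b N) (D N)

/-- Constant precision. -/
def ConstantPrecision (b : ℕ → ℕ) : Prop :=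
  (fun N => (b N : ℝ)) =Θ[atTop] fun _ => (1 : ℝ)

/-- Logarithmic width. -/
def LogWidth (D : ℕ → ℕ) : Prop :=
  (fun N => (D N : ℝ)) =Θ[atTop] fun N => Real.log N

namespace Family

variable {b D : ℕ → ℕ} (T : Family b D)

/-- `L`-uniformity: a logspace machine outputs a description of the transformer on input `1^N`, and
a logspace machine outputs the positional encoding of position `p` on input `(1^N, p)`, where `p` is
given in binary, for all positions of the padded input. -/
def LUniform : Prop :=
  LogspaceOutputs (fun N : ℕ => List.replicate N TapeSym.one) (fun N => (T N).desc) ∧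
  LogspaceOutputs
    (fun i : (N : ℕ) × Fin (N + (T N).pad) =>
      descNat i.1 ++ (binary (Nat.clog 2 (i.1 + (T i.1).pad)) i.2).map TapeSym.bit)
    (fun i => descVec ((T i.1).pos i.2))

/-- `L`-uniform family with constant precision, logarithmic width, polynomial padding, boundedly many
blocks and layers, and `Θ(log^d N)` loop iterations. -/
structure IsLPT (d : ℕ) : Prop where
  uniform : T.LUniform
  precision : ConstantPrecision b
  width : LogWidth D
  padding : ∃ K : ℕ, (fun N => ((T N).pad : ℝ)) =O[atTop] fun N => (N : ℝ) ^ K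
  layers : ∃ K : ℕ, ∀ N, (T N).blocks.length ≤ K ∧ ∀ B ∈ (T N).blocks, B.2.length ≤ K
  loops : (fun N => ((T N).loopCount : ℝ)) =Θ[atTop] fun N => Real.log N ^ d

/-- On every input of the problem the transformer for its length gives the correct answer. -/
def Recognizes (κ : AttnKind) (P : Problem) : Prop :=
  ∀ x y, (x, y) ∈ P → (T x.length).output κ x = some y

/-- On every input `w ∘ ⟨C⟩` the final residual stream holds, at the last position of each argument
pointer, the binary expansions of the index of the argument and of the index of the gate to which
the argument belongs, in two disjoint sub-blocks of `⌈log₂ N⌉` coordinates that depend on `N`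
only. -/
def ReadsPointers (κ : AttnKind) : Prop :=
  ∃ blk : ∀ N, Fin (Nat.clog 2 N) ⊕ Fin (Nat.clog 2 N) → Fin (D N),
    (∀ N, Function.Injective (blk N)) ∧
    ∀ (n : ℕ) (C : Circuit n) (w : Fin n → Bool),
      let x := C.instanceOf w
      ∃ H, (T x.length).hidden κ x = some H ∧
        ∀ (g : Fin C.size) (k : Fin (C.args g).length),
          ∃ p : Fin ((T x.length).paddedLength x), (p : ℕ) = C.argEnd g k ∧
            ∀ i : Fin (Nat.clog 2 x.length),
              H p (blk x.length (Sum.inl i)) =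
                (if (C.index ((C.args g).get k)).testBit i then 1 else 0) ∧
              H p (blk x.length (Sum.inr i)) =
                (if (C.index (Sum.inr g)).testBit i then 1 else 0)

end Family

end LPT

open LPT

/-! The residual stream is used as the memory of a machine that runs one program at all positions at
once. With precision two every number is a mantissa between `-15` and `15` that counts quarters. The
width is `m * slots` with `m = Nat.size N`: at every position, block `i` of the `m` blocks holds bit
number `i` of each of a fixed set of boolean registers (`State`, `Encodes`). A bit is stored as a
pair `(x, -x)` with `x` zero or one. Such a pair has mean zero, and for `ε = 1/4` rounded layer
normalization maps it to itself (`mant_pairNorm`), so bits survive the residual additions.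

Two kinds of instructions suffice. `Instr.asg` is a boolean gate computed by the ReLU network.
`Instr.att` is attention: query-key products are `0` or `-1`, so a score is zero iff no bit excludes
the position, and for `τ = 1/4` the exponential of every other score rounds to zero. Softmax and
average hard attention thus have the same unnormalized weights zero and one. The normalizer
saturates at `15/4`, so the weight of a match never rounds to zero, however many matches there are,
and the weighted sum is nonzero iff some matching position carries the bit. Attention is therefore a
disjunction of unbounded fan-in (`mant_attention`, `exists_apply_instr`). One padding symbol with
zero keys matches every query and keeps the normalizer nonzero.

Keys for a position and for its successor let positions read their neighbours. Carrying bits to the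
right, one block up per position, collects a pointer in binary at its last symbol; the number of the
gate is then carried back to the left to the end of the argument pointer. This takes `3 * m` rounds
(`triple_loop`, `readBits_argEnd`, `readGate_argEnd`). An input is represented by its own position,
a gate by the ends of all its argument pointers. One evaluation step consists of fetching the values
that the pointers name and of a disjunction over the argument ends of the same gate, with negations
before and after it for AND and NOT (`triple_step`, `carries_step`). As many steps as the depth make
all values up to the output correct (`update_iterate`); the output is the gate whose number no
pointer names (`isSink_iff`).

For uniformity, all matrices have constant blocks on and just above the diagonal and zeros
elsewhere. A machine that counts its input in binary obtains a tape with `m` digits, and nested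
loops over this tape write the description (`runs_buildRuler`, `leads_descFrag`). The positional
encoding takes one scan with a carry (`runs_posProg`). Wide circuits reduce to depth at most `log ^
d` of the input length, because `n ^ c ≤ size` turns the factor `c * log n` into at most `log N`
(`Circuit.IsWide.depth_le`). -/

namespace LPT

/-! ### Arithmetic of fixed-point numbers of precision two

A number is handled through its mantissa, an integer between `-15` and `15` that counts quarters. -/

namespace Fixed

/-- Saturation at the extreme mantissas. -/
def clamp (z : ℤ) : ℤ := max (-15) (min 15 z)

theorem clamp_of_abs_le {z : ℤ} (h : |z| ≤ 15) : clamp z = z := by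
  rw [abs_le] at h; unfold clamp; omega

theorem nearestInt_intCast (z : ℤ) : nearestInt (z : ℝ) = z := by
  unfold nearestInt
  split_ifs with h
  · rw [Int.floor_eq_iff]; constructor <;> linarith
  · rw [Int.ceil_eq_iff]; constructor <;> linarith

theorem nearestInt_neg (y : ℝ) : nearestInt (-y) = -nearestInt y := by
  unfold nearestInt
  rcases lt_trichotomy y 0 with h | h | h
  · rw [if_pos (by linarith), if_neg (by linarith), ← Int.floor_neg]; congr 1; ring
  · subst h; norm_num
  · rw [if_neg (by linarith), if_pos (by linarith), ← Int.ceil_neg]; congr 1; ring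

theorem nearestInt_eq {y : ℝ} {k : ℤ} (hy : 0 ≤ y) (h₁ : (k : ℝ) - 1 / 2 ≤ y)
    (h₂ : y < k + 1 / 2) : nearestInt y = k := by
  unfold nearestInt
  rw [if_pos hy, Int.floor_eq_iff]; constructor <;> linarith

theorem mant_round (x : ℝ) : (round 2 x).mant = clamp (nearestInt (x * 4)) := by
  simp only [round, clamp]; norm_num

theorem mant_abs_le (x : Fixed 2) : |x.mant| ≤ 15 := by
  have := x.bound; norm_num at this; omega

theorem mant_round_neg (x : ℝ) : (round 2 (-x)).mant = -(round 2 x).mant := by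
  rw [mant_round, mant_round, neg_mul, nearestInt_neg]; unfold clamp; omega

theorem mant_round_int {x : ℝ} {z : ℤ} (h : x * 4 = z) : (round 2 x).mant = clamp z := by
  rw [mant_round, h, nearestInt_intCast]

theorem val_eq (x : Fixed 2) : x.val = (x.mant : ℝ) / 4 := by
  unfold val; norm_num

@[simp] theorem mant_zero : (0 : Fixed 2).mant = 0 :=
  (mant_round_int (z := 0) (by norm_num)).trans (by decide)

@[simp] theorem mant_one : (1 : Fixed 2).mant = 4 :=
  (mant_round_int (z := 4) (by norm_num)).trans (by decide)

theorem mant_add (x y : Fixed 2) : (add x y).mant = clamp (x.mant + y.mant) :=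
  mant_round_int (by rw [val_eq, val_eq]; push_cast; ring)

theorem mant_sub (x y : Fixed 2) : (sub x y).mant = clamp (x.mant - y.mant) :=
  mant_round_int (by rw [val_eq, val_eq]; push_cast; ring)

/-- Products with an integral factor are exact up to saturation. -/
theorem mant_mul_int {x y : Fixed 2} {c : ℤ} (h : y.mant = 4 * c) :
    (mul x y).mant = clamp (x.mant * c) :=
  mant_round_int (by rw [val_eq, val_eq, h]; push_cast; ring)

theorem mant_mul_comm (x y : Fixed 2) : mul x y = mul y x := by
  unfold mul; rw [mul_comm]

theorem mant_relu (x : Fixed 2) : (relu x).mant = max 0 x.mant := by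
  have h := abs_le.1 (mant_abs_le x)
  rw [relu, mant_round_int (z := max 0 x.mant), clamp_of_abs_le]
  · rw [abs_le]; omega
  · rw [val_eq]; push_cast
    rcases le_total (0:ℝ) x.mant with h | h
    · rw [max_eq_right h, max_eq_right (by positivity)]; ring
    · rw [max_eq_left h, max_eq_left (by linarith)]; ring

theorem mul_zero_left {x : Fixed 2} (y : Fixed 2) (h : x.mant = 0) : (mul x y).mant = 0 := by
  rw [mul, mant_round_int (z := 0) (by rw [val_eq, h]; simp)]; decide

/-- The number with a given mantissa. -/
noncomputable def ofMant (z : ℤ) : Fixed 2 := round 2 (z / 4)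

theorem mant_ofMant {z : ℤ} (h : |z| ≤ 15) : (ofMant z).mant = z := by
  rw [ofMant, mant_round_int (z := z) (by ring), clamp_of_abs_le h]

/-! ### Saturating sums -/

/-- The positive and the negative parts are bounded separately, so no partial sum leaves the range,
in whatever order the terms come. -/
theorem mant_foldl_exact (l : List (Fixed 2)) (a : Fixed 2)
    (hp : max 0 a.mant + (l.map fun x => max 0 x.mant).sum ≤ 15)
    (hn : max 0 (-a.mant) + (l.map fun x => max 0 (-x.mant)).sum ≤ 15) :
    (l.foldl add a).mant = a.mant + (l.map mant).sum := by
  induction l generalizing a with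
  | nil => simp
  | cons x l ih =>
    simp only [List.map_cons, List.sum_cons, List.foldl_cons] at *
    have h1 : 0 ≤ (l.map fun x : Fixed 2 => max 0 x.mant).sum :=
      List.sum_nonneg (by intro z hz; obtain ⟨y, -, rfl⟩ := List.mem_map.1 hz; exact le_max_left _ _)
    have h2 : 0 ≤ (l.map fun x : Fixed 2 => max 0 (-x.mant)).sum :=
      List.sum_nonneg (by intro z hz; obtain ⟨y, -, rfl⟩ := List.mem_map.1 hz; exact le_max_left _ _)
    have hs : (add a x).mant = a.mant + x.mant := by
      rw [mant_add, clamp_of_abs_le]; rw [abs_le]; omega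
    rw [ih, hs]
    · ring
    · rw [hs]; omega
    · rw [hs]; omega

/-- A sum of nonnegative terms that has reached the maximum stays there, so saturation after each
addition amounts to saturation of the total. -/
theorem mant_foldl_nonneg (l : List (Fixed 2)) (a : Fixed 2) (ha : 0 ≤ a.mant)
    (h : ∀ x ∈ l, 0 ≤ x.mant) :
    (l.foldl add a).mant = min 15 (a.mant + (l.map mant).sum) := by
  induction l generalizing a with
  | nil => have := abs_le.1 (mant_abs_le a); simp; omega
  | cons x l ih =>
    simp only [List.map_cons, List.sum_cons, List.foldl_cons, List.mem_cons, forall_eq_or_imp] at *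
    have h1 : 0 ≤ (l.map mant).sum :=
      List.sum_nonneg (by intro z hz; obtain ⟨y, hy, rfl⟩ := List.mem_map.1 hz; exact h.2 y hy)
    rw [ih _ _ h.2, mant_add]
    · unfold clamp; omega
    · rw [mant_add]; unfold clamp; omega

theorem mant_foldl_nonpos (l : List (Fixed 2)) (a : Fixed 2) (ha : a.mant ≤ 0)
    (h : ∀ x ∈ l, x.mant ≤ 0) :
    (l.foldl add a).mant = max (-15) (a.mant + (l.map mant).sum) := by
  induction l generalizing a with
  | nil => have := abs_le.1 (mant_abs_le a); simp; omega
  | cons x l ih =>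
    simp only [List.map_cons, List.sum_cons, List.foldl_cons, List.mem_cons, forall_eq_or_imp] at *
    have h1 : (l.map mant).sum ≤ 0 := by
      have h3 := h.2
      clear ih h
      induction l with
      | nil => simp
      | cons y l ihl =>
        simp only [List.map_cons, List.sum_cons, List.mem_cons, forall_eq_or_imp] at *
        have := ihl h3.2
        omega
    rw [ih _ _ h.2, mant_add]
    · unfold clamp; omega
    · rw [mant_add]; unfold clamp; omega

theorem mant_sum_exact {n : ℕ} (f : Fin n → Fixed 2) (hp : ∑ i, max 0 (f i).mant ≤ 15)
    (hn : ∑ i, max 0 (-(f i).mant) ≤ 15) :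
    (sum (List.ofFn f)).mant = ∑ i, (f i).mant := by
  rw [sum, mant_foldl_exact] <;> simp_all [List.map_ofFn, List.sum_ofFn, Function.comp_def]

theorem mant_sum_nonneg {n : ℕ} (f : Fin n → Fixed 2) (h : ∀ i, 0 ≤ (f i).mant) :
    (sum (List.ofFn f)).mant = min 15 (∑ i, (f i).mant) := by
  rw [sum, mant_foldl_nonneg _ _ (by simp)]
  · simp [List.map_ofFn, List.sum_ofFn, Function.comp_def]
  · intro x hx; obtain ⟨i, rfl⟩ := (List.mem_ofFn' _ _).1 hx; exact h i

theorem mant_sum_nonpos {n : ℕ} (f : Fin n → Fixed 2) (h : ∀ i, (f i).mant ≤ 0) :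
    (sum (List.ofFn f)).mant = max (-15) (∑ i, (f i).mant) := by
  rw [sum, mant_foldl_nonpos _ _ (by simp)]
  · simp [List.map_ofFn, List.sum_ofFn, Function.comp_def]
  · intro x hx; obtain ⟨i, rfl⟩ := (List.mem_ofFn' _ _).1 hx; exact h i

/-! ### Layer normalization of a pair of opposite numbers -/

/-- The mantissa of the result of layer normalization of the pair `(x, -x)` in the coordinate `x`,
for the mantissas that occur. -/
def pairNorm (z : ℤ) : ℤ :=
  if |z| = 8 then z.sign * 5 else if |z| = 12 then z.sign * 8
  else if |z| = 15 then z.sign * 10 else z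

/-- The mantissas to which layer normalization of pairs is applied. -/
def Tame (z : ℤ) : Prop := z = 0 ∨ |z| = 4 ∨ |z| = 8 ∨ |z| = 12 ∨ |z| = 15

theorem mant_mul_self_neg {x y : Fixed 2} (h : y.mant = -x.mant) : mul y y = mul x x := by
  unfold mul; congr 1; rw [val_eq, val_eq, h]; push_cast; ring

theorem mant_round_eq {x : ℝ} {k : ℤ} (hx : 0 ≤ x) (h₁ : (k : ℝ) - 1 / 2 ≤ x * 4)
    (h₂ : x * 4 < k + 1 / 2) : (round 2 x).mant = clamp k := by
  rw [mant_round, nearestInt_eq (by linarith) h₁ h₂]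

theorem mant_div_neg {x y : Fixed 2} (z : Fixed 2) (h : y.mant = -x.mant) :
    (div y z).mant = -(div x z).mant := by
  unfold div
  rw [← mant_round_neg]; congr 2
  rw [val_eq y, val_eq x, h]; push_cast; ring

/-- The stages are certified by their mantissas: `q` is the square before saturation, `v` the
variance, `s` the root of variance plus stabilizer, `r` the quotient. The inequalities say that each
is a nearest integer, without divisions or roots, so that numerical instances are decidable by
`norm_num`. -/
theorem mant_pairNorm_aux {x e t : Fixed 2} {a q v s r : ℤ} (hx : x.mant = a) (ha : 0 ≤ a)
    (he : e.mant = 1) (ht : t.mant = 8)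
    (h1 : (2 * q - 1 : ℝ) * 2 ≤ a * a) (h1' : (a * a : ℝ) < (2 * q + 1) * 2) (hq : 0 ≤ q)
    (h2 : (2 * v - 1 : ℝ) ≤ (clamp (2 * clamp q) : ℤ)) (h2' : ((clamp (2 * clamp q) : ℤ) : ℝ) < 2 * v + 1)
    (hv : 0 ≤ v) (hv14 : v ≤ 14)
    (h3 : (2 * s - 1 : ℝ) ^ 2 ≤ 16 * (v + 1)) (h3' : (16 * (v + 1) : ℝ) < (2 * s + 1) ^ 2)
    (hs : 1 ≤ s) (hs15 : s ≤ 15) (h4 : ((2 * r - 1) * s : ℝ) ≤ 8 * a) (h4' : (8 * a : ℝ) < (2 * r + 1) * s)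
    (hr : |r| ≤ 15) :
    (div x (sqrt (add (div (sum [mul x x, mul x x]) t) e))).mant = r := by
  have hsR : (1 : ℝ) ≤ s := by exact_mod_cast hs
  have haR : (0 : ℝ) ≤ a := by exact_mod_cast ha
  have hvR : (0 : ℝ) ≤ v := by exact_mod_cast hv
  have m1 : (mul x x).mant = clamp q := by
    rw [mul]
    apply mant_round_eq
    · rw [← pow_two]; positivity
    · rw [val_eq, hx]; nlinarith
    · rw [val_eq, hx]; nlinarith
  have c1 : 0 ≤ clamp q := by unfold clamp; omega
  have m2 : (sum [mul x x, mul x x]).mant = clamp (2 * clamp q) := by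
    simp only [sum, List.foldl_cons, List.foldl_nil, mant_add, m1, mant_zero]
    unfold clamp; omega
  have m3 : (div (sum [mul x x, mul x x]) t).mant = v := by
    rw [div, val_eq, val_eq, m2, ht, ← clamp_of_abs_le (z := v) (by rw [abs_le]; omega)]
    have : 0 ≤ clamp (2 * clamp q) := by unfold clamp; omega
    have : (0 : ℝ) ≤ (clamp (2 * clamp q) : ℤ) := by exact_mod_cast this
    apply mant_round_eq
    · push_cast; positivity
    · push_cast at *; linarith
    · push_cast at *; linarith
  have m4 : (add (div (sum [mul x x, mul x x]) t) e).mant = v + 1 := by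
    rw [mant_add, m3, he, clamp_of_abs_le]; rw [abs_le]; omega
  have m5 : (sqrt (add (div (sum [mul x x, mul x x]) t) e)).mant = s := by
    rw [sqrt, val_eq, m4, ← clamp_of_abs_le (z := s) (by rw [abs_le]; omega)]
    apply mant_round_eq (Real.sqrt_nonneg _)
    · have : ((s : ℝ) - 1 / 2) / 4 ≤ Real.sqrt (((v + 1 : ℤ) : ℝ) / 4) := by
        apply Real.le_sqrt_of_sq_le; push_cast; nlinarith
      linarith
    · have : Real.sqrt (((v + 1 : ℤ) : ℝ) / 4) < ((s : ℝ) + 1 / 2) / 4 := by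
        rw [Real.sqrt_lt' (by linarith)]; push_cast; nlinarith
      linarith
  rw [div, val_eq, val_eq, m5, hx, ← clamp_of_abs_le hr]
  have hs0 : (0 : ℝ) < s := by linarith
  have e1 : (a : ℝ) / 4 / (s / 4) * 4 = 4 * a / s := by field_simp
  apply mant_round_eq (by positivity)
  · rw [e1, le_div_iff₀ hs0]; linarith
  · rw [e1, div_lt_iff₀ hs0]; linarith

/-- The case that matters most is `4`: the root of `1 + 1/4` rounds to `1`, so a stored bit is a
fixed point of layer normalization. -/
theorem mant_pairNorm {x e t : Fixed 2} (hx : Tame x.mant) (he : e.mant = 1) (ht : t.mant = 8) :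
    (div x (sqrt (add (div (sum [mul x x, mul x x]) t) e))).mant = pairNorm x.mant := by
  have key : ∀ y : Fixed 2, 0 ≤ y.mant → Tame y.mant →
      (div y (sqrt (add (div (sum [mul y y, mul y y]) t) e))).mant = pairNorm y.mant := by
    intro y hy hT
    have : y.mant = 0 ∨ y.mant = 4 ∨ y.mant = 8 ∨ y.mant = 12 ∨ y.mant = 15 := by
      unfold Tame at hT; rwa [abs_of_nonneg hy] at hT
    rcases this with h | h | h | h | h <;> rw [h]
    · exact mant_pairNorm_aux (q := 0) (v := 0) (s := 2) (r := 0) h (by decide) he ht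
        (by norm_num) (by norm_num) (by decide) (by norm_num [clamp]) (by norm_num [clamp]) (by decide)
        (by decide) (by norm_num) (by norm_num) (by decide) (by decide) (by norm_num) (by norm_num)
        (by decide)
    · exact mant_pairNorm_aux (q := 4) (v := 4) (s := 4) (r := 4) h (by decide) he ht
        (by norm_num) (by norm_num) (by decide) (by norm_num [clamp]) (by norm_num [clamp]) (by decide)
        (by decide) (by norm_num) (by norm_num) (by decide) (by decide) (by norm_num) (by norm_num)
        (by decide)
    -- From mantissa `8` on the squares saturate, and the rounded root is always `6/4`.
    · exact mant_pairNorm_aux (q := 16) (v := 8) (s := 6) (r := 5) h (by decide) he ht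
        (by norm_num) (by norm_num) (by decide) (by norm_num [clamp]) (by norm_num [clamp]) (by decide)
        (by decide) (by norm_num) (by norm_num) (by decide) (by decide) (by norm_num) (by norm_num)
        (by decide)
    · exact mant_pairNorm_aux (q := 36) (v := 8) (s := 6) (r := 8) h (by decide) he ht
        (by norm_num) (by norm_num) (by decide) (by norm_num [clamp]) (by norm_num [clamp]) (by decide)
        (by decide) (by norm_num) (by norm_num) (by decide) (by decide) (by norm_num) (by norm_num)
        (by decide)
    · exact mant_pairNorm_aux (q := 56) (v := 8) (s := 6) (r := 10) h (by decide) he ht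
        (by norm_num) (by norm_num) (by decide) (by norm_num [clamp]) (by norm_num [clamp]) (by decide)
        (by decide) (by norm_num) (by norm_num) (by decide) (by decide) (by norm_num) (by norm_num)
        (by decide)
  rcases le_total 0 x.mant with h | h
  · exact key x h hx
  · have hb : |(-x.mant)| ≤ 15 := by rw [abs_neg]; exact mant_abs_le x
    have hm : (ofMant (-x.mant)).mant = -x.mant := mant_ofMant hb
    have h2 := key (ofMant (-x.mant)) (by omega) (by rw [hm]; unfold Tame at *; rw [abs_neg]; omega)
    rw [mant_mul_self_neg hm, mant_div_neg _ hm, hm] at h2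
    have : pairNorm (-x.mant) = -pairNorm x.mant := by
      unfold pairNorm; rw [abs_neg, Int.sign_neg]; split_ifs <;> ring
    omega

end Fixed

/-! ### Inner products with sparse columns. -/

namespace Fixed

theorem mant_dot_exact {n : ℕ} {x w : Fin n → Fixed 2} (h : ∑ i, |(mul (x i) (w i)).mant| ≤ 15) :
    (dot x w).mant = ∑ i, (mul (x i) (w i)).mant := by
  apply mant_sum_exact
  · exact (Finset.sum_le_sum fun i _ => max_le (abs_nonneg _) (le_abs_self _)).trans h
  · exact (Finset.sum_le_sum fun i _ => max_le (abs_nonneg _) (neg_le_abs _)).trans h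

theorem mant_dot_single {n : ℕ} {x w : Fin n → Fixed 2} (u : Fin n)
    (h : ∀ i, i ≠ u → (w i).mant = 0) : (dot x w).mant = (mul (x u) (w u)).mant := by
  have h0 : ∀ i, i ≠ u → (mul (x i) (w i)).mant = 0 := fun i hi => by
    rw [mant_mul_comm]; exact mul_zero_left _ (h i hi)
  rw [mant_dot_exact, Finset.sum_eq_single u (fun i _ hi => h0 i hi) (by simp)]
  rw [Finset.sum_eq_single u (fun i _ hi => by simp [h0 i hi]) (by simp)]
  exact mant_abs_le _

theorem mant_dot_zero {n : ℕ} {x w : Fin n → Fixed 2} (h : ∀ i, (w i).mant = 0) :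
    (dot x w).mant = 0 := by
  have h0 : ∀ i, (mul (x i) (w i)).mant = 0 := fun i => by
    rw [mant_mul_comm]; exact mul_zero_left _ (h i)
  rw [mant_dot_exact] <;> simp [h0]

/-- The two indices may coincide, and `β = 0` covers columns with a single entry. -/
theorem mant_dot_two {n : ℕ} {x w : Fin n → Fixed 2} (u v : Fin n) (α β : ℤ)
    (h : ∀ i, (w i).mant = 4 * ((if i = u then α else 0) + (if i = v then β else 0)))
    (hb : |(x u).mant * α| + |(x v).mant * β| ≤ 15) :
    (dot x w).mant = (x u).mant * α + (x v).mant * β := by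
  have h1 : ∀ i, (x i).mant * ((if i = u then α else 0) + (if i = v then β else 0)) =
      (if i = u then (x u).mant * α else 0) + (if i = v then (x v).mant * β else 0) := by
    intro i; split_ifs <;> subst_vars <;> ring
  have h2 : ∀ i, |(if i = u then (x u).mant * α else 0) + (if i = v then (x v).mant * β else 0)| ≤
      (if i = u then |(x u).mant * α| else 0) + (if i = v then |(x v).mant * β| else 0) := by
    intro i; refine (abs_add_le _ _).trans (le_of_eq ?_); split_ifs <;> simp
  have h3 : ∀ i, (mul (x i) (w i)).mant =
      (if i = u then (x u).mant * α else 0) + (if i = v then (x v).mant * β else 0) := by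
    intro i
    rw [mant_mul_int (h i), h1, clamp_of_abs_le]
    refine (h2 i).trans (le_trans ?_ hb)
    have := abs_nonneg ((x u).mant * α)
    have := abs_nonneg ((x v).mant * β)
    split_ifs <;> omega
  rw [mant_dot_exact]
  · simp only [h3, Finset.sum_add_distrib, Finset.sum_ite_eq', Finset.mem_univ, if_true]
  · simp only [h3]
    refine (Finset.sum_le_sum fun i _ => h2 i).trans ?_
    simpa only [Finset.sum_add_distrib, Finset.sum_ite_eq', Finset.mem_univ, if_true] using hb

end Fixed

/-! ### Coordinates of the residual stream -/

/-- The boolean registers kept for every position and every bit number. -/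
inductive Fld
  | pos | nxt | first | one | bit | pad | hash | mark | bitHash | isAnd | isNeg | ampBit
  | pk | npk | nk | nnk | seed | argE | gateE | inner | t | u | v
  | argR | inPtr | kAnd | kNeg | gateSrc | gateR
  | aq | naq | gq | ngq | inp | inpOne | nodeK | nnodeK | negIn | negOut | sink | val | lit | outV
  | zero
  deriving DecidableEq

noncomputable instance : Fintype Fld :=
  Fintype.ofInjective (fun f : Fld => (⟨f.ctorIdx, by cases f <;> decide⟩ : Fin 45)) fun a b h => by
    rw [← Fld.ofNat_ctorIdx a, ← Fld.ofNat_ctorIdx b]; exact congrArg Fld.ofNat (Fin.mk.inj h)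

/-- A register and a sign, or the accumulator for attention and a sign. -/
abbrev Slot := Option Fld × Bool

/-- The number of slots. -/
noncomputable abbrev slots : ℕ := Fintype.card Slot

/-- An enumeration of the slots. -/
noncomputable def slotEquiv : Slot ≃ Fin slots := Fintype.equivFin Slot

/-- The coordinates of a residual stream of width `m * slots`. -/
noncomputable def coord (m : ℕ) : Fin m × Slot ≃ Fin (m * slots) :=
  (Equiv.prodCongr (Equiv.refl _) slotEquiv).trans finProdFinEquiv

/-- The matrix with the same table `T` in all diagonal blocks and the same table `T'` in all blocks
above the diagonal. -/
noncomputable def blockMat (m : ℕ) (T T' : Slot → Slot → ℤ) :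
    Fin (m * slots) → Fin (m * slots) → Fixed 2 := fun x y =>
  let r := (coord m).symm x
  let c := (coord m).symm y
  if c.1 = r.1 then Fixed.ofMant (T r.2 c.2)
  else if (c.1 : ℕ) = r.1 + 1 then Fixed.ofMant (T' r.2 c.2) else 0

/-- The vector with the same entries in all blocks. -/
noncomputable def blockVec (m : ℕ) (v : Slot → ℤ) : Fin (m * slots) → Fixed 2 := fun x =>
  Fixed.ofMant (v ((coord m).symm x).2)

/-- The mantissas in the blocks of the parameters of a layer. -/
structure LayerTable where
  q : Slot → Slot → ℤ
  k : Slot → Slot → ℤ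
  v : Slot → Slot → ℤ
  vShift : Slot → Slot → ℤ
  w₁ : Slot → Slot → ℤ
  b₁ : Slot → ℤ
  w₂ : Slot → Slot → ℤ
  b₂ : Slot → ℤ

/-- The layer of width `m * slots` with a given table; opposite coordinates are normalized
together. -/
noncomputable def LayerTable.layer (T : LayerTable) (m : ℕ) : Layer 2 (m * slots) where
  WQ := blockMat m T.q fun _ _ => 0
  WK := blockMat m T.k fun _ _ => 0
  WV := blockMat m T.v T.vShift
  W₁ := blockMat m T.w₁ fun _ _ => 0
  bias₁ := blockVec m T.b₁
  W₂ := blockMat m T.w₂ fun _ _ => 0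
  bias₂ := blockVec m T.b₂
  part := fun x => coord m (((coord m).symm x).1, ((coord m).symm x).2.1, true)

theorem blockMat_coord {m : ℕ} {T : Slot → Slot → ℤ} (i i' : Fin m) (s s' : Slot)
    (hT : |T s s'| ≤ 15) :
    (blockMat m T (fun _ _ => 0) (coord m (i, s)) (coord m (i', s'))).mant =
      if i = i' then T s s' else 0 := by
  simp only [blockMat, Equiv.symm_apply_apply]
  by_cases h : i = i'
  · simp [h, Fixed.mant_ofMant hT]
  · rw [if_neg (Ne.symm h), if_neg h]; split_ifs
    · exact Fixed.mant_ofMant (by simp)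
    · exact Fixed.mant_zero

theorem blockVec_coord {m : ℕ} {v : Slot → ℤ} (i : Fin m) (s : Slot) (h : |v s| ≤ 15) :
    (blockVec m v (coord m (i, s))).mant = v s := by
  simp [blockVec, Fixed.mant_ofMant h]

/-- A column of a block diagonal matrix with one or two nonzero entries. -/
theorem mant_vecMul_two {m : ℕ} {T : Slot → Slot → ℤ} (x : Fin (m * slots) → Fixed 2) (i : Fin m)
    (s a b : Slot) (α β : ℤ)
    (hT : ∀ s', T s' s = 4 * ((if s' = a then α else 0) + (if s' = b then β else 0)))
    (hα : |α| ≤ 1) (hβ : |β| ≤ 1)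
    (hb : |(x (coord m (i, a))).mant * α| + |(x (coord m (i, b))).mant * β| ≤ 15) :
    (vecMul x (blockMat m T fun _ _ => 0) (coord m (i, s))).mant =
      (x (coord m (i, a))).mant * α + (x (coord m (i, b))).mant * β := by
  apply Fixed.mant_dot_two _ _ _ _ _ hb
  intro y
  obtain ⟨⟨i', s'⟩, rfl⟩ := (coord m).surjective y
  rw [blockMat_coord]
  · simp only [EmbeddingLike.apply_eq_iff_eq, Prod.mk.injEq, hT]
    by_cases h : i' = i <;> simp [h]
  · rw [hT]
    rw [abs_le] at *; split_ifs <;> constructor <;> omega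

theorem mant_vecMul_zero {m : ℕ} {T : Slot → Slot → ℤ} (x : Fin (m * slots) → Fixed 2) (i : Fin m)
    (s : Slot) (hT : ∀ s', T s' s = 0) :
    (vecMul x (blockMat m T fun _ _ => 0) (coord m (i, s))).mant = 0 := by
  apply Fixed.mant_dot_zero
  intro y
  obtain ⟨⟨i', s'⟩, rfl⟩ := (coord m).surjective y
  rw [blockMat_coord _ _ _ _ (by simp [hT]), hT, ite_self]

/-- Layer normalization of a vector whose opposite coordinates hold opposite numbers. -/
theorem mant_layerNorm {m : ℕ} (T : LayerTable) {ε : Fixed 2} (hε : ε.mant = 1)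
    (x : Fin (m * slots) → Fixed 2) (i : Fin m) (f : Option Fld)
    (ho : (x (coord m (i, f, false))).mant = -(x (coord m (i, f, true))).mant)
    (ht : Fixed.Tame (x (coord m (i, f, true))).mant) (s : Bool) :
    (layerNorm (T.layer m).part ε x (coord m (i, f, s))).mant =
      Fixed.pairNorm (x (coord m (i, f, s))).mant := by
  set A := coord m (i, f, true) with hA
  set B := coord m (i, f, false) with hB
  have hAB : A ≠ B := by simp [hA, hB]
  set idx := (List.finRange (m * slots)).filter fun j =>
    decide ((T.layer m).part j = (T.layer m).part (coord m (i, f, s))) with hidx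
  have hmem : ∀ j, j ∈ idx ↔ j = A ∨ j = B := by
    intro j
    obtain ⟨⟨i', f', s'⟩, rfl⟩ := (coord m).surjective j
    simp only [hidx, LayerTable.layer, List.mem_filter, List.mem_finRange, true_and,
      Equiv.symm_apply_apply, decide_eq_true_eq, EmbeddingLike.apply_eq_iff_eq, Prod.mk.injEq,
      and_true, hA, hB]
    cases s' <;> simp
  have hnd : idx.Nodup := (List.nodup_finRange _).filter _
  -- `slotEquiv` is an arbitrary enumeration, so it is unknown which partner comes first; both
  -- orders give the same sums.
  have hcases : idx = [A, B] ∨ idx = [B, A] := by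
    have hp : idx.Perm [A, B] := by
      rw [List.perm_ext_iff_of_nodup hnd (by simp [hAB])]
      intro j; rw [hmem]; simp
    have := List.perm_pair.1 hp
    exact this
  have hlen : idx.length = 2 := by rcases hcases with h | h <;> simp [h]
  have hk : (Fixed.round 2 (idx.length : ℝ)).mant = 8 := by
    rw [hlen, Fixed.mant_round_int (z := 8) (by norm_num)]; decide
  have hxA := Fixed.mant_abs_le (x A)
  have hμ0 : (Fixed.sum (idx.map x)).mant = 0 := by
    rcases hcases with h | h <;>
    · rw [h]
      simp only [Fixed.sum, List.map_cons, List.map_nil, List.foldl_cons, List.foldl_nil,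
        Fixed.mant_add, Fixed.mant_zero, ho]
      unfold Fixed.clamp; rw [abs_le] at hxA; omega
  have hμ : (Fixed.div (Fixed.sum (idx.map x)) (Fixed.round 2 (idx.length : ℝ))).mant = 0 := by
    rw [Fixed.div, Fixed.mant_round_int (z := 0)]
    · decide
    · rw [Fixed.val_eq (Fixed.sum _), hμ0]; simp
  have hy : ∀ j, Fixed.sub (x j)
      (Fixed.div (Fixed.sum (idx.map x)) (Fixed.round 2 (idx.length : ℝ))) = x j := by
    intro j; ext
    rw [Fixed.mant_sub, hμ, sub_zero, Fixed.clamp_of_abs_le (Fixed.mant_abs_le _)]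
  have hsq : idx.map (fun j => Fixed.mul (x j) (x j)) =
      [Fixed.mul (x (coord m (i, f, s))) (x (coord m (i, f, s))),
        Fixed.mul (x (coord m (i, f, s))) (x (coord m (i, f, s)))] := by
    have e : Fixed.mul (x B) (x B) = Fixed.mul (x A) (x A) := Fixed.mant_mul_self_neg ho
    rcases hcases with h | h <;> cases s <;> simp [h, ← hA, ← hB, e]
  have htame : Fixed.Tame (x (coord m (i, f, s))).mant := by
    cases s
    · rw [← hB, ho]; unfold Fixed.Tame at *; rw [abs_neg]; omega
    · exact ht
  have := Fixed.mant_pairNorm htame hε hk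
  unfold layerNorm
  simp only [← hidx, hy, hsq]
  exact this

/-! ### Attention weights -/

theorem mant_round_exp_zero {x : Fixed 2} (h : x.mant = 0) : (Fixed.exp x).mant = 4 := by
  rw [Fixed.exp, Fixed.val_eq, h, Fixed.mant_round_int (z := 4) (by norm_num)]; decide

/-- `e ≥ 2` gives `exp (15/4) > 2 ^ 3`, so the exponential of the lowest number is below `1/8`, half
of the smallest positive number, and rounds to zero. -/
theorem mant_round_exp_small {x : Fixed 2} (h : x.mant = -15) : (Fixed.exp x).mant = 0 := by
  have h1 : Real.exp (-15 / 4) < 1 / 8 := by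
    have h2 : (2 : ℝ) ≤ Real.exp 1 := by have := Real.add_one_le_exp (1 : ℝ); linarith
    have h3 : (8 : ℝ) ≤ Real.exp 3 := by
      have : Real.exp 3 = Real.exp 1 ^ 3 := by rw [← Real.exp_nat_mul]; norm_num
      rw [this]; calc (8:ℝ) = 2 ^ 3 := by norm_num
        _ ≤ _ := by gcongr
    have h4 : Real.exp 3 < Real.exp (15 / 4) := Real.exp_lt_exp.2 (by norm_num)
    rw [neg_div, Real.exp_neg, inv_eq_one_div]
    apply one_div_lt_one_div_of_lt <;> linarith
  have h0 := Real.exp_pos (-15 / 4)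
  rw [Fixed.exp, Fixed.val_eq, h]
  push_cast
  rw [Fixed.mant_round_eq (k := 0) h0.le (by push_cast; linarith) (by push_cast; linarith)]; decide

/-- If all scores are nonpositive integers and some score is zero, then the positions of score zero
have weight one and the others weight zero. -/
theorem mant_rawWeights {P : ℕ} (κ : AttnKind) {τ : Fixed 2} (hτ : τ.mant = 1)
    (s : Fin P → Fixed 2) (hs : ∀ j, (s j).mant = 0 ∨ (s j).mant ≤ -4) (h0 : ∃ j, (s j).mant = 0)
    (j : Fin P) : (rawWeights κ τ s j).mant = if (s j).mant = 0 then 4 else 0 := by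
  cases κ with
  | soft =>
    simp only [rawWeights]
    -- Division by `τ = 1/4` takes a score of at most `-1` to at most `-4`, which saturates at
    -- `-15/4`.
    have hd : (Fixed.div (s j) τ).mant = Fixed.clamp (4 * (s j).mant) := by
      rw [Fixed.div, Fixed.mant_round_int]
      rw [Fixed.val_eq, Fixed.val_eq, hτ]; push_cast; ring
    rcases hs j with h | h
    · rw [if_pos h, mant_round_exp_zero]; rw [hd, h]; decide
    · rw [if_neg (by omega), mant_round_exp_small]; rw [hd]; unfold Fixed.clamp; omega
  | hard =>
    simp only [rawWeights]
    obtain ⟨j₀, hj₀⟩ := h0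
    have : (∀ j', (s j').val ≤ (s j).val) ↔ (s j).mant = 0 := by
      constructor
      · intro h
        have h1 := h j₀
        rw [Fixed.val_eq, Fixed.val_eq, hj₀] at h1
        have h2 : (0 : ℝ) ≤ (s j).mant := by push_cast at h1; linarith
        have h3 : 0 ≤ (s j).mant := by exact_mod_cast h2
        rcases hs j with h | h <;> omega
      · intro h j'
        rw [Fixed.val_eq, Fixed.val_eq, h]
        have h1 : ((s j').mant : ℝ) ≤ 0 := by exact_mod_cast (by rcases hs j' with h | h <;> omega)
        push_cast; linarith
    split_ifs with h1 h2 h2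
    · simp
    · exact absurd (this.1 h1) h2
    · exact absurd (this.2 h2) h1
    · simp

/-- The weighted sum of values `0` and `±15`, all of the same sign. -/
theorem mant_attention {P : ℕ} {e v : Fin P → Fixed 2} (M : Fin P → Prop) (B : Fin P → Prop)
    [DecidablePred M] [DecidablePred B] (σ : ℤ) (hσ : σ = 1 ∨ σ = -1)
    (he : ∀ j, (e j).mant = if M j then 4 else 0)
    (hv : ∀ j, (v j).mant = if B j then 15 * σ else 0) (h0 : ∃ j, M j) :
    Fixed.sum (List.ofFn e) ≠ 0 ∧
    ∃ a : ℤ, (Fixed.sum (List.ofFn fun j => Fixed.mul (Fixed.div (e j)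
        (Fixed.sum (List.ofFn e))) (v j))).mant = a * σ ∧
      (a = 0 ∨ a = 4 ∨ a = 8 ∨ a = 12 ∨ a = 15) ∧ (a = 0 ↔ ¬ ∃ j, M j ∧ B j) ∧
      a = min 15 (((Finset.univ.filter fun j => M j ∧ B j).card : ℤ) *
        (if (Fixed.sum (List.ofFn e)).mant = 4 then 15
          else if (Fixed.sum (List.ofFn e)).mant = 8 then 8 else 4)) := by
  set Z := Fixed.sum (List.ofFn e) with hZdef
  have hZ : Z.mant = min 15 (((Finset.univ.filter M).card : ℤ) * 4) := by
    rw [hZdef, Fixed.mant_sum_nonneg]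
    · simp only [he, Finset.sum_ite, Finset.sum_const_zero, Finset.sum_const, add_zero, nsmul_eq_mul]
    · intro i; rw [he]; split_ifs <;> norm_num
  have hcard : 1 ≤ (Finset.univ.filter M).card := by
    obtain ⟨j, hj⟩ := h0
    exact Finset.card_pos.2 ⟨j, by simp [hj]⟩
  set n := (Finset.univ.filter M).card
  have hZ' : Z.mant = 4 ∨ Z.mant = 8 ∨ Z.mant = 12 ∨ Z.mant = 15 := by omega
  -- One, two, or at least three matches give the weights `1`, `1/2`, `1/4`: both `1/3` and the
  -- quotient `4/15` by the saturated normalizer round to `1/4`.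
  have hdiv : ∀ j, (Fixed.div (e j) Z).mant =
      if M j then (if Z.mant = 4 then 4 else if Z.mant = 8 then 2 else 1) else 0 := by
    intro j
    rw [Fixed.div, Fixed.val_eq (e j), he]
    split_ifs with h1 h2 h3
    · rw [Fixed.val_eq, h2, Fixed.mant_round_int (z := 4) (by norm_num)]; decide
    · rw [Fixed.val_eq, h3, Fixed.mant_round_int (z := 2) (by norm_num)]; decide
    · rcases hZ' with h | h | h | h
      · exact absurd h h2
      · exact absurd h h3
      all_goals
        rw [Fixed.val_eq, h, Fixed.mant_round_eq (k := 1) (by norm_num) (by norm_num) (by norm_num)]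
        decide
    · rw [Fixed.mant_round_int (z := 0) (by norm_num)]; decide
  -- The contribution of one position is `15` times its weight, where `7.5` rounds to `8` and `3.75`
  -- to `4`. It is never zero.
  set r : ℤ := if Z.mant = 4 then 15 else if Z.mant = 8 then 8 else 4 with hr
  have hmul : ∀ j, (Fixed.mul (Fixed.div (e j) Z) (v j)).mant = if M j ∧ B j then r * σ else 0 := by
    intro j
    by_cases h1 : M j
    swap
    · rw [if_neg (by tauto), Fixed.mul_zero_left _ (by rw [hdiv, if_neg h1])]
    by_cases h2 : B j
    swap
    · rw [if_neg (by tauto), Fixed.mant_mul_comm, Fixed.mul_zero_left _ (by rw [hv, if_neg h2])]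
    rw [if_pos ⟨h1, h2⟩]
    have h3 := hdiv j
    have h4 := hv j
    rw [if_pos h1] at h3
    rw [if_pos h2] at h4
    have pos : ∀ x y : Fixed 2, x.mant = (if Z.mant = 4 then 4 else if Z.mant = 8 then 2 else 1) →
        y.mant = 15 → (Fixed.mul x y).mant = r := by
      intro x y hx hy
      rw [Fixed.mul, Fixed.val_eq, Fixed.val_eq, hy, hx, hr]
      split_ifs
      · rw [Fixed.mant_round_int (z := 15) (by norm_num)]; decide
      · rw [Fixed.mant_round_eq (k := 8) (by norm_num) (by norm_num) (by norm_num)]; decide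
      · rw [Fixed.mant_round_eq (k := 4) (by norm_num) (by norm_num) (by norm_num)]; decide
    rcases hσ with rfl | rfl
    · rw [pos _ _ h3 (by rw [h4]; rfl)]; ring
    · have h5 : (Fixed.ofMant 15).mant = 15 := Fixed.mant_ofMant (by norm_num)
      have h6 := pos _ _ h3 h5
      have h7 : (Fixed.mul (Fixed.div (e j) Z) (v j)).mant =
          -(Fixed.mul (Fixed.div (e j) Z) (Fixed.ofMant 15)).mant := by
        unfold Fixed.mul
        rw [← Fixed.mant_round_neg, Fixed.val_eq (v j), Fixed.val_eq (Fixed.ofMant 15), h4, h5]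
        congr 2; push_cast; ring
      rw [h7, h6]; ring
  set c := (Finset.univ.filter fun j => M j ∧ B j).card with hc
  have hr0 : r = 15 ∨ r = 8 ∨ r = 4 := by rw [hr]; split_ifs <;> simp
  have hsum : ∑ j, (Fixed.mul (Fixed.div (e j) Z) (v j)).mant = c * r * σ := by
    simp only [hmul, Finset.sum_ite, Finset.sum_const_zero, Finset.sum_const, add_zero, nsmul_eq_mul,
      ← hc]
    ring
  -- The witness does not involve `σ`, so the two coordinates of the accumulator receive exactly
  -- opposite numbers.
  refine ⟨fun h => ?_, min 15 (c * r), ?_, ?_, ?_, rfl⟩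
  · rw [h, Fixed.mant_zero] at hZ'; omega
  · rcases hσ with rfl | rfl
    · rw [Fixed.mant_sum_nonneg, hsum]
      · simp
      · intro j; rw [hmul]; split_ifs <;> omega
    · rw [Fixed.mant_sum_nonpos, hsum]
      · omega
      · intro j; rw [hmul]; split_ifs <;> omega
  · rcases hr0 with h | h | h <;> rw [h] <;> omega
  · have h1 : c = 0 ↔ ¬ ∃ j, M j ∧ B j := by
      rw [hc, Finset.card_eq_zero, Finset.filter_eq_empty_iff]; simp
    rw [← h1]
    rcases hr0 with h | h | h <;> rw [h] <;> omega

/-! ### Instructions on boolean registers and their implementation by layers -/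

/-- Boolean registers for every position and bit number. -/
abbrev State := ℕ → ℕ → Fld → Bool

/-- `att` sets the register `t` at position `p` and bit `i` to the disjunction of the registers `v`
(of the preceding bit number if `sh` holds) at all positions that no pair of registers of `p` and
of that position excludes; `asg` assigns the possibly negated conjunction of two literals. -/
inductive Instr
  | att (a₁ b₁ a₂ b₂ v : Fld) (sh : Bool)
  | asg (x a : Fld) (sa : Bool) (b : Fld) (sb : Bool) (so : Bool)

/-- Position `j` is not excluded at position `p`. -/
def Matches (m : ℕ) (β : State) (a₁ b₁ a₂ b₂ : Fld) (p j : ℕ) : Prop :=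
  ∀ i < m, ¬(β p i a₁ = true ∧ β j i b₁ = true) ∧ ¬(β p i a₂ = true ∧ β j i b₂ = true)

/-- The value that an attention instruction reads. -/
def source (β : State) (v : Fld) (sh : Bool) (j i : ℕ) : Bool :=
  if sh then decide (i ≠ 0) && β j (i - 1) v else β j i v

open Classical in
/-- The effect of an instruction with positions below `P` and bit numbers below `m`. -/
noncomputable def Instr.eval (P m : ℕ) : Instr → State → State
  | .att a₁ b₁ a₂ b₂ v sh, β => fun p i f =>
    if f = .t then decide (∃ j < P, Matches m β a₁ b₁ a₂ b₂ p j ∧ source β v sh j i = true)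
    else β p i f
  | .asg x a sa b sb so, β => fun p i f =>
    if f = x then (((β p i a == sa) && (β p i b == sb)) == so) else β p i f

/-- Attention never runs dry, because some position is excluded nowhere. -/
def Instr.Ok (P m : ℕ) : Instr → State → Prop
  | .att _ b₁ _ b₂ _ _, β => ∃ j < P, ∀ i < m, β j i b₁ = false ∧ β j i b₂ = false
  | .asg .., _ => True

/-- The entry of a table that copies the slot `a` with weight `α` and the slot `b` with weight
`β`. -/
def twoEntry (a b : Slot) (α β : ℤ) (s : Slot) : ℤ :=
  4 * ((if s = a then α else 0) + (if s = b then β else 0))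

/-- The sign of a literal. -/
def litSign (s : Bool) : ℤ := if s then 1 else -1

/-- The layer that implements an instruction. -/
def Instr.table : Instr → LayerTable
  | .att a₁ b₁ a₂ b₂ v sh =>
    let V : Slot → Slot → ℤ := fun s s' =>
      if s'.1 = none ∧ s = (some v, true) then 15 * litSign s'.2 else 0
    { q := fun s s' => if s' = (none, true) then twoEntry (some a₁, true) (none, true) 1 0 s
        else if s' = (none, false) then twoEntry (some a₂, true) (none, true) 1 0 s else 0
      k := fun s s' => if s' = (none, true) then twoEntry (some b₁, true) (none, true) (-1) 0 s
        else if s' = (none, false) then twoEntry (some b₂, true) (none, true) (-1) 0 s else 0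
      v := if sh then fun _ _ => 0 else V
      vShift := if sh then V else fun _ _ => 0
      w₁ := fun s s' => if s' = (none, true) then twoEntry (none, true) (none, true) (-1) 0 s
        else if s' = (some .t, true) then twoEntry (some .t, true) (none, true) 1 0 s else 0
      -- The positive accumulator rests at `-15`. A hit adds the normalized value of `4`, `8`, `12`
      -- or `15`, which is at least `4`, and so lifts it to `-11` or more. The hidden unit is hence
      -- `4` without a hit and `0` with one.
      b₁ := fun s => if s = (none, true) then -11 else 0
      w₂ := fun s s' => if s'.1 = some .t then
        twoEntry (none, true) (some .t, true) (-litSign s'.2) (-litSign s'.2) s else 0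
      -- For `t`, the bias minus the indicator of a miss minus the old value is the change that
      -- overwrites the register. For the accumulator, `-15` is normalized to `-10`, which takes any
      -- value up to `-5` back to `-15` by saturation.
      b₂ := fun s => if s.1 = some .t then 4 * litSign s.2
        else if s.1 = none then -15 * litSign s.2 else 0 }
  | .asg x a sa b sb so =>
    { q := fun _ _ => 0
      k := fun _ _ => 0
      v := fun _ _ => 0
      vShift := fun _ _ => 0
      -- The hidden unit `(x, true)` computes the conjunction, and `(x, false)` copies the old value
      -- of `x`; the output layer subtracts the copy, so that the residual addition overwrites the
      -- register.
      w₁ := fun s s' => if s' = (some x, true) then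
          twoEntry (some a, true) (some b, true) (litSign sa) (litSign sb) s
        else if s' = (some x, false) then twoEntry (some x, true) (none, true) 1 0 s else 0
      b₁ := fun s => if s = (some x, true) then
        4 * ((if sa then 0 else 1) + (if sb then 0 else 1) - 1) else 0
      w₂ := fun s s' => if s'.1 = some x then
        twoEntry (some x, true) (some x, false) (litSign so * litSign s'.2) (-litSign s'.2) s else 0
      b₂ := fun s => if s.1 = some x then (if so then 0 else 4 * litSign s.2) else 0 }

/-- The mantissa that a slot holds: `0` or `±1` for the registers, `∓15/4` for the accumulator. -/
def slotVal (β : Fld → Bool) : Slot → ℤ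
  | (some f, s) => if β f then 4 * litSign s else 0
  | (none, s) => -15 * litSign s

/-- The residual stream holds the boolean registers. -/
def Encodes {m P : ℕ} (β : State) (H : Hidden 2 (m * slots) P) : Prop :=
  ∀ (p : Fin P) (i : Fin m) (s : Slot), (H p (coord m (i, s))).mant = slotVal (β p i) s

theorem pairNorm_mul_litSign (z : ℤ) (s : Bool) :
    Fixed.pairNorm (z * litSign s) = Fixed.pairNorm z * litSign s := by
  cases s
  · simp only [litSign, Bool.false_eq_true, if_false, mul_neg, mul_one, Fixed.pairNorm, abs_neg,
      Int.sign_neg, neg_mul]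
    split_ifs <;> ring
  · simp [litSign]

/-- Layer normalization of a vector of pairs of opposite numbers, in terms of mantissas. -/
theorem mant_layerNorm_pairs {m : ℕ} (T : LayerTable) {ε : Fixed 2} (hε : ε.mant = 1)
    (x : Fin (m * slots) → Fixed 2) (i : Fin m) (f : Option Fld) (z : ℤ)
    (hx : ∀ s, (x (coord m (i, f, s))).mant = z * litSign s) (ht : Fixed.Tame z) (s : Bool) :
    (layerNorm (T.layer m).part ε x (coord m (i, f, s))).mant = Fixed.pairNorm z * litSign s := by
  rw [mant_layerNorm T hε x i f, hx, pairNorm_mul_litSign]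
  · rw [hx, hx]; simp [litSign]
  · rw [hx]; simpa [litSign] using ht

/-- Sums of numbers zero and minus one. -/
theorem mant_sum_penalties {n : ℕ} (f : Fin n → Fixed 2)
    (h : ∀ i, (f i).mant = 0 ∨ (f i).mant = -4) :
    ((Fixed.sum (List.ofFn f)).mant = 0 ∨ (Fixed.sum (List.ofFn f)).mant ≤ -4) ∧
      ((Fixed.sum (List.ofFn f)).mant = 0 ↔ ∀ i, (f i).mant = 0) := by
  have hle : ∀ i, (f i).mant ≤ 0 := fun i => by rcases h i with h | h <;> omega
  rw [Fixed.mant_sum_nonpos f hle]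
  by_cases hall : ∀ i, (f i).mant = 0
  · simp [hall]
  · have : ∑ i, (f i).mant ≤ -4 := by
      push Not at hall
      obtain ⟨j, hj⟩ := hall
      have h1 : (f j).mant = -4 := by rcases h j with h | h <;> omega
      rw [← h1]
      have := Finset.sum_le_sum_of_subset_of_nonneg (f := fun i => -(f i).mant)
        (Finset.subset_univ {j}) (fun i _ _ => by have := hle i; omega)
      simp only [Finset.sum_singleton, Finset.sum_neg_distrib] at this
      omega
    refine ⟨by omega, iff_of_false (by omega) hall⟩

theorem abs_slotVal_le (β : Fld → Bool) (s : Slot) : |slotVal β s| ≤ 15 := by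
  obtain ⟨f | f, s⟩ := s <;> cases s <;> simp only [slotVal, litSign] <;> split_ifs <;> simp

/-! ### Attention layers as disjunctions over matching positions. -/

section Attention

variable {m P : ℕ} {β : State} {H : Hidden 2 (m * slots) P} (hH : Encodes β H)
  (a₁ b₁ a₂ b₂ v : Fld) (sh : Bool)
include hH

theorem mant_att_query (p : Fin P) (i : Fin m) (s : Slot) :
    (vecMul (H p) (((Instr.att a₁ b₁ a₂ b₂ v sh).table.layer m).WQ) (coord m (i, s))).mant =
      if s = (none, true) then (if β p i a₁ then 4 else 0)
      else if s = (none, false) then (if β p i a₂ then 4 else 0) else 0 := by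
  have h15 : ∀ f, |(if β p i f = true then (4 : ℤ) else 0) * 1| + 0 ≤ 15 := by
    intro f; split_ifs <;> norm_num
  by_cases h1 : s = (none, true)
  · subst h1
    refine (mant_vecMul_two (H p) i (none, true) (some a₁, true) (none, true) 1 0 ?_ (by simp)
      (by simp) ?_).trans ?_
    · intro s'; simp [Instr.table, twoEntry]
    · simpa [hH p i, slotVal, litSign] using h15 a₁
    · simp [hH p i, slotVal, litSign]
  by_cases h2 : s = (none, false)
  · subst h2
    refine (mant_vecMul_two (H p) i (none, false) (some a₂, true) (none, true) 1 0 ?_ (by simp)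
      (by simp) ?_).trans ?_
    · intro s'; simp [Instr.table, twoEntry]
    · simpa [hH p i, slotVal, litSign] using h15 a₂
    · simp [hH p i, slotVal, litSign]
  · rw [if_neg h1, if_neg h2]
    exact mant_vecMul_zero _ _ _ fun s' => by simp [Instr.table, h1, h2]

theorem mant_att_key (p : Fin P) (i : Fin m) (s : Slot) :
    (vecMul (H p) (((Instr.att a₁ b₁ a₂ b₂ v sh).table.layer m).WK) (coord m (i, s))).mant =
      if s = (none, true) then (if β p i b₁ then -4 else 0)
      else if s = (none, false) then (if β p i b₂ then -4 else 0) else 0 := by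
  have h15 : ∀ f, |(if β p i f = true then (-4 : ℤ) else 0)| ≤ 15 := by
    intro f; split_ifs <;> norm_num
  by_cases h1 : s = (none, true)
  · subst h1
    refine (mant_vecMul_two (H p) i (none, true) (some b₁, true) (none, true) (-1) 0 ?_ (by simp)
      (by simp) ?_).trans ?_
    · intro s'; simp [Instr.table, twoEntry]
    · have := h15 b₁; simp [hH p i, slotVal, litSign]; split_ifs <;> simp
    · simp [hH p i, slotVal, litSign]; split_ifs <;> simp
  by_cases h2 : s = (none, false)
  · subst h2
    refine (mant_vecMul_two (H p) i (none, false) (some b₂, true) (none, true) (-1) 0 ?_ (by simp)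
      (by simp) ?_).trans ?_
    · intro s'; simp [Instr.table, twoEntry]
    · have := h15 b₂; simp [hH p i, slotVal, litSign]; split_ifs <;> simp
    · simp [hH p i, slotVal, litSign]; split_ifs <;> simp
  · rw [if_neg h1, if_neg h2]
    exact mant_vecMul_zero _ _ _ fun s' => by simp [Instr.table, h1, h2]

/-- Each coordinate contributes `-1` if a query bit meets a key bit, and `0` otherwise. All terms
have the same sign, so saturation cannot bring a negative sum back to zero. -/
theorem mant_att_score (p j : Fin P) :
    let l := (Instr.att a₁ b₁ a₂ b₂ v sh).table.layer m
    let s := Fixed.dot (vecMul (H p) l.WQ) (vecMul (H j) l.WK)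
    (s.mant = 0 ∨ s.mant ≤ -4) ∧ (s.mant = 0 ↔ Matches m β a₁ b₁ a₂ b₂ p j) := by
  intro l s
  have hterm : ∀ (i : Fin m) (sl : Slot),
      (Fixed.mul (vecMul (H p) l.WQ (coord m (i, sl))) (vecMul (H j) l.WK (coord m (i, sl)))).mant =
      if sl = (none, true) then (if β p i a₁ = true ∧ β j i b₁ = true then -4 else 0)
      else if sl = (none, false) then (if β p i a₂ = true ∧ β j i b₂ = true then -4 else 0)
      else 0 := by
    intro i sl
    have hq := mant_att_query hH a₁ b₁ a₂ b₂ v sh p i sl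
    have hk := mant_att_key hH a₁ b₁ a₂ b₂ v sh j i sl
    have : (vecMul (H j) l.WK (coord m (i, sl))).mant = 4 *
      (if sl = (none, true) then (if β j i b₁ then -1 else 0)
      else if sl = (none, false) then (if β j i b₂ then -1 else 0) else 0) := by
      rw [hk]; split_ifs <;> rfl
    rw [Fixed.mant_mul_int this, hq]
    by_cases h1 : sl = (none, true)
    · simp only [h1, if_true]
      cases β p i a₁ <;> cases β j i b₁ <;> decide
    by_cases h2 : sl = (none, false)
    · subst h2
      cases β p i a₂ <;> cases β j i b₂ <;> simp [Fixed.clamp]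
    · simp [h1, h2, Fixed.clamp]
  obtain ⟨h1, h2⟩ := mant_sum_penalties
    (fun y => Fixed.mul (vecMul (H p) l.WQ y) (vecMul (H j) l.WK y)) (by
      intro y
      obtain ⟨⟨i, sl⟩, rfl⟩ := (coord m).surjective y
      rw [hterm]; split_ifs <;> simp)
  refine ⟨h1, h2.trans ?_⟩
  constructor
  · intro h i hi
    have e1 := h (coord m (⟨i, hi⟩, none, true))
    have e2 := h (coord m (⟨i, hi⟩, none, false))
    rw [hterm] at e1 e2
    simp only [if_true, Prod.mk.injEq, Bool.false_eq_true, and_false, if_false] at e1 e2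
    constructor
    · intro hc; rw [if_pos hc] at e1; omega
    · intro hc; rw [if_pos hc] at e2; omega
  · intro h y
    obtain ⟨⟨i, sl⟩, rfl⟩ := (coord m).surjective y
    obtain ⟨h3, h4⟩ := h i i.2
    rw [hterm, if_neg h3, if_neg h4]; split_ifs <;> rfl

/-- The band above the diagonal moves bit number `i - 1` into block `i`; block `0` receives nothing.
-/
theorem mant_att_value (p : Fin P) (i : Fin m) (s : Slot) :
    (vecMul (H p) (((Instr.att a₁ b₁ a₂ b₂ v sh).table.layer m).WV) (coord m (i, s))).mant =
      if s.1 = none ∧ source β v sh p i = true then 15 * litSign s.2 else 0 := by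
  have hl : |15 * litSign s.2| ≤ 15 := by unfold litSign; split_ifs <;> norm_num
  have hent : ∀ s' : Slot, |(if s.1 = none ∧ s' = (some v, true) then 15 * litSign s.2 else 0)| ≤ 15 := by
    intro s'; split_ifs; exacts [hl, by norm_num]
  have hmul : ∀ (x y : Fixed 2) (c : Bool), x.mant = (if c then 4 else 0) →
      y.mant = 15 * litSign s.2 →
      (Fixed.mul x y).mant = if c then 15 * litSign s.2 else 0 := by
    intro x y c hx hy
    cases c
    · simpa using Fixed.mul_zero_left y (by simpa using hx)
    · rw [Fixed.mant_mul_comm, Fixed.mant_mul_int (c := 1) (by simpa using hx), hy, mul_one,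
        Fixed.clamp_of_abs_le hl]; rfl
  cases sh with
  | false =>
    have hW : ∀ (i' : Fin m) (s' : Slot),
        (((Instr.att a₁ b₁ a₂ b₂ v false).table.layer m).WV (coord m (i', s')) (coord m (i, s))).mant =
        if i' = i ∧ s.1 = none ∧ s' = (some v, true) then 15 * litSign s.2 else 0 := by
      intro i' s'
      simp only [LayerTable.layer, Instr.table, Bool.false_eq_true, if_false]
      rw [blockMat_coord _ _ _ _ (hent s')]
      by_cases h : i' = i <;> simp [h]
    rw [vecMul, Fixed.mant_dot_single (coord m (i, some v, true))]
    · by_cases hn : s.1 = none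
      · rw [hmul _ _ (β p i v) (by rw [hH p i]; simp [slotVal, litSign])
          (by rw [hW, if_pos ⟨rfl, hn, rfl⟩])]
        simp [hn, source]
      · rw [if_neg (by tauto), Fixed.mant_mul_comm, Fixed.mul_zero_left]
        rw [hW, if_neg (by tauto)]
    · intro y hy
      obtain ⟨⟨i', s'⟩, rfl⟩ := (coord m).surjective y
      rw [hW, if_neg]
      rintro ⟨rfl, -, rfl⟩
      exact hy rfl
  | true =>
    have hW : ∀ (i' : Fin m) (s' : Slot),
        (((Instr.att a₁ b₁ a₂ b₂ v true).table.layer m).WV (coord m (i', s')) (coord m (i, s))).mant =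
        if (i : ℕ) = i' + 1 ∧ s.1 = none ∧ s' = (some v, true) then 15 * litSign s.2 else 0 := by
      intro i' s'
      simp only [LayerTable.layer, Instr.table, if_true, blockMat, Equiv.symm_apply_apply]
      by_cases h : i = i'
      · subst h
        simp only [if_true, ite_and]
        rw [if_neg (by omega)]; exact Fixed.mant_ofMant (by simp)
      · rw [if_neg h]
        by_cases h2 : (i : ℕ) = i' + 1
        · rw [if_pos h2, Fixed.mant_ofMant (hent s')]; simp [h2]
        · rw [if_neg h2, if_neg (by tauto)]; exact Fixed.mant_zero
    by_cases hi : (i : ℕ) = 0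
    · rw [vecMul, Fixed.mant_dot_zero]
      · simp [source, hi]
      · intro y
        obtain ⟨⟨i', s'⟩, rfl⟩ := (coord m).surjective y
        rw [hW, if_neg (by omega)]
    · rw [vecMul, Fixed.mant_dot_single (coord m (⟨i - 1, by omega⟩, some v, true))]
      · by_cases hn : s.1 = none
        · rw [hmul _ _ (β p (i - 1) v) (by rw [hH p]; simp [slotVal, litSign])
            (by rw [hW, if_pos ⟨by simp; omega, hn, rfl⟩])]
          simp [hn, source, hi]
        · rw [if_neg (by tauto), Fixed.mant_mul_comm, Fixed.mul_zero_left]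
          rw [hW, if_neg (by tauto)]
      · intro y hy
        obtain ⟨⟨i', s'⟩, rfl⟩ := (coord m).surjective y
        rw [hW, if_neg]
        rintro ⟨h1, -, rfl⟩
        apply hy
        congr
        ext; simp; omega

/-- The position granted by `Ok` matches every query, so no normalizer vanishes. Only the zero test
of `a` carries information; its size depends on the number of matches. -/
theorem exists_att_attend (κ : AttnKind) {τ : Fixed 2} (hτ : τ.mant = 1)
    (hok : (Instr.att a₁ b₁ a₂ b₂ v sh).Ok P m β) :
    ∃ A : Hidden 2 (m * slots) P,
      ((Instr.att a₁ b₁ a₂ b₂ v sh).table.layer m).attend κ τ H = some A ∧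
      ∀ (p : Fin P) (i : Fin m), ∃ a : ℤ, (a = 0 ∨ a = 4 ∨ a = 8 ∨ a = 12 ∨ a = 15) ∧
        (a = 0 ↔ ¬ ∃ j < P, Matches m β a₁ b₁ a₂ b₂ p j ∧ source β v sh j i = true) ∧
        ∀ f s, (A p (coord m (i, f, s))).mant = if f = none then a * litSign s else 0 := by
  classical
  set l := (Instr.att a₁ b₁ a₂ b₂ v sh).table.layer m with hl
  obtain ⟨j₀, hj₀, hj⟩ := hok
  have hM0 : ∀ p : Fin P, Matches m β a₁ b₁ a₂ b₂ p j₀ := fun p i hi => by simp [hj i hi]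
  have he : ∀ p j : Fin P, (rawWeights κ τ (fun j => Fixed.dot (vecMul (H p) l.WQ)
      (vecMul (H j) l.WK)) j).mant = if Matches m β a₁ b₁ a₂ b₂ p j then 4 else 0 := by
    intro p j
    have hs := fun j => mant_att_score hH a₁ b₁ a₂ b₂ v sh p j
    rw [mant_rawWeights κ hτ _ (fun j => (hs j).1) ⟨⟨j₀, hj₀⟩, (hs ⟨j₀, hj₀⟩).2.2 (hM0 p)⟩]
    simp only [(hs j).2]
  have hatt := fun (p : Fin P) (c : Fin (m * slots)) (B : Fin P → Prop) (σ : ℤ) (hσ : σ = 1 ∨ σ = -1)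
      (hv : ∀ j, (vecMul (H j) l.WV c).mant = if B j then 15 * σ else 0) =>
    mant_attention (fun j : Fin P => Matches m β a₁ b₁ a₂ b₂ p j) B σ hσ (he p) hv
      ⟨⟨j₀, hj₀⟩, hM0 p⟩
  have hZ : ∀ p, Fixed.sum (List.ofFn (rawWeights κ τ fun j => Fixed.dot (vecMul (H p) l.WQ)
      (vecMul (H j) l.WK))) ≠ 0 := by
    intro p
    exact (mant_attention (v := fun _ => 0) (fun j : Fin P => Matches m β a₁ b₁ a₂ b₂ p j)
      (fun _ => False) 1 (Or.inl rfl) (he p) (by simp) ⟨⟨j₀, hj₀⟩, hM0 p⟩).1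
  refine ⟨_, by rw [Layer.attend]; exact if_pos hZ, ?_⟩
  intro p i
  have hlit : ∀ s, litSign s = 1 ∨ litSign s = -1 := by intro s; cases s <;> simp [litSign]
  have hval := fun (s : Bool) => hatt p (coord m (i, none, s))
    (fun j => source β v sh j i = true) (litSign s) (hlit s) (fun j => by
      rw [mant_att_value hH a₁ b₁ a₂ b₂ v sh j i]; simp)
  obtain ⟨-, a, h1, h2, h3, h4⟩ := hval true
  refine ⟨a, h2, ?_, ?_⟩
  · rw [h3]
    constructor
    · rintro h ⟨j, hj, h'⟩; exact h ⟨⟨j, hj⟩, h'⟩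
    · rintro h ⟨j, h'⟩; exact h ⟨j, j.2, h'⟩
  · intro f s
    cases f with
    | none =>
      obtain ⟨-, a', h1', -, -, h4'⟩ := hval s
      rw [if_pos rfl, h4, ← h4']
      exact h1'
    | some f =>
      rw [if_neg (by simp)]
      obtain ⟨-, a', h1', -, h3', -⟩ := hatt p (coord m (i, some f, s)) (fun _ => False) 1
        (Or.inl rfl) (fun j => by rw [mant_att_value hH a₁ b₁ a₂ b₂ v sh j i]; simp)
      have : a' = 0 := h3'.2 (by simp)
      rw [this, zero_mul] at h1'
      exact h1'

end Attention

/-- The mantissa in the positive slot of a register or of the accumulator. -/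
def regVal (β : Fld → Bool) : Option Fld → ℤ
  | some f => if β f then 4 else 0
  | none => -15

theorem slotVal_eq (β : Fld → Bool) (f : Option Fld) (s : Bool) :
    slotVal β (f, s) = regVal β f * litSign s := by
  cases f <;> simp [slotVal, regVal]

theorem clamp_mul_litSign (z : ℤ) (s : Bool) :
    Fixed.clamp (z * litSign s) = Fixed.clamp z * litSign s := by
  cases s <;> simp only [litSign, Fixed.clamp, if_true, Bool.false_eq_true, if_false] <;> omega

/-- Reduces a layer to integer arithmetic on positive slots: `a` is the output of attention, `g` the
stream between the sub-layers, `o` the output of the network. All vectors are odd in the sign of the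
slot, so layer normalization acts through `pairNorm`. -/
theorem exists_apply {m P : ℕ} {β β' : State} {H A : Hidden 2 (m * slots) P} (hH : Encodes β H)
    (T : LayerTable) (κ : AttnKind) {τ ε : Fixed 2} (hε : ε.mant = 1)
    (hA : (T.layer m).attend κ τ H = some A) (a g o : Fin P → Fin m → Option Fld → ℤ)
    (ha : ∀ p i f s, (A p (coord m (i, f, s))).mant = a p i f * litSign s)
    (hat : ∀ p i f, Fixed.Tame (a p i f))
    (hg : ∀ p i f, Fixed.clamp (Fixed.pairNorm (a p i f) + regVal (β p i) f) = g p i f)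
    (ho : ∀ (p : Fin P) (x : Fin (m * slots) → Fixed 2),
      (∀ i f s, (x (coord m (i, f, s))).mant = g p i f * litSign s) →
      ∀ i f s, ((T.layer m).feedForward x (coord m (i, f, s))).mant = o p i f * litSign s)
    (hot : ∀ p i f, Fixed.Tame (o p i f))
    (hβ : ∀ p i f, Fixed.clamp (g p i f + Fixed.pairNorm (o p i f)) = regVal (β' p i) f) :
    ∃ H', (T.layer m).apply κ τ ε H = some H' ∧ Encodes β' H' := by
  refine ⟨_, by rw [Layer.apply, hA]; rfl, ?_⟩
  intro p i ⟨f, s⟩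
  have hG : ∀ i f s, (Fixed.add (layerNorm (T.layer m).part ε (A p) (coord m (i, f, s)))
      (H p (coord m (i, f, s)))).mant = g p i f * litSign s := by
    intro i f s
    rw [Fixed.mant_add, mant_layerNorm_pairs T hε _ i f _ (ha p i f) (hat p i f), hH, slotVal_eq,
      ← add_mul, clamp_mul_litSign, hg]
  have hF := ho p (fun c => Fixed.add (layerNorm (T.layer m).part ε (A p) c) (H p c)) hG
  rw [Fixed.mant_add, hG, mant_layerNorm_pairs T hε _ i f _ (hF i f) (hot p i f), ← add_mul,
    clamp_mul_litSign, hβ, slotVal_eq]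

/-- With zero keys all positions match, which keeps the normalizer nonzero, and with zero values
attention adds nothing. -/
theorem exists_asg_attend {m P : ℕ} (H : Hidden 2 (m * slots) P) (x a b : Fld) (sa sb so : Bool)
    (κ : AttnKind) {τ : Fixed 2} (hτ : τ.mant = 1) :
    ∃ A : Hidden 2 (m * slots) P,
      ((Instr.asg x a sa b sb so).table.layer m).attend κ τ H = some A ∧
      ∀ p i s, (A p (coord m (i, s))).mant = 0 := by
  classical
  set l := (Instr.asg x a sa b sb so).table.layer m with hl
  have hK : ∀ (j : Fin P) y, (vecMul (H j) l.WK y).mant = 0 := by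
    intro j y
    obtain ⟨⟨i, s⟩, rfl⟩ := (coord m).surjective y
    exact mant_vecMul_zero _ _ _ fun _ => rfl
  have hV : ∀ (j : Fin P) y, (vecMul (H j) l.WV y).mant = 0 := by
    intro j y
    obtain ⟨⟨i, s⟩, rfl⟩ := (coord m).surjective y
    exact mant_vecMul_zero _ _ _ fun _ => rfl
  have hs : ∀ p j : Fin P, (Fixed.dot (vecMul (H p) l.WQ) (vecMul (H j) l.WK)).mant = 0 :=
    fun p j => Fixed.mant_dot_zero (hK j)
  have he : ∀ p j : Fin P, (rawWeights κ τ (fun j => Fixed.dot (vecMul (H p) l.WQ)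
      (vecMul (H j) l.WK)) j).mant = if True then 4 else 0 := by
    intro p j
    rw [mant_rawWeights κ hτ _ (fun j => Or.inl (hs p j)) ⟨p, hs p p⟩, if_pos (hs p j), if_pos trivial]
  have hatt := fun (p : Fin P) (c : Fin (m * slots)) =>
    mant_attention (v := fun j => vecMul (H j) l.WV c) (fun _ : Fin P => True) (fun _ => False) 1
      (Or.inl rfl) (he p) (fun j => by rw [hV]; simp) ⟨p, trivial⟩
  have hZ : ∀ p, Fixed.sum (List.ofFn (rawWeights κ τ fun j => Fixed.dot (vecMul (H p) l.WQ)
      (vecMul (H j) l.WK))) ≠ 0 := fun p =>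
    (mant_attention (v := fun _ => 0) (fun _ : Fin P => True) (fun _ => False) 1
      (Or.inl rfl) (he p) (by simp) ⟨p, trivial⟩).1
  refine ⟨_, by rw [Layer.attend]; exact if_pos hZ, ?_⟩
  intro p i s
  obtain ⟨-, z, h1, -, h3, -⟩ := hatt p (coord m (i, s))
  rw [h3.2 (by simp), zero_mul] at h1
  exact h1

/-- The value of a hidden unit of the feed-forward network. -/
theorem mant_hidden {m : ℕ} {T : LayerTable} (x : Fin (m * slots) → Fixed 2) (i : Fin m)
    (s a b : Slot) (α β : ℤ)
    (hT : ∀ s', T.w₁ s' s = 4 * ((if s' = a then α else 0) + (if s' = b then β else 0)))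
    (hα : |α| ≤ 1) (hβ : |β| ≤ 1)
    (hb : |(x (coord m (i, a))).mant * α| + |(x (coord m (i, b))).mant * β| ≤ 15)
    (hb₁ : |T.b₁ s| ≤ 15) :
    (Fixed.relu (Fixed.add (vecMul x (T.layer m).W₁ (coord m (i, s)))
      ((T.layer m).bias₁ (coord m (i, s))))).mant =
    max 0 (Fixed.clamp ((x (coord m (i, a))).mant * α + (x (coord m (i, b))).mant * β + T.b₁ s)) := by
  rw [Fixed.mant_relu, Fixed.mant_add]
  congr 2
  rw [← mant_vecMul_two (T := T.w₁) x i s a b α β hT hα hβ hb]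
  congr 1
  exact blockVec_coord _ _ hb₁

/-- The value of an output unit of the feed-forward network. -/
theorem mant_feedForward {m : ℕ} {T : LayerTable} (x : Fin (m * slots) → Fixed 2) (i : Fin m)
    (s a b : Slot) (α β y z : ℤ)
    (hT : ∀ s', T.w₂ s' s = 4 * ((if s' = a then α else 0) + (if s' = b then β else 0)))
    (hα : |α| ≤ 1) (hβ : |β| ≤ 1) (hb₂ : |T.b₂ s| ≤ 15)
    (hy : (Fixed.relu (Fixed.add (vecMul x (T.layer m).W₁ (coord m (i, a)))
      ((T.layer m).bias₁ (coord m (i, a))))).mant = y)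
    (hz : (Fixed.relu (Fixed.add (vecMul x (T.layer m).W₁ (coord m (i, b)))
      ((T.layer m).bias₁ (coord m (i, b))))).mant = z)
    (hb : |y * α| + |z * β| ≤ 15) :
    ((T.layer m).feedForward x (coord m (i, s))).mant = Fixed.clamp (y * α + z * β + T.b₂ s) := by
  subst hy hz
  unfold Layer.feedForward
  rw [Fixed.mant_add]
  congr 2
  · exact mant_vecMul_two (T := T.w₂) _ i s a b α β hT hα hβ hb
  · exact blockVec_coord _ _ hb₂

theorem mant_feedForward_bias {m : ℕ} {T : LayerTable} (x : Fin (m * slots) → Fixed 2) (i : Fin m)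
    (s : Slot) (hT : ∀ s', T.w₂ s' s = 0) (hb₂ : |T.b₂ s| ≤ 15) :
    ((T.layer m).feedForward x (coord m (i, s))).mant = T.b₂ s := by
  unfold Layer.feedForward
  rw [Fixed.mant_add]
  have h1 := mant_vecMul_zero (T := T.w₂) (fun j => Fixed.relu (Fixed.add (vecMul x (T.layer m).W₁ j)
    ((T.layer m).bias₁ j))) i s hT
  have h2 : ((T.layer m).bias₂ (coord m (i, s))).mant = T.b₂ s := blockVec_coord _ _ hb₂
  rw [h2]
  erw [h1]
  rw [zero_add, Fixed.clamp_of_abs_le hb₂]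

theorem tame_zero : Fixed.Tame 0 := Or.inl rfl

/-- A negated literal is one minus its register; subtracting one from the sum of both literals
leaves a positive number only if both hold. -/
theorem mant_conjunction : ∀ sa sb a b : Bool,
    max 0 (Fixed.clamp (4 * (a.toNat : ℤ) * litSign sa + 4 * (b.toNat : ℤ) * litSign sb +
      4 * ((if sa then 0 else 1) + (if sb then 0 else 1) - 1))) =
    4 * (((a == sa) && (b == sb)).toNat : ℤ) := by decide

theorem mant_conjunction_le : ∀ sa sb a b : Bool,
    |4 * (a.toNat : ℤ) * litSign sa| + |4 * (b.toNat : ℤ) * litSign sb| ≤ 15 := by decide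

theorem mant_assignment : ∀ so s c x : Bool,
    Fixed.clamp (4 * (c.toNat : ℤ) * (litSign so * litSign s) + 4 * (x.toNat : ℤ) * (-litSign s) +
      (if so then 0 else 4 * litSign s)) =
    (4 * ((c == so).toNat : ℤ) - 4 * x.toNat) * litSign s := by decide

theorem mant_assignment_le : ∀ so s c x : Bool,
    |4 * (c.toNat : ℤ) * (litSign so * litSign s)| + |4 * (x.toNat : ℤ) * (-litSign s)| ≤ 15 := by
  decide

theorem mant_detection : ∀ s c x : Bool,
    Fixed.clamp ((if c then 0 else 4) * (-litSign s) + 4 * (x.toNat : ℤ) * (-litSign s) +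
      4 * litSign s) =
    ((if c then 4 else 0) - 4 * (x.toNat : ℤ)) * litSign s := by decide

theorem mant_detection_le : ∀ s c x : Bool,
    |(if c then 0 else 4) * (-litSign s)| + |4 * (x.toNat : ℤ) * (-litSign s)| ≤ 15 := by decide

theorem max_zero_clamp_bit (x : Bool) (z : ℤ) :
    max 0 (Fixed.clamp (4 * (x.toNat : ℤ) * 1 + z * 0 + 0)) = 4 * (x.toNat : ℤ) := by
  rw [mul_zero]; cases x <;> decide

theorem exists_apply_asg {m P : ℕ} {β : State} {H : Hidden 2 (m * slots) P} (hH : Encodes β H)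
    (κ : AttnKind) {τ ε : Fixed 2} (hτ : τ.mant = 1) (hε : ε.mant = 1)
    (x a b : Fld) (sa sb so : Bool) :
    ∃ H', ((Instr.asg x a sa b sb so).table.layer m).apply κ τ ε H = some H' ∧
      Encodes ((Instr.asg x a sa b sb so).eval P m β) H' := by
  obtain ⟨A, hA, hA0⟩ := exists_asg_attend H x a b sa sb so κ hτ
  have hreg : ∀ (γ : Fld → Bool) f, |regVal γ f| ≤ 15 := by
    intro γ f
    cases f with
    | none => norm_num [regVal]
    | some f => simp only [regVal]; split_ifs <;> norm_num
  have hb : ∀ c : Bool, (if c then (4 : ℤ) else 0) = 4 * c.toNat := by intro c; cases c <;> rfl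
  refine exists_apply hH (Instr.asg x a sa b sb so).table κ hε hA (fun _ _ _ => 0)
    (fun p i f => regVal (β p i) f)
    (fun p i f => if f = some x then
      (4 * ((((β p i a == sa) && (β p i b == sb)) == so).toNat : ℤ) - 4 * (β p i x).toNat) else 0)
    (by simp [hA0]) (fun _ _ _ => tame_zero) ?_ ?_ ?_ ?_
  · intro p i f; simpa [Fixed.pairNorm] using Fixed.clamp_of_abs_le (hreg _ f)
  · intro p y hy i f s
    by_cases hf : f = some x
    · subst hf
      have hlit : |litSign s| ≤ 1 := by cases s <;> simp [litSign]
      have hlo : |litSign so * litSign s| ≤ 1 := by cases s <;> cases so <;> simp [litSign]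
      have hya : (y (coord m (i, some a, true))).mant = 4 * (β p i a).toNat := by
        rw [hy]; simp [regVal, litSign, hb]
      have hyb : (y (coord m (i, some b, true))).mant = 4 * (β p i b).toNat := by
        rw [hy]; simp [regVal, litSign, hb]
      have hyx : (y (coord m (i, some x, true))).mant = 4 * (β p i x).toNat := by
        rw [hy]; simp [regVal, litSign, hb]
      have hyn : (y (coord m (i, none, true))).mant = -15 := by
        rw [hy]; simp [regVal, litSign]
      have h1 := mant_hidden (T := (Instr.asg x a sa b sb so).table) y i (some x, true)
        (some a, true) (some b, true) (litSign sa) (litSign sb) (by intro s'; simp [Instr.table, twoEntry])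
        (by cases sa <;> simp [litSign]) (by cases sb <;> simp [litSign])
        (by rw [hya, hyb]; exact mant_conjunction_le ..)
        (by simp only [Instr.table]; cases sa <;> cases sb <;> simp)
      have h2 := mant_hidden (T := (Instr.asg x a sa b sb so).table) y i (some x, false)
        (some x, true) (none, true) 1 0 (by intro s'; simp [Instr.table, twoEntry])
        (by simp) (by simp)
        (by rw [hyx]; cases β p i x <;> simp)
        (by simp [Instr.table])
      rw [hya, hyb] at h1
      rw [hyx] at h2
      replace h1 := h1.trans (by simpa only [Instr.table, if_true] using mant_conjunction sa sb _ _)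
      replace h2 := h2.trans (by simpa [Instr.table] using max_zero_clamp_bit (β p i x) 0)
      rw [mant_feedForward y i (some x, s) (some x, true) (some x, false) (litSign so * litSign s)
        (-litSign s) _ _ (by intro s'; simp [Instr.table, twoEntry]) hlo (by rwa [abs_neg])
        (by simp only [Instr.table]; cases so <;> cases s <;> simp [litSign]) h1 h2
        (mant_assignment_le ..)]
      rw [if_pos rfl, ← mant_assignment]
      simp only [Instr.table, if_true]
    · rw [mant_feedForward_bias]
      · simp [Instr.table, hf]
      · intro s'; simp [Instr.table, hf]
      · simp [Instr.table, hf]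
  · intro p i f
    split_ifs with hf
    · cases ((β p i a == sa) && (β p i b == sb)) == so <;> cases β p i x <;> simp [Fixed.Tame]
    · exact tame_zero
  · intro p i f
    cases f with
    | none => simp [regVal, Fixed.pairNorm, Fixed.clamp]
    | some f =>
      by_cases hf : f = x
      · subst hf
        simp only [Instr.eval, regVal, if_true]
        cases ((β p i a == sa) && (β p i b == sb)) == so <;> cases β p i f <;>
          simp [Fixed.pairNorm, Fixed.clamp]
      · have : some f ≠ some x := by simpa using hf
        simp only [if_neg this, Instr.eval, if_neg hf, regVal]
        cases β p i f <;> simp [Fixed.pairNorm, Fixed.clamp]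

theorem exists_apply_att {m P : ℕ} {β : State} {H : Hidden 2 (m * slots) P} (hH : Encodes β H)
    (κ : AttnKind) {τ ε : Fixed 2} (hτ : τ.mant = 1) (hε : ε.mant = 1)
    (a₁ b₁ a₂ b₂ v : Fld) (sh : Bool) (hok : (Instr.att a₁ b₁ a₂ b₂ v sh).Ok P m β) :
    ∃ H', ((Instr.att a₁ b₁ a₂ b₂ v sh).table.layer m).apply κ τ ε H = some H' ∧
      Encodes ((Instr.att a₁ b₁ a₂ b₂ v sh).eval P m β) H' := by
  classical
  obtain ⟨A, hA, hA'⟩ := exists_att_attend hH a₁ b₁ a₂ b₂ v sh κ hτ hok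
  choose z hz hz0 hzA using hA'
  have hb : ∀ c : Bool, (if c then (4 : ℤ) else 0) = 4 * c.toNat := by intro c; cases c <;> rfl
  refine exists_apply hH (Instr.att a₁ b₁ a₂ b₂ v sh).table κ hε hA
    (fun p i f => if f = none then z p i else 0)
    (fun p i f => if f = none then -15 + Fixed.pairNorm (z p i) else regVal (β p i) f)
    (fun p i f => if f = some .t then (if z p i = 0 then 0 else 4) - 4 * ((β p i .t).toNat : ℤ)
      else if f = none then -15 else 0) ?_ ?_ ?_ ?_ ?_ ?_
  · intro p i f s; rw [hzA]; split_ifs <;> simp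
  · intro p i f
    split_ifs
    · unfold Fixed.Tame
      rcases hz p i with h | h | h | h | h <;> simp [h]
    · exact tame_zero
  · intro p i f
    cases f with
    | none =>
      simp only [if_true, regVal]
      rcases hz p i with h | h | h | h | h <;> rw [h] <;> decide
    | some f => cases h : β p i f <;> simp [regVal, h, Fixed.pairNorm, Fixed.clamp]
  · intro p y hy i f s
    by_cases hf : f = some .t
    · subst hf
      have hlit : |(-litSign s)| ≤ 1 := by cases s <;> simp [litSign]
      have hyt : (y (coord m (i, some .t, true))).mant = 4 * (β p i .t).toNat := by
        rw [hy]; simp [regVal, litSign, hb]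
      have hyn : (y (coord m (i, none, true))).mant = -15 + Fixed.pairNorm (z p i) := by
        rw [hy]; simp [litSign]
      have h1 := mant_hidden (T := (Instr.att a₁ b₁ a₂ b₂ v sh).table) y i (none, true)
        (none, true) (none, true) (-1) 0 (by intro s'; simp [Instr.table, twoEntry])
        (by simp) (by simp)
        (by rw [hyn]; rcases hz p i with h | h | h | h | h <;> rw [h] <;> decide)
        (by simp [Instr.table])
      have h2 := mant_hidden (T := (Instr.att a₁ b₁ a₂ b₂ v sh).table) y i (some .t, true)
        (some .t, true) (none, true) 1 0 (by intro s'; simp [Instr.table, twoEntry])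
        (by simp) (by simp)
        (by rw [hyt]; cases β p i .t <;> simp)
        (by simp [Instr.table])
      rw [hyn] at h1
      rw [hyt] at h2
      replace h1 := h1.trans (show _ = if decide (z p i ≠ 0) = true then 0 else 4 by
        simp only [Instr.table, if_true]
        rcases hz p i with h | h | h | h | h <;> rw [h] <;> decide)
      replace h2 := h2.trans (by simpa [Instr.table] using max_zero_clamp_bit (β p i .t) 0)
      rw [mant_feedForward y i (some .t, s) (none, true) (some .t, true) (-litSign s)
        (-litSign s) _ _ (by intro s'; simp [Instr.table, twoEntry]) hlit hlit
        (by simp only [Instr.table]; cases s <;> simp [litSign]) h1 h2 (mant_detection_le ..)]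
      have := mant_detection s (decide (z p i ≠ 0)) (β p i .t)
      simp only [Instr.table, if_true] at this ⊢
      rw [this]
      simp
    · rw [mant_feedForward_bias]
      · simp only [Instr.table, if_neg hf]; split_ifs <;> ring
      · intro s'; simp [Instr.table, hf]
      · simp only [Instr.table, if_neg hf]; split_ifs <;> cases s <;> simp [litSign]
  · intro p i f
    split_ifs
    · cases β p i .t <;> simp [Fixed.Tame]
    · cases β p i .t <;> simp [Fixed.Tame]
    · simp [Fixed.Tame]
    · exact tame_zero
  · intro p i f
    cases f with
    | none =>
      simp only [if_true, regVal, reduceCtorEq, if_false]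
      rcases hz p i with h | h | h | h | h <;> rw [h] <;> decide
    | some f =>
      by_cases hf : f = .t
      · subst hf
        simp only [reduceCtorEq, Instr.eval, regVal, if_true, if_false, decide_eq_true_eq]
        by_cases h : z p i = 0
        · simp only [h, (hz0 p i).1 h, if_true, if_false]
          cases β p i .t <;> decide
        · simp only [h, not_not.1 (mt (hz0 p i).2 h), if_true, if_false]
          cases β p i .t <;> decide
      · simp only [reduceCtorEq, if_false, Instr.eval, regVal, Option.some.injEq, hf]
        cases β p i f <;> simp [Fixed.pairNorm, Fixed.clamp]

/-- Every instruction is implemented by its layer. -/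
theorem exists_apply_instr {m P : ℕ} {β : State} {H : Hidden 2 (m * slots) P} (hH : Encodes β H)
    (κ : AttnKind) {τ ε : Fixed 2} (hτ : τ.mant = 1) (hε : ε.mant = 1) (I : Instr)
    (hok : I.Ok P m β) :
    ∃ H', (I.table.layer m).apply κ τ ε H = some H' ∧ Encodes (I.eval P m β) H' := by
  cases I with
  | att a₁ b₁ a₂ b₂ v sh => exact exists_apply_att hH κ hτ hε a₁ b₁ a₂ b₂ v sh hok
  | asg x a sa b sb so => exact exists_apply_asg hH κ hτ hε x a b sa sb so

/-! ### Programs -/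

/-- The effect of a list of instructions. -/
noncomputable def evalList (P m : ℕ) (is : List Instr) (β : State) : State :=
  is.foldl (fun β I => I.eval P m β) β

/-- All instructions of a list can be executed. -/
def OkList (P m : ℕ) : List Instr → State → Prop
  | [], _ => True
  | I :: is, β => I.Ok P m β ∧ OkList P m is (I.eval P m β)

/-- If `Φ` holds then the program can be executed, and `Ψ` holds afterwards. -/
def Triple (P m : ℕ) (Φ : State → Prop) (is : List Instr) (Ψ : State → Prop) : Prop :=
  ∀ β, Φ β → OkList P m is β ∧ Ψ (evalList P m is β)

theorem okList_append {P m : ℕ} {is is' : List Instr} {β : State} :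
    OkList P m (is ++ is') β ↔ OkList P m is β ∧ OkList P m is' (evalList P m is β) := by
  induction is generalizing β with
  | nil => simp [OkList, evalList]
  | cons I is ih => simp [OkList, evalList, ih, and_assoc]

theorem evalList_append {P m : ℕ} {is is' : List Instr} {β : State} :
    evalList P m (is ++ is') β = evalList P m is' (evalList P m is β) := by
  simp [evalList]

/-- The layers that implement a program. -/
noncomputable def layersOf (m : ℕ) (is : List Instr) : List (Layer 2 (m * slots)) :=
  is.map fun I => I.table.layer m

section Run

variable {m P : ℕ} (T : Transformer 2 (m * slots)) (κ : AttnKind) (hτ : T.τ.mant = 1)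
  (hε : T.ε.mant = 1)
include hτ hε

theorem exists_runLayers {Φ Ψ : State → Prop} {is : List Instr} (h : Triple P m Φ is Ψ) {β : State}
    (hβ : Φ β) {H : Hidden 2 (m * slots) P} (hH : Encodes β H) :
    ∃ H' β', T.runLayers κ (layersOf m is) H = some H' ∧ Encodes β' H' ∧ Ψ β' := by
  obtain ⟨hok, hΨ⟩ := h β hβ
  clear h hβ
  suffices ∃ H', T.runLayers κ (layersOf m is) H = some H' ∧ Encodes (evalList P m is β) H' by
    obtain ⟨H', h1, h2⟩ := this
    exact ⟨H', _, h1, h2, hΨ⟩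
  clear hΨ
  induction is generalizing β H with
  | nil => exact ⟨H, rfl, hH⟩
  | cons I is ih =>
    obtain ⟨H₁, h1, h2⟩ := exists_apply_instr hH κ hτ hε I hok.1
    obtain ⟨H₂, h3, h4⟩ := ih h2 hok.2
    refine ⟨H₂, ?_, h4⟩
    simp only [Transformer.runLayers, layersOf, List.map_cons, List.foldlM_cons] at h3 ⊢
    rw [h1]
    exact h3

theorem exists_runLoop {Φ : ℕ → State → Prop} {is : List Instr}
    (h : ∀ t, Triple P m (Φ t) is (Φ (t + 1))) (n : ℕ) {t : ℕ} {β : State}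
    (hβ : Φ t β) {H : Hidden 2 (m * slots) P} (hH : Encodes β H) :
    ∃ H' β', T.runLoop κ (layersOf m is) n H = some H' ∧ Encodes β' H' ∧ Φ (t + n) β' := by
  induction n generalizing t β H with
  | zero => exact ⟨H, β, rfl, hH, hβ⟩
  | succ n ih =>
    obtain ⟨H₁, β₁, h1, h2, h3⟩ := exists_runLayers T κ hτ hε (h t) hβ hH
    obtain ⟨H₂, β₂, h4, h5, h6⟩ := ih h3 h2
    refine ⟨H₂, β₂, ?_, h5, by convert h6 using 1; ring⟩
    rw [Transformer.runLoop, h1]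
    exact h4

end Run

/-! ### The programs -/

namespace Instr

/-- Conjunction of two literals. -/
abbrev conj (x a : Fld) (sa : Bool) (b : Fld) (sb : Bool) : Instr := .asg x a sa b sb true

/-- Disjunction of two registers. -/
abbrev disj (x a b : Fld) : Instr := .asg x a false b false false

/-- Reading a register at the next position. -/
abbrev next (v : Fld) (sh : Bool) : Instr := .att .nk .npk .nnk .pk v sh

/-- Reading a register at the preceding position. -/
abbrev prev (v : Fld) (sh : Bool) : Instr := .att .pk .nnk .npk .nk v sh

end Instr

open Instr

/-- Propagation of a register along positions where `pass` holds, read by the instruction `I`. -/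
def propagate (I : Instr) (y src pass : Fld) : List Instr :=
  [I, conj .u pass true .t true, disj y .u src]

/-- Preparation: keys for the positions, and the kinds of positions. -/
def initProg : List Instr :=
  [conj .pk .pos true .pad false, conj .npk .pos false .pad false,
   conj .nk .nxt true .pad false, conj .nnk .nxt false .pad false,
   conj .seed .first true .one true,
   next .hash false, conj .argE .bit true .t true,
   next .bitHash false, conj .gateE .bit true .t false, conj .inner .gateE false .pad false]

/-- One iteration of reading the pointers. -/
def loopProg : List Instr :=
  -- Every move to the right shifts the collected bits one block up, so block `i` at position `p`
  -- comes to hold the bit read at `p - i`.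
  propagate (prev .argR true) .argR .seed .bit ++
  propagate (prev .inPtr false) .inPtr .mark .bit ++
  propagate (prev .kAnd false) .kAnd .isAnd .ampBit ++
  propagate (prev .kNeg false) .kNeg .isNeg .ampBit ++
  conj .gateSrc .gateE true .argR true :: propagate (next .gateR false) .gateR .gateSrc .inner

/-- Queries and keys for nodes, types of gates, and the sink. -/
def finProg : List Instr :=
  [conj .aq .argE true .argR true, conj .naq .argE true .argR false,
   conj .gq .argE true .gateR true, conj .ngq .argE true .gateR false,
   conj .inp .bit true .inPtr false, conj .inpOne .inp true .one true,
   conj .val .inpOne true .inpOne true,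
   conj .u .inp true .pk true, disj .nodeK .u .gq,
   conj .u .inp true .npk true, disj .nnodeK .u .ngq,
   -- The type of a gate has reached only the end of its first argument pointer; a disjunction over
   -- the argument ends of the same gate distributes it. AND negates its inputs, and both AND and
   -- NOT negate the output.
   conj .u .argE true .kAnd true, .att .gq .ngq .ngq .gq .u false, conj .negIn .argE true .t true,
   conj .u .argE true .kNeg true, .att .gq .ngq .ngq .gq .u false, conj .negOut .argE true .t true,
   -- Attention detects whether some argument pointer equals the number of this gate; if none does,
   -- the gate is the output.
   .att .gq .naq .ngq .aq .argE false, conj .sink .argE true .t false]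

/-- One step of the evaluation of all gates. -/
def stepProg : List Instr :=
  -- A node is excluded if its number differs from the pointer in some bit. Positions without a node
  -- have zero keys and always match, but their value is false.
  [.att .aq .nnodeK .naq .nodeK .val false,
   conj .u .t true .negIn false, conj .v .t false .negIn true, disj .lit .u .v,
   conj .lit .lit true .argE true,
   .att .gq .ngq .ngq .gq .lit false,
   conj .u .t true .negOut false, conj .v .t false .negOut true, disj .u .u .v,
   conj .u .u true .argE true, disj .val .u .inpOne,
   -- With zero queries everything matches, so the value of the output gate reaches all positions,
   -- including the padding at the end where the classifier reads it.
   conj .outV .sink true .val true, .att .zero .zero .zero .zero .outV false]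

/-! ### The initial state -/

/-- The registers that depend on the symbol. -/
def tokFlag : Fld → Option Tok → Bool
  | .one, some .one => true
  | .bit, some .zero => true
  | .bit, some .one => true
  | .pad, none => true
  | .hash, some .hash => true
  | .mark, some .amp => true
  | .mark, some .hash => true
  | .bitHash, some .zero => true
  | .bitHash, some .one => true
  | .bitHash, some .hash => true
  | .isAnd, some .and => true
  | .isNeg, some .and => true
  | .isNeg, some .not => true
  | .ampBit, some .amp => true
  | .ampBit, some .zero => true
  | .ampBit, some .one => true
  | _, _ => false

/-- The registers that depend on the position. -/
def posFlag (p i : ℕ) : Fld → Bool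
  | .pos => p.testBit i
  | .nxt => (p + 1).testBit i
  | .first => decide (i = 0)
  | _ => false

/-- A register that depends on the symbol, at a position. -/
def tk (x : List Tok) (f : Fld) (p : ℕ) : Bool := tokFlag f x[p]?

/-- The initial state on input `x`. -/
def initState (x : List Tok) : State := fun p i f => posFlag p i f || tk x f p

theorem tk_pad (x : List Tok) (p : ℕ) : tk x .pad p = !decide (p < x.length) := by
  unfold tk
  by_cases h : p < x.length
  · rw [List.getElem?_eq_getElem h]; simp [tokFlag, h]
  · rw [List.getElem?_eq_none (not_lt.1 h)]; simp [tokFlag, h]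

theorem tk_of_length_le {x : List Tok} {p : ℕ} (h : x.length ≤ p) {f : Fld} (hf : f ≠ .pad) :
    tk x f p = false := by
  unfold tk
  rw [List.getElem?_eq_none h]; cases f <;> first | rfl | exact absurd rfl hf

/-- The last position of an argument pointer. -/
def isArgEnd (x : List Tok) (p : ℕ) : Bool := tk x .bit p && tk x .hash (p + 1)

/-- The last position of a gate pointer. -/
def isGateEnd (x : List Tok) (p : ℕ) : Bool := tk x .bit p && !tk x .bitHash (p + 1)

/-- A position in front of the last position of a gate pointer. -/
def isInner (x : List Tok) (p : ℕ) : Bool := !isGateEnd x p && decide (p < x.length)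

/-- The registers that are constant after the preparation. -/
structure Static (x : List Tok) (β : State) : Prop where
  one : ∀ p i, β p i .one = tk x .one p
  bit : ∀ p i, β p i .bit = tk x .bit p
  mark : ∀ p i, β p i .mark = tk x .mark p
  isAnd : ∀ p i, β p i .isAnd = tk x .isAnd p
  isNeg : ∀ p i, β p i .isNeg = tk x .isNeg p
  ampBit : ∀ p i, β p i .ampBit = tk x .ampBit p
  pk : ∀ p i, β p i .pk = (p.testBit i && decide (p < x.length))
  npk : ∀ p i, β p i .npk = (!p.testBit i && decide (p < x.length))
  nk : ∀ p i, β p i .nk = ((p + 1).testBit i && decide (p < x.length))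
  nnk : ∀ p i, β p i .nnk = (!(p + 1).testBit i && decide (p < x.length))
  seed : ∀ p i, β p i .seed = (decide (i = 0) && tk x .one p)
  argE : ∀ p i, β p i .argE = isArgEnd x p
  gateE : ∀ p i, β p i .gateE = isGateEnd x p
  inner : ∀ p i, β p i .inner = isInner x p
  zero : ∀ p i, β p i .zero = false

/-- A position below `2 ^ m` is determined by its bits. -/
theorem eq_of_testBit_lt {m a b : ℕ} (ha : a < 2 ^ m) (hb : b < 2 ^ m)
    (h : ∀ i < m, a.testBit i = b.testBit i) : a = b := by
  apply Nat.eq_of_testBit_eq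
  intro i
  by_cases hi : i < m
  · exact h i hi
  · rw [Nat.testBit_eq_false_of_lt (ha.trans_le (Nat.pow_le_pow_right two_pos (not_lt.1 hi))),
      Nat.testBit_eq_false_of_lt (hb.trans_le (Nat.pow_le_pow_right two_pos (not_lt.1 hi)))]

/-- Boolean vectors in two registers for a bit and its negation match iff they are equal. -/
theorem matches_iff {m : ℕ} {β : State} {a na b nb : Fld} {p j : ℕ} {f g : ℕ → Bool}
    (ha : ∀ i, β p i a = f i) (hna : ∀ i, β p i na = !f i)
    (hb : ∀ i, β j i b = g i) (hnb : ∀ i, β j i nb = !g i) :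
    Matches m β a nb na b p j ↔ ∀ i < m, f i = g i := by
  unfold Matches
  simp only [ha, hna, hb, hnb]
  refine forall₂_congr fun i _ => ?_
  cases f i <;> cases g i <;> simp

/-! ### Reading the registers of a neighbouring position. -/

section Neighbours

variable {x : List Tok} {m : ℕ} (hm : x.length < 2 ^ m) {β : State}
  (hpk : ∀ p i, β p i .pk = (p.testBit i && decide (p < x.length)))
  (hnpk : ∀ p i, β p i .npk = (!p.testBit i && decide (p < x.length)))
  (hnk : ∀ p i, β p i .nk = ((p + 1).testBit i && decide (p < x.length)))
  (hnnk : ∀ p i, β p i .nnk = (!(p + 1).testBit i && decide (p < x.length)))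
include hm hpk hnpk hnk hnnk

/-- Among the symbols of the input only the one with number `p + 1` matches. Padding has zero keys
and always matches, hence the condition that `S` fails there; this also gives the right value at the
last symbol. -/
theorem next_iff {p : ℕ} (hp : p < x.length) {S : ℕ → Prop} (hS : ∀ j, x.length ≤ j → ¬ S j) :
    (∃ j < x.length + 1, Matches m β .nk .npk .nnk .pk p j ∧ S j) ↔ S (p + 1) := by
  have key : ∀ j < x.length, Matches m β .nk .npk .nnk .pk p j ↔ p + 1 = j := by
    intro j hj
    rw [matches_iff (f := (p + 1).testBit) (g := j.testBit) (by simp [hnk, hp]) (by simp [hnnk, hp])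
      (by simp [hpk, hj]) (by simp [hnpk, hj])]
    exact ⟨eq_of_testBit_lt (by omega) (by omega), fun h i _ => by rw [h]⟩
  constructor
  · rintro ⟨j, -, h1, h2⟩
    have hj : j < x.length := not_le.1 fun h => hS j h h2
    rwa [(key j hj).1 h1]
  · intro h
    have hj : p + 1 < x.length := not_le.1 fun h' => hS _ h' h
    exact ⟨p + 1, by omega, (key _ hj).2 rfl, h⟩

theorem prev_iff {p : ℕ} (hp : p < x.length) {S : ℕ → Prop} (hS : ∀ j, x.length ≤ j → ¬ S j) :
    (∃ j < x.length + 1, Matches m β .pk .nnk .npk .nk p j ∧ S j) ↔ p ≠ 0 ∧ S (p - 1) := by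
  have key : ∀ j < x.length, Matches m β .pk .nnk .npk .nk p j ↔ p = j + 1 := by
    intro j hj
    rw [matches_iff (f := p.testBit) (g := (j + 1).testBit) (by simp [hpk, hp]) (by simp [hnpk, hp])
      (by simp [hnk, hj]) (by simp [hnnk, hj])]
    exact ⟨eq_of_testBit_lt (by omega) (by omega), fun h i _ => by rw [h]⟩
  constructor
  · rintro ⟨j, -, h1, h2⟩
    have hj : j < x.length := not_le.1 fun h => hS j h h2
    rw [(key j hj).1 h1]
    exact ⟨by omega, h2⟩
  · rintro ⟨h0, h⟩
    have hj : p - 1 < x.length := not_le.1 fun h' => hS _ h' h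
    exact ⟨p - 1, by omega, (key _ hj).2 (by omega), h⟩

end Neighbours

theorem triple_init {x : List Tok} {m : ℕ} (hm : x.length < 2 ^ m) :
    Triple (x.length + 1) m (fun β => β = initState x) initProg (fun β => Static x β ∧
      ∀ f, (f = .argR ∨ f = .inPtr ∨ f = .kAnd ∨ f = .kNeg ∨ f = .gateR) →
        ∀ p i, β p i f = false) := by
  rintro _ rfl
  set β₀ := initState x with hβ₀
  have hpos : ∀ p i, β₀ p i .pos = p.testBit i := by
    intro p i; simp [hβ₀, initState, posFlag, tk, tokFlag]
  have hnxt : ∀ p i, β₀ p i .nxt = (p + 1).testBit i := by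
    intro p i; simp [hβ₀, initState, posFlag, tk, tokFlag]
  have hfirst : ∀ p i, β₀ p i .first = decide (i = 0) := by
    intro p i; simp [hβ₀, initState, posFlag, tk, tokFlag]
  have htk : ∀ p i f, posFlag p i f = false → β₀ p i f = tk x f p := by
    intro p i f h; simp [hβ₀, initState, h]
  have hpad : ∀ p i, β₀ p i .pad = !decide (p < x.length) := by
    intro p i; rw [htk _ _ _ rfl, tk_pad]
  have e₁ : initProg = initProg.take 5 ++ initProg.drop 5 := rfl
  set β₁ := evalList (x.length + 1) m (initProg.take 5) β₀ with hβ₁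
  have ok₁ : OkList (x.length + 1) m (initProg.take 5) β₀ := by
    simp [initProg, OkList, Instr.Ok]
  have hpk : ∀ p i, β₁ p i .pk = (p.testBit i && decide (p < x.length)) := by
    intro p i; simp [hβ₁, initProg, evalList, Instr.eval, hpos, hpad]
  have hnpk : ∀ p i, β₁ p i .npk = (!p.testBit i && decide (p < x.length)) := by
    intro p i; simp [hβ₁, initProg, evalList, Instr.eval, hpos, hpad]
  have hnk : ∀ p i, β₁ p i .nk = ((p + 1).testBit i && decide (p < x.length)) := by
    intro p i; simp [hβ₁, initProg, evalList, Instr.eval, hnxt, hpad]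
  have hnnk : ∀ p i, β₁ p i .nnk = (!(p + 1).testBit i && decide (p < x.length)) := by
    intro p i; simp [hβ₁, initProg, evalList, Instr.eval, hnxt, hpad]
  have hseed : ∀ p i, β₁ p i .seed = (decide (i = 0) && tk x .one p) := by
    intro p i; simp [hβ₁, initProg, evalList, Instr.eval, hfirst, htk _ _ .one rfl]
  have hrest : ∀ p i f, f ≠ .pk → f ≠ .npk → f ≠ .nk → f ≠ .nnk → f ≠ .seed →
      β₁ p i f = β₀ p i f := by
    intro p i f h1 h2 h3 h4 h5
    simp [hβ₁, initProg, evalList, Instr.eval, h1, h2, h3, h4, h5]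
  have hnext := fun (p : ℕ) (hp : p < x.length) (f : Fld) (hf : f ≠ .pad) =>
    next_iff hm hpk hnpk hnk hnnk hp (S := fun j => tk x f j = true) fun j hj => by
      rw [tk_of_length_le hj hf]; simp
  -- The padding position is the one that is excluded nowhere.
  have hdummy : ∀ j, x.length ≤ j → ∀ i, β₁ j i .npk = false ∧ β₁ j i .pk = false := by
    intro j hj i; rw [hpk, hnpk]; simp [hj]
  rw [e₁, okList_append, evalList_append, ← hβ₁]
  have hb : ∀ p i, β₁ p i .bit = tk x .bit p := fun p i => by
    rw [hrest _ _ _ (by simp) (by simp) (by simp) (by simp) (by simp), htk _ _ _ rfl]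
  have hh : ∀ p i, β₁ p i .hash = tk x .hash p := fun p i => by
    rw [hrest _ _ _ (by simp) (by simp) (by simp) (by simp) (by simp), htk _ _ _ rfl]
  have hbh : ∀ p i, β₁ p i .bitHash = tk x .bitHash p := fun p i => by
    rw [hrest _ _ _ (by simp) (by simp) (by simp) (by simp) (by simp), htk _ _ _ rfl]
  have hpd : ∀ p i, β₁ p i .pad = !decide (p < x.length) := fun p i => by
    rw [hrest _ _ _ (by simp) (by simp) (by simp) (by simp) (by simp), hpad]
  set β₂ := evalList (x.length + 1) m (initProg.drop 5) β₁ with hβ₂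
  have hfix : ∀ p i f, f ≠ .argE → f ≠ .gateE → f ≠ .inner → f ≠ .t → β₂ p i f = β₁ p i f := by
    intro p i f h1 h2 h3 h4
    simp [hβ₂, initProg, evalList, Instr.eval, h1, h2, h3, h4]
  have hA : ∀ p i, β₂ p i .argE = isArgEnd x p := by
    intro p i
    simp only [hβ₂, initProg, evalList, List.drop, List.foldl, Instr.eval, reduceCtorEq, if_false,
      if_true, source, Matches, isArgEnd, hb, hh, beq_true, Bool.false_eq_true]
    by_cases hp : p < x.length
    · have := hnext p hp .hash (by simp)
      simp only [Matches] at this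
      simp only [this]
      simp
    · rw [tk_of_length_le (not_lt.1 hp) (by simp)]; simp
  have hG : ∀ p i, β₂ p i .gateE = isGateEnd x p := by
    intro p i
    simp only [hβ₂, initProg, evalList, List.drop, List.foldl, Instr.eval, reduceCtorEq, if_false,
      if_true, source, Matches, isGateEnd, hb, hbh, beq_true, Bool.false_eq_true]
    by_cases hp : p < x.length
    · have := hnext p hp .bitHash (by simp)
      simp only [Matches] at this
      simp only [this]
      simp
    · rw [tk_of_length_le (not_lt.1 hp) (by simp)]; simp
  have hI : ∀ p i, β₂ p i .inner = isInner x p := by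
    intro p i
    have : β₂ p i .inner = (!β₂ p i .gateE && !β₁ p i .pad) := by
      simp [hβ₂, initProg, evalList, Instr.eval]
    rw [this, hG, hpd]
    unfold isInner
    rw [Bool.not_not]
  refine ⟨⟨ok₁, ?_⟩, ⟨?_, ?_, ?_, ?_, ?_, ?_, ?_, ?_, ?_, ?_, ?_, hA, hG, hI, ?_⟩, ?_⟩
  · have : ∀ β : State, (∀ p i f, f ≠ .argE → f ≠ .t → β p i f = β₁ p i f) →
        Instr.Ok (x.length + 1) m (.att .nk .npk .nnk .pk .bitHash false) β := by
      intro β h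
      refine ⟨x.length, by omega, fun i _ => ?_⟩
      rw [h _ _ _ (by simp) (by simp), h _ _ _ (by simp) (by simp)]
      exact hdummy _ le_rfl i
    refine ⟨⟨x.length, by omega, fun i _ => hdummy _ le_rfl i⟩, trivial, this _ ?_, trivial,
      trivial, trivial⟩
    intro p i f h1 h2
    simp [Instr.eval, h1, h2]
  all_goals try (intro p i; rw [hfix _ _ _ (by simp) (by simp) (by simp) (by simp)])
  · rw [hrest _ _ _ (by simp) (by simp) (by simp) (by simp) (by simp), htk _ _ _ rfl]
  · exact hb p i
  · rw [hrest _ _ _ (by simp) (by simp) (by simp) (by simp) (by simp), htk _ _ _ rfl]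
  · rw [hrest _ _ _ (by simp) (by simp) (by simp) (by simp) (by simp), htk _ _ _ rfl]
  · rw [hrest _ _ _ (by simp) (by simp) (by simp) (by simp) (by simp), htk _ _ _ rfl]
  · rw [hrest _ _ _ (by simp) (by simp) (by simp) (by simp) (by simp), htk _ _ _ rfl]
  · exact hpk p i
  · exact hnpk p i
  · exact hnk p i
  · exact hnnk p i
  · exact hseed p i
  · rw [hrest _ _ _ (by simp) (by simp) (by simp) (by simp) (by simp), htk _ _ _ rfl]
    unfold tk; cases x[p]? <;> rfl
  · intro f hf p i
    rcases hf with rfl | rfl | rfl | rfl | rfl <;>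
    · rw [hfix _ _ _ (by simp) (by simp) (by simp) (by simp),
        hrest _ _ _ (by simp) (by simp) (by simp) (by simp) (by simp), htk _ _ _ rfl]
      unfold tk; cases x[p]? <;> rfl

open Instr

/-! ### One round of propagation. -/

section Propagate

variable {x : List Tok} {m : ℕ} (hm : x.length < 2 ^ m) {β : State} (hs : Static x β)
  {y src pass : Fld} {sh : Bool} (hsrc : src ≠ .t ∧ src ≠ .u)
  (hpass : pass ≠ .t ∧ pass ≠ .u) (hp0 : ∀ p i, x.length ≤ p → β p i pass = false)
  (hy0 : ∀ p i, x.length ≤ p → β p i y = false)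
include hm hs hsrc hpass hp0 hy0

theorem propagate_prev :
    let β' := evalList (x.length + 1) m (propagate (prev y sh) y src pass) β
    OkList (x.length + 1) m (propagate (prev y sh) y src pass) β ∧
    (∀ p i, src ≠ y → β' p i y =
      (β p i src || (β p i pass && (decide (p ≠ 0) && source β y sh (p - 1) i)))) ∧
    ∀ p i f, f ≠ .t → f ≠ .u → f ≠ y → β' p i f = β p i f := by
  intro β'
  refine ⟨⟨⟨x.length, by omega, fun i _ => ?_⟩, trivial, trivial, trivial⟩, ?_, ?_⟩
  · rw [hs.nk, hs.nnk]; simp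
  · intro p i hsy
    simp only [β', propagate, evalList, List.foldl, Instr.eval, if_true, reduceCtorEq, if_false,
      hsrc.1, hsrc.2, hpass.1]
    by_cases hp : p < x.length
    · have hS : ∀ j, x.length ≤ j → ¬ source β y sh j i = true := by
        intro j hj; simp [source, hy0 j _ hj]
      have := prev_iff hm hs.pk hs.npk hs.nk hs.nnk hp hS
      simp only [this]
      cases β p i src <;> cases β p i pass <;> simp
    · rw [hp0 p i (not_lt.1 hp)]
      cases β p i src <;> simp
  · intro p i f h1 h2 h3
    simp [β', propagate, evalList, Instr.eval, h1, h2, h3]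

theorem propagate_next :
    let β' := evalList (x.length + 1) m (propagate (next y sh) y src pass) β
    OkList (x.length + 1) m (propagate (next y sh) y src pass) β ∧
    (∀ p i, src ≠ y → β' p i y = (β p i src || (β p i pass && source β y sh (p + 1) i))) ∧
    ∀ p i f, f ≠ .t → f ≠ .u → f ≠ y → β' p i f = β p i f := by
  intro β'
  refine ⟨⟨⟨x.length, by omega, fun i _ => ?_⟩, trivial, trivial, trivial⟩, ?_, ?_⟩
  · rw [hs.pk, hs.npk]; simp
  · intro p i hsy
    simp only [β', propagate, evalList, List.foldl, Instr.eval, if_true, reduceCtorEq, if_false,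
      hsrc.1, hsrc.2, hpass.1]
    by_cases hp : p < x.length
    · have hS : ∀ j, x.length ≤ j → ¬ source β y sh j i = true := by
        intro j hj; simp [source, hy0 j _ hj]
      have := next_iff hm hs.pk hs.npk hs.nk hs.nnk hp hS
      simp only [this]
      cases β p i src <;> cases β p i pass <;> simp
    · rw [hp0 p i (not_lt.1 hp)]
      cases β p i src <;> simp
  · intro p i f h1 h2 h3
    simp [β', propagate, evalList, Instr.eval, h1, h2, h3]

end Propagate

theorem Static.congr {x : List Tok} {β β' : State} (h : Static x β)
    (hβ : ∀ p i f, f ≠ .t → f ≠ .u → f ≠ .argR → f ≠ .inPtr → f ≠ .kAnd → f ≠ .kNeg →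
      f ≠ .gateSrc → f ≠ .gateR → β' p i f = β p i f) : Static x β' := by
  obtain ⟨h1, h2, h3, h4, h5, h6, h7, h8, h9, h10, h11, h12, h13, h14, h15⟩ := h
  constructor <;> intro p i <;>
    rw [hβ _ _ _ (by simp) (by simp) (by simp) (by simp) (by simp) (by simp) (by simp) (by simp)]
  exacts [h1 p i, h2 p i, h3 p i, h4 p i, h5 p i, h6 p i, h7 p i, h8 p i, h9 p i, h10 p i, h11 p i,
    h12 p i, h13 p i, h14 p i, h15 p i]

/-- Propagation of a flag to the right in `n` steps. -/
def spread (src pass : ℕ → Bool) : ℕ → ℕ → Bool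
  | 0, _ => false
  | n + 1, p => src p || (pass p && (decide (p ≠ 0) && spread src pass n (p - 1)))

/-- The bits in front of a position, read in `n` steps. -/
def readBits (x : List Tok) : ℕ → ℕ → ℕ → Bool
  | 0, _, _ => false
  | n + 1, p, i => (decide (i = 0) && tk x .one p) ||
      (tk x .bit p && (decide (p ≠ 0) && (decide (i ≠ 0) && readBits x n (p - 1) (i - 1))))

/-- The bits in front of the next end of a gate pointer, read in `n` steps. -/
def readGate (x : List Tok) : ℕ → ℕ → ℕ → Bool
  | 0, _, _ => false
  | n + 1, p, i => (isGateEnd x p && readBits x (n + 1) p i) ||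
      (isInner x p && readGate x n (p + 1) i)

/-- The state after `n` iterations of reading. -/
structure Reading (x : List Tok) (n : ℕ) (β : State) : Prop where
  static : Static x β
  argR : ∀ p i, β p i .argR = readBits x n p i
  inPtr : ∀ p i, β p i .inPtr = spread (tk x .mark) (tk x .bit) n p
  kAnd : ∀ p i, β p i .kAnd = spread (tk x .isAnd) (tk x .ampBit) n p
  kNeg : ∀ p i, β p i .kNeg = spread (tk x .isNeg) (tk x .ampBit) n p
  gateR : ∀ p i, β p i .gateR = readGate x n p i

theorem spread_of_length_le {x : List Tok} {f g : Fld} (hf : f ≠ .pad) (hg : g ≠ .pad) (n : ℕ)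
    {p : ℕ} (h : x.length ≤ p) : spread (tk x f) (tk x g) n p = false := by
  cases n with
  | zero => rfl
  | succ n => simp [spread, tk_of_length_le h hf, tk_of_length_le h hg]

theorem readBits_of_length_le {x : List Tok} (n : ℕ) {p : ℕ} (i : ℕ) (h : x.length ≤ p) :
    readBits x n p i = false := by
  cases n with
  | zero => rfl
  | succ n => simp [readBits, tk_of_length_le h]

theorem isGateEnd_of_length_le {x : List Tok} {p : ℕ} (h : x.length ≤ p) : isGateEnd x p = false := by
  simp [isGateEnd, tk_of_length_le h]

theorem readGate_of_length_le {x : List Tok} (n : ℕ) {p : ℕ} (i : ℕ) (h : x.length ≤ p) :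
    readGate x n p i = false := by
  cases n with
  | zero => rfl
  | succ n => simp [readGate, isGateEnd_of_length_le h, isInner, h]

/-- Apart from the scratch registers `t` and `u`, the five propagations write to different
registers, so each recursion equation is read off separately. `gateSrc` uses the `argR` of the same
round, which is why `readGate` at `n + 1` refers to `readBits` at `n + 1`. -/
theorem triple_loop {x : List Tok} {m : ℕ} (hm : x.length < 2 ^ m) (n : ℕ) :
    Triple (x.length + 1) m (Reading x n) loopProg (Reading x (n + 1)) := by
  intro β h
  have hlen := @tk_of_length_le x
  obtain ⟨ok₁, e₁, f₁⟩ := propagate_prev (y := .argR) (src := .seed) (pass := .bit) (sh := true) hm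
    h.static (by simp) (by simp)
    (fun p i hp => by rw [h.static.bit]; exact hlen hp (by simp))
    (fun p i hp => by rw [h.argR]; exact readBits_of_length_le _ _ hp)
  set β₁ := evalList (x.length + 1) m (propagate (prev .argR true) .argR .seed .bit) β with hβ₁
  have s₁ : Static x β₁ := h.static.congr fun p i f a b c _ _ _ _ _ => f₁ p i f a b c
  obtain ⟨ok₂, e₂, f₂⟩ := propagate_prev (y := .inPtr) (src := .mark) (pass := .bit) (sh := false)
    hm s₁ (by simp) (by simp)
    (fun p i hp => by rw [s₁.bit]; exact hlen hp (by simp))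
    (fun p i hp => by
      rw [f₁ _ _ _ (by simp) (by simp) (by simp), h.inPtr]
      exact spread_of_length_le (by simp) (by simp) _ hp)
  set β₂ := evalList (x.length + 1) m (propagate (prev .inPtr false) .inPtr .mark .bit) β₁ with hβ₂
  have s₂ : Static x β₂ := s₁.congr fun p i f a b _ c _ _ _ _ => f₂ p i f a b c
  obtain ⟨ok₃, e₃, f₃⟩ := propagate_prev (y := .kAnd) (src := .isAnd) (pass := .ampBit) (sh := false)
    hm s₂ (by simp) (by simp)
    (fun p i hp => by rw [s₂.ampBit]; exact hlen hp (by simp))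
    (fun p i hp => by
      rw [f₂ _ _ _ (by simp) (by simp) (by simp), f₁ _ _ _ (by simp) (by simp) (by simp), h.kAnd]
      exact spread_of_length_le (by simp) (by simp) _ hp)
  set β₃ := evalList (x.length + 1) m (propagate (prev .kAnd false) .kAnd .isAnd .ampBit) β₂ with hβ₃
  have s₃ : Static x β₃ := s₂.congr fun p i f a b _ _ c _ _ _ => f₃ p i f a b c
  obtain ⟨ok₄, e₄, f₄⟩ := propagate_prev (y := .kNeg) (src := .isNeg) (pass := .ampBit) (sh := false)
    hm s₃ (by simp) (by simp)
    (fun p i hp => by rw [s₃.ampBit]; exact hlen hp (by simp))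
    (fun p i hp => by
      rw [f₃ _ _ _ (by simp) (by simp) (by simp), f₂ _ _ _ (by simp) (by simp) (by simp),
        f₁ _ _ _ (by simp) (by simp) (by simp), h.kNeg]
      exact spread_of_length_le (by simp) (by simp) _ hp)
  set β₄ := evalList (x.length + 1) m (propagate (prev .kNeg false) .kNeg .isNeg .ampBit) β₃ with hβ₄
  have s₄ : Static x β₄ := s₃.congr fun p i f a b _ _ _ c _ _ => f₄ p i f a b c
  set β₅ := (conj .gateSrc .gateE true .argR true).eval (x.length + 1) m β₄ with hβ₅
  have f₅ : ∀ p i f, f ≠ .gateSrc → β₅ p i f = β₄ p i f := by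
    intro p i f h; simp [hβ₅, Instr.eval, h]
  have s₅ : Static x β₅ := s₄.congr fun p i f _ _ _ _ _ _ c _ => f₅ p i f c
  obtain ⟨ok₆, e₆, f₆⟩ := propagate_next (y := .gateR) (src := .gateSrc) (pass := .inner)
    (sh := false) hm s₅ (by simp) (by simp)
    (fun p i hp => by rw [s₅.inner]; simp [isInner, hp])
    (fun p i hp => by
      rw [f₅ _ _ _ (by simp), f₄ _ _ _ (by simp) (by simp) (by simp),
        f₃ _ _ _ (by simp) (by simp) (by simp), f₂ _ _ _ (by simp) (by simp) (by simp),
        f₁ _ _ _ (by simp) (by simp) (by simp), h.gateR]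
      exact readGate_of_length_le _ _ hp)
  set β₆ := evalList (x.length + 1) m (propagate (next .gateR false) .gateR .gateSrc .inner) β₅
    with hβ₆
  have hev : evalList (x.length + 1) m loopProg β = β₆ := by
    unfold loopProg
    rw [evalList_append, evalList_append, evalList_append, evalList_append]
    rfl
  have hR : ∀ p i, β₄ p i .argR = readBits x (n + 1) p i := by
    intro p i
    rw [f₄ _ _ _ (by simp) (by simp) (by simp), f₃ _ _ _ (by simp) (by simp) (by simp),
      f₂ _ _ _ (by simp) (by simp) (by simp), e₁ _ _ (by simp), h.static.seed, h.static.bit]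
    simp [source, readBits, h.argR]
  rw [hev]
  refine ⟨?_, ⟨?_, ?_, ?_, ?_, ?_, ?_⟩⟩
  · unfold loopProg
    rw [okList_append, okList_append, okList_append, okList_append, evalList_append, evalList_append,
      evalList_append]
    exact ⟨⟨⟨⟨ok₁, ok₂⟩, ok₃⟩, ok₄⟩, trivial, ok₆⟩
  · exact s₅.congr fun p i f a b _ _ _ _ _ c => f₆ p i f a b c
  · intro p i
    rw [f₆ _ _ _ (by simp) (by simp) (by simp), f₅ _ _ _ (by simp), hR]
  · intro p i
    rw [f₆ _ _ _ (by simp) (by simp) (by simp), f₅ _ _ _ (by simp),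
      f₄ _ _ _ (by simp) (by simp) (by simp), f₃ _ _ _ (by simp) (by simp) (by simp),
      e₂ _ _ (by simp), s₁.mark, s₁.bit]
    simp only [source, Bool.false_eq_true, if_false, spread]
    rw [f₁ _ _ _ (by simp) (by simp) (by simp), h.inPtr]
  · intro p i
    rw [f₆ _ _ _ (by simp) (by simp) (by simp), f₅ _ _ _ (by simp),
      f₄ _ _ _ (by simp) (by simp) (by simp), e₃ _ _ (by simp), s₂.isAnd, s₂.ampBit]
    simp only [source, Bool.false_eq_true, if_false, spread]
    rw [f₂ _ _ _ (by simp) (by simp) (by simp), f₁ _ _ _ (by simp) (by simp) (by simp), h.kAnd]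
  · intro p i
    rw [f₆ _ _ _ (by simp) (by simp) (by simp), f₅ _ _ _ (by simp), e₄ _ _ (by simp), s₃.isNeg,
      s₃.ampBit]
    simp only [source, Bool.false_eq_true, if_false, spread]
    rw [f₃ _ _ _ (by simp) (by simp) (by simp), f₂ _ _ _ (by simp) (by simp) (by simp),
      f₁ _ _ _ (by simp) (by simp) (by simp), h.kNeg]
  · intro p i
    have hsrc : β₅ p i .gateSrc = (isGateEnd x p && readBits x (n + 1) p i) := by
      simp [hβ₅, Instr.eval, s₄.gateE, hR]
    rw [e₆ _ _ (by simp), hsrc, s₅.inner]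
    simp only [source, Bool.false_eq_true, if_false, readGate]
    rw [f₅ _ _ _ (by simp), f₄ _ _ _ (by simp) (by simp) (by simp),
        f₃ _ _ _ (by simp) (by simp) (by simp), f₂ _ _ _ (by simp) (by simp) (by simp),
        f₁ _ _ _ (by simp) (by simp) (by simp), h.gateR]

/-! ### Values of the propagated registers -/

/-- A source at distance `k` needs `k + 1` rounds, and all positions right of it up to `p` have to
pass the flag on. -/
theorem spread_eq_true {src pass : ℕ → Bool} {n p : ℕ} (k : ℕ) (hk : k < n) (hkp : k ≤ p)
    (hs : src (p - k) = true) (hp : ∀ l < k, pass (p - l) = true) : spread src pass n p = true := by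
  induction k generalizing n p with
  | zero =>
    obtain ⟨n, rfl⟩ : ∃ n', n = n' + 1 := ⟨n - 1, by omega⟩
    simp only [Nat.sub_zero] at hs
    simp [spread, hs]
  | succ k ih =>
    obtain ⟨n, rfl⟩ : ∃ n', n = n' + 1 := ⟨n - 1, by omega⟩
    have h0 := hp 0 (by omega)
    simp only [Nat.sub_zero] at h0
    have := ih (n := n) (p := p - 1) (by omega) (by omega) (by rw [← hs]; congr 1; omega)
      (fun l hl => by rw [← hp (l + 1) (by omega)]; congr 1; omega)
    simp [spread, h0, this, show p ≠ 0 by omega]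

/-- The flag is stopped at distance `k`, or by the left end of the input if `k > p`; the number of
rounds is irrelevant. -/
theorem spread_eq_false {src pass : ℕ → Bool} {n p : ℕ} (k : ℕ) (hp : k ≤ p → pass (p - k) = false)
    (hs : ∀ l ≤ k, l ≤ p → src (p - l) = false) : spread src pass n p = false := by
  induction k generalizing n p with
  | zero =>
    cases n with
    | zero => rfl
    | succ n =>
      have h1 := hp (by omega)
      have h2 := hs 0 le_rfl (by omega)
      simp only [Nat.sub_zero] at h1 h2
      simp [spread, h1, h2]
  | succ k ih =>
    cases n with
    | zero => rfl
    | succ n =>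
      have h2 := hs 0 (by omega) (by omega)
      simp only [Nat.sub_zero] at h2
      rw [spread, h2]
      by_cases h0 : p = 0
      · simp [h0]
      · rw [ih]
        · simp
        · intro h; rw [← hp (by omega)]; congr 1; omega
        · intro l hl hlp
          rw [← hs (l + 1) (by omega) (by omega)]; congr 1; omega

/-- Each round moves one place to the right and one block up, so bit number `i` stems from the
symbol `i` places to the left. -/
theorem readBits_eq {x : List Tok} {n p i : ℕ} (hn : i < n) (hi : i ≤ p)
    (hb : ∀ l < i, tk x .bit (p - l) = true) : readBits x n p i = tk x .one (p - i) := by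
  induction i generalizing n p with
  | zero =>
    obtain ⟨n, rfl⟩ : ∃ n', n = n' + 1 := ⟨n - 1, by omega⟩
    simp [readBits]
  | succ i ih =>
    obtain ⟨n, rfl⟩ : ∃ n', n = n' + 1 := ⟨n - 1, by omega⟩
    have h0 := hb 0 (by omega)
    simp only [Nat.sub_zero] at h0
    have := ih (n := n) (p := p - 1) (by omega) (by omega)
      (fun l hl => by rw [← hb (l + 1) (by omega)]; congr 1; omega)
    rw [readBits]
    simp only [Nat.add_sub_cancel, this, h0]
    have hp0 : p ≠ 0 := by omega
    simp [show p - 1 - i = p - (i + 1) by omega, hp0]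

theorem tk_one_of_not_bit {x : List Tok} {p : ℕ} (h : tk x .bit p = false) : tk x .one p = false := by
  revert h; unfold tk
  rcases x[p]? with _ | a
  · simp [tokFlag]
  · cases a <;> simp [tokFlag]

/-- A symbol that is no bit cuts off all bit numbers from its distance on; this yields the leading
zeros of a pointer. -/
theorem readBits_eq_false {x : List Tok} {n p i : ℕ} (k : ℕ) (hk : k ≤ i) (hkp : k ≤ p)
    (hb : tk x .bit (p - k) = false) : readBits x n p i = false := by
  induction k generalizing n p i with
  | zero =>
    cases n with
    | zero => rfl
    | succ n =>
      simp only [Nat.sub_zero] at hb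
      simp [readBits, hb, tk_one_of_not_bit hb]
  | succ k ih =>
    cases n with
    | zero => rfl
    | succ n =>
      rw [readBits, ih (p := p - 1) (i := i - 1) (by omega) (by omega) (by rw [← hb]; congr 1; omega)]
      simp [show i ≠ 0 by omega]

/-- Of the `n` rounds, `k` go into carrying the bits from `p + k` to the left, and `n - k` remain
for reading them. -/
theorem readGate_eq {x : List Tok} {n p i : ℕ} (k : ℕ) (hk : k < n)
    (hin : ∀ l < k, isInner x (p + l) = true) (he : isGateEnd x (p + k) = true) :
    readGate x n p i = readBits x (n - k) (p + k) i := by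
  induction k generalizing n p with
  | zero =>
    obtain ⟨n, rfl⟩ : ∃ n', n = n' + 1 := ⟨n - 1, by omega⟩
    simp only [Nat.add_zero] at he
    simp [readGate, he, isInner]
  | succ k ih =>
    obtain ⟨n, rfl⟩ : ∃ n', n = n' + 1 := ⟨n - 1, by omega⟩
    have h0 := hin 0 (by omega)
    simp only [Nat.add_zero] at h0
    have hg : isGateEnd x p = false := by
      unfold isInner at h0; revert h0; cases isGateEnd x p <;> simp
    rw [readGate, h0, hg, ih (n := n) (p := p + 1) (by omega)
      (fun l hl => by rw [← hin (l + 1) (by omega)]; congr 1; omega)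
      (by rw [← he]; congr 1; omega)]
    simp only [Bool.false_and, Bool.true_and, Bool.false_or]
    congr 1 <;> omega

/-! ### The symbols of a serialized circuit -/

theorem getElem?_flatMap {α β : Type*} (l : List α) (f : α → List β) (k : ℕ) (hk : k < l.length)
    (r : ℕ) (hr : r < (f l[k]).length) :
    (l.flatMap f)[((l.take k).flatMap f).length + r]? = (f l[k])[r]? := by
  have : l = l.take k ++ l[k] :: l.drop (k + 1) := by simp
  conv_lhs => rw [this]
  rw [List.flatMap_append, List.flatMap_cons, List.take_append_of_le_length (by simp [hk.le]),
    List.take_take, min_self, List.getElem?_append_right (by omega), Nat.add_sub_cancel_left,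
    List.getElem?_append_left hr]

theorem length_take_succ_flatMap {α β : Type*} (l : List α) (f : α → List β) (k : ℕ)
    (hk : k < l.length) : ((l.take (k + 1)).flatMap f).length =
      ((l.take k).flatMap f).length + (f l[k]).length := by
  rw [← List.take_concat_get' l k hk, List.flatMap_append]; simp

theorem exists_of_lt_length_flatMap {α β : Type*} (l : List α) (f : α → List β) (p : ℕ)
    (hp : p < (l.flatMap f).length) : ∃ (k : ℕ) (hk : k < l.length) (r : ℕ),
      r < (f l[k]).length ∧ p = ((l.take k).flatMap f).length + r := by
  induction l generalizing p with
  | nil => simp at hp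
  | cons a l ih =>
    by_cases h : p < (f a).length
    · exact ⟨0, by simp, p, h, by simp⟩
    · rw [List.flatMap_cons, List.length_append] at hp
      obtain ⟨k, hk, r, hr, h'⟩ := ih (p - (f a).length) (by omega)
      refine ⟨k + 1, by simpa using hk, r, by simpa using hr, ?_⟩
      rw [List.take_succ_cons, List.flatMap_cons, List.length_append]; omega

namespace Circuit

variable {n : ℕ} (C : Circuit n)

/-- The part of the serialization that belongs to one argument. -/
def serializeArg (g : Fin C.size) (a : Fin n ⊕ Fin C.size) : List Tok :=
  Tok.amp :: (C.ptr a ++ Tok.hash :: C.ptr (Sum.inr g))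

theorem length_ptr (a : Fin n ⊕ Fin C.size) : (C.ptr a).length = C.ptrWidth := by
  simp [ptr, binary]

theorem length_serializeArg (g : Fin C.size) (a : Fin n ⊕ Fin C.size) :
    (C.serializeArg g a).length = 2 * C.ptrWidth + 2 := by
  simp [serializeArg, length_ptr]; ring

theorem length_flatMap_serializeArg (g : Fin C.size) (l : List (Fin n ⊕ Fin C.size)) :
    (l.flatMap (C.serializeArg g)).length = l.length * (2 * C.ptrWidth + 2) := by
  simp [List.length_flatMap, length_serializeArg]

theorem length_serializeGate (g : Fin C.size) :
    (C.serializeGate g).length = 1 + (C.args g).length * (2 * C.ptrWidth + 2) := by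
  have := C.length_flatMap_serializeArg g (C.args g)
  unfold serializeArg at this
  rw [serializeGate, List.length_cons, this]; ring

/-- The position of the type of gate `g`. -/
def gateStart (g : Fin C.size) : ℕ :=
  2 * n + (((List.finRange C.size).take g).flatMap C.serializeGate).length

/-- The position of the marker in front of argument `k` of gate `g`. -/
def argStart (g : Fin C.size) (k : ℕ) : ℕ := C.gateStart g + 1 + k * (2 * C.ptrWidth + 2)

theorem argEnd_eq (g : Fin C.size) (k : ℕ) : C.argEnd g k = C.argStart g k + C.ptrWidth := rfl

variable (w : Fin n → Bool)

theorem length_instanceOf : (C.instanceOf w).length =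
    2 * n + ((List.finRange C.size).flatMap C.serializeGate).length := by
  simp [instanceOf, serialize]; ring

theorem instanceOf_input (i : Fin n) : (C.instanceOf w)[(i : ℕ)]? = some (Tok.bit (w i)) := by
  rw [instanceOf, List.getElem?_append_left (by simp)]; simp

theorem instanceOf_X {p : ℕ} (h₁ : n ≤ p) (h₂ : p < 2 * n) :
    (C.instanceOf w)[p]? = some Tok.X := by
  rw [instanceOf, List.getElem?_append_right (by simpa using h₁), serialize,
    List.getElem?_append_left (by simp; omega)]
  simp [List.getElem?_replicate]; omega

theorem instanceOf_gate (g : Fin C.size) (r : ℕ) (hr : r < (C.serializeGate g).length) :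
    (C.instanceOf w)[C.gateStart g + r]? = (C.serializeGate g)[r]? := by
  have h := getElem?_flatMap (List.finRange C.size) C.serializeGate g (by simp) r (by simpa using hr)
  rw [instanceOf, List.getElem?_append_right (by simp [gateStart]; omega), serialize,
    List.getElem?_append_right (by simp [gateStart]; omega)]
  have e : C.gateStart g + r - ((List.ofFn w).map Tok.bit).length - (List.replicate n Tok.X).length =
    (((List.finRange C.size).take g).flatMap C.serializeGate).length + r := by
    simp [gateStart]; omega
  rw [e, h]; simp

theorem instanceOf_gateStart (g : Fin C.size) :
    (C.instanceOf w)[C.gateStart g]? = some (Tok.gate (C.kind g)) :=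
  (C.instanceOf_gate w g 0 (by simp [serializeGate])).trans (by simp [serializeGate])

theorem instanceOf_arg (g : Fin C.size) (k : Fin (C.args g).length) (r : ℕ)
    (hr : r < 2 * C.ptrWidth + 2) :
    (C.instanceOf w)[C.argStart g k + r]? = (C.serializeArg g ((C.args g).get k))[r]? := by
  have hk := k.2
  have h := getElem?_flatMap (C.args g) (C.serializeArg g) k hk r (by rwa [length_serializeArg])
  have hlen : ((C.args g).take k).length = k := by simp [hk.le]
  rw [length_flatMap_serializeArg, hlen] at h
  have e : C.argStart g k + r = C.gateStart g + (k * (2 * C.ptrWidth + 2) + r + 1) := by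
    unfold argStart; ring
  rw [e, instanceOf_gate, serializeGate, List.getElem?_cons_succ]
  · exact h
  · rw [length_serializeGate]
    have : (k + 1 : ℕ) * (2 * C.ptrWidth + 2) ≤ (C.args g).length * (2 * C.ptrWidth + 2) :=
      Nat.mul_le_mul_right _ hk
    rw [add_mul] at this
    omega

theorem ptr_getElem? (a : Fin n ⊕ Fin C.size) {i : ℕ} (hi : i < C.ptrWidth) :
    (C.ptr a)[C.ptrWidth - 1 - i]? = some (Tok.bit ((C.index a).testBit i)) := by
  have h : C.ptrWidth - 1 - i < C.ptrWidth := by omega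
  simp [ptr, binary, h, show C.ptrWidth - 1 - (C.ptrWidth - 1 - i) = i by omega]

variable (g : Fin C.size) (k : Fin (C.args g).length)

theorem instanceOf_amp : (C.instanceOf w)[C.argStart g k]? = some Tok.amp :=
  (C.instanceOf_arg w g k 0 (by omega)).trans (by simp [serializeArg])

theorem instanceOf_argBit {i : ℕ} (hi : i < C.ptrWidth) :
    (C.instanceOf w)[C.argEnd g k - i]? =
      some (Tok.bit ((C.index ((C.args g).get k)).testBit i)) := by
  have e : C.argEnd g k - i = C.argStart g k + (C.ptrWidth - 1 - i + 1) := by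
    rw [argEnd_eq]; omega
  rw [e, instanceOf_arg _ _ _ _ _ (by omega), serializeArg, List.getElem?_cons_succ,
    List.getElem?_append_left (by rw [length_ptr]; omega), ptr_getElem? _ _ hi]

theorem instanceOf_hash : (C.instanceOf w)[C.argEnd g k + 1]? = some Tok.hash := by
  rw [argEnd_eq, add_assoc, instanceOf_arg _ _ _ _ _ (by omega), serializeArg,
    List.getElem?_cons_succ, List.getElem?_append_right (by rw [length_ptr])]
  simp [length_ptr]

theorem instanceOf_gateBit {i : ℕ} (hi : i < C.ptrWidth) :
    (C.instanceOf w)[C.argEnd g k + 1 + C.ptrWidth - i]? =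
      some (Tok.bit ((C.index (Sum.inr g)).testBit i)) := by
  have e : C.argEnd g k + 1 + C.ptrWidth - i =
      C.argStart g k + (C.ptrWidth + (C.ptrWidth - 1 - i + 1) + 1) := by rw [argEnd_eq]; omega
  rw [e, instanceOf_arg _ _ _ _ _ (by omega), serializeArg, List.getElem?_cons_succ,
    List.getElem?_append_right (by rw [length_ptr]; omega), length_ptr, Nat.add_sub_cancel_left,
    List.getElem?_cons_succ, ptr_getElem? _ _ hi]

theorem argEnd_lt : C.argEnd g k + 1 + C.ptrWidth < (C.instanceOf w).length := by
  have h : (C.instanceOf w)[C.argStart g k + (2 * C.ptrWidth + 1)]? ≠ none := by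
    rw [instanceOf_arg _ _ _ _ _ (by omega), List.getElem?_eq_getElem (by rw [length_serializeArg]; omega)]
    simp
  rw [ne_eq, List.getElem?_eq_none_iff, not_le] at h
  rw [argEnd_eq]; omega

theorem argStart_succ : C.argStart g (k + 1) = C.argEnd g k + C.ptrWidth + 2 := by
  rw [argEnd_eq]; unfold argStart; ring

/-- The symbol after a gate pointer. -/
theorem instanceOf_after : (C.instanceOf w)[C.argEnd g k + C.ptrWidth + 2]? = none ∨
    (C.instanceOf w)[C.argEnd g k + C.ptrWidth + 2]? = some Tok.amp ∨
    ∃ κ, (C.instanceOf w)[C.argEnd g k + C.ptrWidth + 2]? = some (Tok.gate κ) := by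
  rw [← argStart_succ]
  by_cases hk : (k : ℕ) + 1 < (C.args g).length
  · exact Or.inr (Or.inl (C.instanceOf_amp w g ⟨k + 1, hk⟩))
  have hk' : (k : ℕ) + 1 = (C.args g).length := by omega
  have e : C.argStart g (k + 1) = 2 * n +
      (((List.finRange C.size).take (g + 1)).flatMap C.serializeGate).length := by
    rw [length_take_succ_flatMap _ _ _ (by simp), argStart, gateStart, List.getElem_finRange]
    simp only [Fin.cast_mk, Fin.eta, length_serializeGate, hk']
    ring
  by_cases hg : (g : ℕ) + 1 < C.size
  · exact Or.inr (Or.inr ⟨_, by rw [e]; exact C.instanceOf_gateStart w ⟨g + 1, hg⟩⟩)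
  · left
    rw [List.getElem?_eq_none_iff, e, length_instanceOf, List.take_of_length_le (by simp; omega)]

/-- All positions of the input. -/
theorem position_cases {p : ℕ} (hp : p < (C.instanceOf w).length) :
    p < n ∨ (n ≤ p ∧ p < 2 * n) ∨ (∃ g, p = C.gateStart g) ∨
    ∃ (g : Fin C.size) (k : Fin (C.args g).length) (r : ℕ), r < 2 * C.ptrWidth + 2 ∧
      p = C.argStart g k + r := by
  by_cases h1 : p < n
  · exact Or.inl h1
  by_cases h2 : p < 2 * n
  · exact Or.inr (Or.inl ⟨by omega, h2⟩)
  right; right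
  rw [length_instanceOf] at hp
  obtain ⟨j, hj, r, hr, h⟩ := exists_of_lt_length_flatMap _ _ (p - 2 * n) (by omega :
    p - 2 * n < ((List.finRange C.size).flatMap C.serializeGate).length)
  rw [List.length_finRange] at hj
  have hp' : p = C.gateStart ⟨j, hj⟩ + r := by unfold gateStart; dsimp only; omega
  simp only [List.getElem_finRange, Fin.cast_mk] at hr
  by_cases hr0 : r = 0
  · exact Or.inl ⟨⟨j, hj⟩, by omega⟩
  right
  rw [length_serializeGate, ← length_flatMap_serializeArg _ ⟨j, hj⟩] at hr
  obtain ⟨k, hk, r', hr', h'⟩ := exists_of_lt_length_flatMap _ _ (r - 1) (by omega :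
    r - 1 < ((C.args ⟨j, hj⟩).flatMap (C.serializeArg ⟨j, hj⟩)).length)
  rw [length_serializeArg] at hr'
  rw [length_flatMap_serializeArg, List.length_take, min_eq_left hk.le] at h'
  refine ⟨⟨j, hj⟩, ⟨k, hk⟩, r', hr', ?_⟩
  unfold argStart
  dsimp only
  omega

/-- There is an output gate, and without inputs each gate would have a gate as argument, contrary to
acyclicity. So there are at least two nodes. -/
theorem one_le_ptrWidth : 1 ≤ C.ptrWidth := by
  have hg := C.out.2
  have hn : 1 ≤ n := by
    by_contra h
    have hn : n = 0 := by omega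
    subst hn
    have : ∀ g : Fin C.size, False := by
      intro g
      induction g using C.acyclic.induction with
      | _ g ih =>
        obtain ⟨a, ha⟩ := List.exists_mem_of_ne_nil _ (C.args_ne_nil g)
        rcases a with a | a
        · exact a.elim0
        · exact ih a ha
    exact this C.out
  unfold ptrWidth
  exact Nat.clog_pos (by norm_num) (by omega)

theorem index_lt (a : Fin n ⊕ Fin C.size) : C.index a < 2 ^ C.ptrWidth := by
  have : C.index a < n + C.size := by
    rcases a with a | a <;> simp only [index, Sum.elim_inl, Sum.elim_inr] <;> omega
  exact this.trans_le (Nat.le_pow_clog (by norm_num) _)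

theorem index_injective : Function.Injective C.index := by
  rintro (a | a) (b | b) h <;> simp only [index, Sum.elim_inl, Sum.elim_inr] at h
  · congr; ext; exact h
  · omega
  · omega
  · congr; ext; omega

/-- Each gate contributes at least its type symbol. Hence the number of a node is below the input
length and a pointer fits into the blocks. -/
theorem size_le_length : n + C.size ≤ (C.instanceOf w).length := by
  rw [length_instanceOf, List.length_flatMap]
  have : (List.finRange C.size).length • 1 ≤ ((List.finRange C.size).map
      fun g => (C.serializeGate g).length).sum := by
    rw [← List.length_map (f := fun g => (C.serializeGate g).length)]
    apply List.card_nsmul_le_sum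
    intro z hz
    obtain ⟨g, -, rfl⟩ := List.mem_map.1 hz
    rw [length_serializeGate]; omega
  simp only [List.length_finRange, smul_eq_mul, mul_one] at this
  omega

theorem gateStart_ge (g : Fin C.size) : 2 * n ≤ C.gateStart g := by unfold gateStart; omega

end Circuit

/-! ### The evaluation in terms of positions. -/

open Instr

/-- The input positions. -/
def isInput (x : List Tok) (n p : ℕ) : Bool :=
  tk x .bit p && !spread (tk x .mark) (tk x .bit) n p

/-- Whether some argument position of the same gate satisfies `S`. -/
def SomeArg (x : List Tok) (m n : ℕ) (S : ℕ → Bool) (p : ℕ) : Prop :=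
  ∃ j < x.length + 1, isArgEnd x j = true ∧ S j = true ∧
    ∀ i < m, readGate x n p i = readGate x n j i

/-- Whether some argument pointer points to the gate at `p`. -/
def IsUsed (x : List Tok) (m n : ℕ) (p : ℕ) : Prop :=
  ∃ j < x.length + 1, isArgEnd x j = true ∧ ∀ i < m, readGate x n p i = readBits x n j i

/-- The key of a node at position `p`. -/
def nodeKey (x : List Tok) (n p i : ℕ) : Bool :=
  (isInput x n p && p.testBit i) || (isArgEnd x p && readGate x n p i)

/-- The negated key of a node at position `p`. -/
def nodeKeyNeg (x : List Tok) (n p i : ℕ) : Bool :=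
  (isInput x n p && !p.testBit i) || (isArgEnd x p && !readGate x n p i)

/-- Whether the argument of the pointer at `p` has the value one. -/
def ArgTrue (x : List Tok) (m n : ℕ) (V : ℕ → Bool) (p : ℕ) : Prop :=
  ∃ j < x.length + 1, (∀ i < m, ¬(readBits x n p i = true ∧ nodeKeyNeg x n j i = true) ∧
    ¬(readBits x n p i = false ∧ nodeKey x n j i = true)) ∧ V j = true

open Classical in
/-- Negation of the arguments of a gate. -/
noncomputable def negatesIn (x : List Tok) (m n p : ℕ) : Bool :=
  isArgEnd x p && decide (SomeArg x m n (spread (tk x .isAnd) (tk x .ampBit) n) p)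

open Classical in
/-- Negation of the result of a gate. -/
noncomputable def negatesOut (x : List Tok) (m n p : ℕ) : Bool :=
  isArgEnd x p && decide (SomeArg x m n (spread (tk x .isNeg) (tk x .ampBit) n) p)

open Classical in
/-- The argument values as they enter the disjunction of a gate. -/
noncomputable def literal (x : List Tok) (m n : ℕ) (V : ℕ → Bool) (p : ℕ) : Bool :=
  isArgEnd x p && ((decide (ArgTrue x m n V p)) ^^ negatesIn x m n p)

open Classical in
/-- The values of all nodes after one step. -/
noncomputable def stepVal (x : List Tok) (m n : ℕ) (V : ℕ → Bool) (p : ℕ) : Bool :=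
  (isArgEnd x p && (decide (SomeArg x m n (literal x m n V) p) ^^ negatesOut x m n p)) ||
    (isInput x n p && tk x .one p)

open Classical in
/-- The positions of gates that feed no other gate. -/
noncomputable def isSink (x : List Tok) (m n p : ℕ) : Bool :=
  isArgEnd x p && !decide (IsUsed x m n p)

/-- The state between two steps of evaluation, with node values `V`. -/
structure Ready (x : List Tok) (m n : ℕ) (V : ℕ → Bool) (β : State) : Prop where
  argR : ∀ p i, β p i .argR = readBits x n p i
  gateR : ∀ p i, β p i .gateR = readGate x n p i
  argE : ∀ p i, β p i .argE = isArgEnd x p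
  aq : ∀ p i, β p i .aq = (isArgEnd x p && readBits x n p i)
  naq : ∀ p i, β p i .naq = (isArgEnd x p && !readBits x n p i)
  gq : ∀ p i, β p i .gq = (isArgEnd x p && readGate x n p i)
  ngq : ∀ p i, β p i .ngq = (isArgEnd x p && !readGate x n p i)
  inpOne : ∀ p i, β p i .inpOne = (isInput x n p && tk x .one p)
  nodeK : ∀ p i, β p i .nodeK = nodeKey x n p i
  nnodeK : ∀ p i, β p i .nnodeK = nodeKeyNeg x n p i
  negIn : ∀ p i, β p i .negIn = negatesIn x m n p
  negOut : ∀ p i, β p i .negOut = negatesOut x m n p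
  sink : ∀ p i, β p i .sink = isSink x m n p
  zero : ∀ p i, β p i .zero = false
  val : ∀ p i, β p i .val = V p

theorem isArgEnd_of_length_le {x : List Tok} {p : ℕ} (h : x.length ≤ p) : isArgEnd x p = false := by
  simp [isArgEnd, tk_of_length_le h]

theorem isInput_of_length_le {x : List Tok} {n p : ℕ} (h : x.length ≤ p) :
    isInput x n p = false := by
  simp [isInput, tk_of_length_le h]

theorem isInput_lt {x : List Tok} {n p : ℕ} (h : isInput x n p = true) : p < x.length := by
  by_contra h'
  rw [isInput_of_length_le (not_lt.1 h')] at h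
  simp at h

section Gates

variable {x : List Tok} {m n : ℕ} {β : State}
  (hgq : ∀ p i, β p i .gq = (isArgEnd x p && readGate x n p i))
  (hngq : ∀ p i, β p i .ngq = (isArgEnd x p && !readGate x n p i))
include hgq hngq

/-- Positions other than argument ends have zero keys and match every query, so `S` has to be false
there. -/
theorem someArg_iff {p : ℕ} (hp : isArgEnd x p = true) {S : ℕ → Bool}
    (hS : ∀ j, S j = true → isArgEnd x j = true) :
    (∃ j < x.length + 1, Matches m β .gq .ngq .ngq .gq p j ∧ S j = true) ↔ SomeArg x m n S p := by
  unfold SomeArg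
  refine exists_congr fun j => and_congr_right fun _ => ?_
  constructor
  · rintro ⟨h1, h2⟩
    exact ⟨hS j h2, h2, (matches_iff (by simp [hgq, hp]) (by simp [hngq, hp])
      (by simp [hgq, hS j h2]) (by simp [hngq, hS j h2])).1 h1⟩
  · rintro ⟨h1, h2, h3⟩
    exact ⟨(matches_iff (f := readGate x n p) (g := readGate x n j) (by simp [hgq, hp])
      (by simp [hngq, hp]) (by simp [hgq, h1]) (by simp [hngq, h1])).2 h3, h2⟩

theorem isUsed_iff (haq : ∀ p i, β p i .aq = (isArgEnd x p && readBits x n p i))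
    (hnaq : ∀ p i, β p i .naq = (isArgEnd x p && !readBits x n p i))
    {p : ℕ} (hp : isArgEnd x p = true) :
    (∃ j < x.length + 1, Matches m β .gq .naq .ngq .aq p j ∧ isArgEnd x j = true) ↔
      IsUsed x m n p := by
  unfold IsUsed
  refine exists_congr fun j => and_congr_right fun _ => ?_
  rw [and_comm]
  refine and_congr_right fun h => ?_
  exact matches_iff (by simp [hgq, hp]) (by simp [hngq, hp]) (by simp [haq, h]) (by simp [hnaq, h])

end Gates

theorem triple_fin (x : List Tok) (m n : ℕ) :
    Triple (x.length + 1) m (Reading x n) finProg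
      (Ready x m n fun p => isInput x n p && tk x .one p) := by
  intro β h
  have e₁ : finProg = finProg.take 11 ++ finProg.drop 11 := rfl
  set β₁ := evalList (x.length + 1) m (finProg.take 11) β with hβ₁
  have hs := h.static
  have ok₁ : OkList (x.length + 1) m (finProg.take 11) β := by simp [finProg, OkList, Instr.Ok]
  have haq : ∀ p i, β₁ p i .aq = (isArgEnd x p && readBits x n p i) := by
    intro p i; simp [hβ₁, finProg, evalList, Instr.eval, hs.argE, h.argR]
  have hnaq : ∀ p i, β₁ p i .naq = (isArgEnd x p && !readBits x n p i) := by
    intro p i; simp [hβ₁, finProg, evalList, Instr.eval, hs.argE, h.argR]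
  have hgq : ∀ p i, β₁ p i .gq = (isArgEnd x p && readGate x n p i) := by
    intro p i; simp [hβ₁, finProg, evalList, Instr.eval, hs.argE, h.gateR]
  have hngq : ∀ p i, β₁ p i .ngq = (isArgEnd x p && !readGate x n p i) := by
    intro p i; simp [hβ₁, finProg, evalList, Instr.eval, hs.argE, h.gateR]
  have hinpOne : ∀ p i, β₁ p i .inpOne = (isInput x n p && tk x .one p) := by
    intro p i; simp [hβ₁, finProg, evalList, Instr.eval, hs.bit, hs.one, h.inPtr, isInput]
  have hval : ∀ p i, β₁ p i .val = (isInput x n p && tk x .one p) := by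
    intro p i; simp [hβ₁, finProg, evalList, Instr.eval, hs.bit, hs.one, h.inPtr, isInput]
  have hnodeK : ∀ p i, β₁ p i .nodeK = nodeKey x n p i := by
    intro p i
    have : β₁ p i .nodeK = ((isInput x n p && (p.testBit i && decide (p < x.length))) ||
        (isArgEnd x p && readGate x n p i)) := by
      simp [hβ₁, finProg, evalList, Instr.eval, hs.bit, hs.argE, h.inPtr, h.gateR, hs.pk, isInput]
    rw [this, nodeKey]
    by_cases hi : isInput x n p = true
    · simp [isInput_lt hi]
    · simp [hi]
  have hnnodeK : ∀ p i, β₁ p i .nnodeK = nodeKeyNeg x n p i := by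
    intro p i
    have : β₁ p i .nnodeK = ((isInput x n p && (!p.testBit i && decide (p < x.length))) ||
        (isArgEnd x p && !readGate x n p i)) := by
      simp [hβ₁, finProg, evalList, Instr.eval, hs.bit, hs.argE, h.inPtr, h.gateR, hs.npk, isInput]
    rw [this, nodeKeyNeg]
    by_cases hi : isInput x n p = true
    · simp [isInput_lt hi]
    · simp [hi]
  have hkeep : ∀ p i f, (f = .argR ∨ f = .gateR ∨ f = .argE ∨ f = .kAnd ∨ f = .kNeg ∨ f = .zero) →
      β₁ p i f = β p i f := by
    intro p i f hf
    rcases hf with rfl | rfl | rfl | rfl | rfl | rfl <;>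
      simp [hβ₁, finProg, evalList, Instr.eval]
  have hargE : ∀ p i, β₁ p i .argE = isArgEnd x p := fun p i => by
    rw [hkeep _ _ _ (by simp), hs.argE]
  have hkAnd : ∀ p i, β₁ p i .kAnd = spread (tk x .isAnd) (tk x .ampBit) n p := fun p i => by
    rw [hkeep _ _ _ (by simp), h.kAnd]
  have hkNeg : ∀ p i, β₁ p i .kNeg = spread (tk x .isNeg) (tk x .ampBit) n p := fun p i => by
    rw [hkeep _ _ _ (by simp), h.kNeg]
  rw [e₁, okList_append, evalList_append, ← hβ₁]
  set β₂ := evalList (x.length + 1) m (finProg.drop 11) β₁ with hβ₂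
  have hrest : ∀ p i f, f ≠ .t → f ≠ .u → f ≠ .negIn → f ≠ .negOut → f ≠ .sink →
      β₂ p i f = β₁ p i f := by
    intro p i f h1 h2 h3 h4 h5
    simp [hβ₂, finProg, evalList, Instr.eval, h1, h2, h3, h4, h5]
  have hmask : ∀ (S : ℕ → Bool) p, isArgEnd x p = true →
      ((∃ j < x.length + 1, Matches m β₁ .gq .ngq .ngq .gq p j ∧ (isArgEnd x j && S j) = true) ↔
      SomeArg x m n S p) := by
    intro S p hp
    rw [someArg_iff hgq hngq hp (fun j hj => by simp at hj; exact hj.1)]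
    unfold SomeArg
    refine exists_congr fun j => and_congr_right fun _ => and_congr_right fun hj => ?_
    simp [hj]
  refine ⟨⟨ok₁, ?_⟩, ?_⟩
  · have hd : ∀ i f, (f = .gq ∨ f = .ngq ∨ f = .aq ∨ f = .naq) → β₁ x.length i f = false := by
      intro i f hf
      rcases hf with rfl | rfl | rfl | rfl <;>
        simp [haq, hnaq, hgq, hngq, isArgEnd_of_length_le (x := x) le_rfl]
    refine ⟨trivial, ⟨x.length, by omega, fun i _ => ?_⟩, trivial, trivial,
      ⟨x.length, by omega, fun i _ => ?_⟩, trivial, ⟨x.length, by omega, fun i _ => ?_⟩, trivial,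
      trivial⟩ <;> simp [Instr.eval, hd]
  refine ⟨?_, ?_, ?_, ?_, ?_, ?_, ?_, ?_, ?_, ?_, ?_, ?_, ?_, ?_, ?_⟩ <;> intro p i
  · rw [hrest _ _ _ (by simp) (by simp) (by simp) (by simp) (by simp), hkeep _ _ _ (by simp), h.argR]
  · rw [hrest _ _ _ (by simp) (by simp) (by simp) (by simp) (by simp), hkeep _ _ _ (by simp), h.gateR]
  · rw [hrest _ _ _ (by simp) (by simp) (by simp) (by simp) (by simp), hargE]
  · rw [hrest _ _ _ (by simp) (by simp) (by simp) (by simp) (by simp), haq]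
  · rw [hrest _ _ _ (by simp) (by simp) (by simp) (by simp) (by simp), hnaq]
  · rw [hrest _ _ _ (by simp) (by simp) (by simp) (by simp) (by simp), hgq]
  · rw [hrest _ _ _ (by simp) (by simp) (by simp) (by simp) (by simp), hngq]
  · rw [hrest _ _ _ (by simp) (by simp) (by simp) (by simp) (by simp), hinpOne]
  · rw [hrest _ _ _ (by simp) (by simp) (by simp) (by simp) (by simp), hnodeK]
  · rw [hrest _ _ _ (by simp) (by simp) (by simp) (by simp) (by simp), hnnodeK]
  · simp only [hβ₂, finProg, evalList, List.drop, List.foldl, Instr.eval, reduceCtorEq, if_false,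
      if_true, source, hargE, hkAnd, beq_true, Bool.false_eq_true, negatesIn, Matches]
    by_cases hp : isArgEnd x p = true
    · have := hmask (spread (tk x .isAnd) (tk x .ampBit) n) p hp
      simp only [Matches] at this
      exact congrArg _ (decide_eq_decide.2 this)
    · simp [hp]
  · simp only [hβ₂, finProg, evalList, List.drop, List.foldl, Instr.eval, reduceCtorEq, if_false,
      if_true, source, hargE, hkNeg, beq_true, Bool.false_eq_true, negatesOut, Matches]
    by_cases hp : isArgEnd x p = true
    · have := hmask (spread (tk x .isNeg) (tk x .ampBit) n) p hp
      simp only [Matches] at this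
      exact congrArg _ (decide_eq_decide.2 this)
    · simp [hp]
  · simp only [hβ₂, finProg, evalList, List.drop, List.foldl, Instr.eval, reduceCtorEq, if_false,
      if_true, source, hargE, beq_true, Bool.false_eq_true, isSink, Matches]
    by_cases hp : isArgEnd x p = true
    · have := isUsed_iff (m := m) hgq hngq haq hnaq hp
      simp only [Matches] at this
      rw [hp, ← (@decide_eq_decide _ _ (Classical.propDecidable _) (Classical.propDecidable _)).2
        this]
      simp
    · simp [hp]
  · rw [hrest _ _ _ (by simp) (by simp) (by simp) (by simp) (by simp), hkeep _ _ _ (by simp),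
      hs.zero]
  · rw [hrest _ _ _ (by simp) (by simp) (by simp) (by simp) (by simp), hval]

-- The program is cut after the argument literals and after the new node values; the last two
-- instructions broadcast the value of the output gate into `t`.
open Classical in
theorem triple_step (x : List Tok) (m n : ℕ) (V : ℕ → Bool) :
    Triple (x.length + 1) m (Ready x m n V) stepProg fun β => Ready x m n (stepVal x m n V) β ∧
      ∀ p i, β p i .t = decide (∃ j < x.length + 1, isSink x m n j = true ∧
        stepVal x m n V j = true) := by
  intro β h
  have e₁ : stepProg = stepProg.take 5 ++ stepProg.drop 5 := rfl
  set β₁ := evalList (x.length + 1) m (stepProg.take 5) β with hβ₁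
  have hrest₁ : ∀ p i f, f ≠ .t → f ≠ .u → f ≠ .v → f ≠ .lit → β₁ p i f = β p i f := by
    intro p i f h1 h2 h3 h4
    simp [hβ₁, stepProg, evalList, Instr.eval, h1, h2, h3, h4]
  have hlit : ∀ p i, β₁ p i .lit = literal x m n V p := by
    intro p i
    simp only [hβ₁, stepProg, evalList, List.take, List.foldl, Instr.eval, reduceCtorEq, if_false,
      if_true, source, h.argE, h.negIn, h.val, beq_true, Bool.false_eq_true, literal, Matches]
    by_cases hp : isArgEnd x p = true
    · have : (∃ j < x.length + 1, (∀ i < m, ¬(β p i .aq = true ∧ β j i .nnodeK = true) ∧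
          ¬(β p i .naq = true ∧ β j i .nodeK = true)) ∧ V j = true) ↔ ArgTrue x m n V p := by
        simp [ArgTrue, h.aq, h.naq, h.nodeK, h.nnodeK, hp]
      simp only [this, hp]
      cases decide (ArgTrue x m n V p) <;> cases negatesIn x m n p <;> rfl
    · simp [hp]
  have hgq : ∀ p i, β₁ p i .gq = (isArgEnd x p && readGate x n p i) := fun p i => by
    rw [hrest₁ _ _ _ (by simp) (by simp) (by simp) (by simp), h.gq]
  have hngq : ∀ p i, β₁ p i .ngq = (isArgEnd x p && !readGate x n p i) := fun p i => by
    rw [hrest₁ _ _ _ (by simp) (by simp) (by simp) (by simp), h.ngq]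
  have hargE : ∀ p i, β₁ p i .argE = isArgEnd x p := fun p i => by
    rw [hrest₁ _ _ _ (by simp) (by simp) (by simp) (by simp), h.argE]
  have hnegOut : ∀ p i, β₁ p i .negOut = negatesOut x m n p := fun p i => by
    rw [hrest₁ _ _ _ (by simp) (by simp) (by simp) (by simp), h.negOut]
  have hinpOne : ∀ p i, β₁ p i .inpOne = (isInput x n p && tk x .one p) := fun p i => by
    rw [hrest₁ _ _ _ (by simp) (by simp) (by simp) (by simp), h.inpOne]
  rw [e₁, okList_append, evalList_append, ← hβ₁]
  have e₂ : stepProg.drop 5 = (stepProg.drop 5).take 6 ++ stepProg.drop 11 := rfl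
  set β₂ := evalList (x.length + 1) m ((stepProg.drop 5).take 6) β₁ with hβ₂
  have hrest₂ : ∀ p i f, f ≠ .t → f ≠ .u → f ≠ .v → f ≠ .val → β₂ p i f = β₁ p i f := by
    intro p i f h1 h2 h3 h4
    simp [hβ₂, stepProg, evalList, Instr.eval, h1, h2, h3, h4]
  have hval : ∀ p i, β₂ p i .val = stepVal x m n V p := by
    intro p i
    simp only [hβ₂, stepProg, evalList, List.drop, List.take, List.foldl, Instr.eval, reduceCtorEq,
      if_false, if_true, source, hargE, hnegOut, hlit, hinpOne, beq_true, Bool.false_eq_true,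
      stepVal, Matches]
    by_cases hp : isArgEnd x p = true
    · have := someArg_iff (m := m) hgq hngq hp (S := literal x m n V)
        (fun j hj => by simp [literal] at hj; exact hj.1)
      simp only [Matches] at this
      simp only [this, hp]
      cases decide (SomeArg x m n (literal x m n V) p) <;> cases negatesOut x m n p <;>
        cases (isInput x n p && tk x .one p) <;> rfl
    · simp only [hp]
      cases (isInput x n p && tk x .one p) <;> simp
  rw [e₂, okList_append, evalList_append, ← hβ₂]
  set β₃ := evalList (x.length + 1) m (stepProg.drop 11) β₂ with hβ₃
  have hrest : ∀ p i f, f ≠ .t → f ≠ .u → f ≠ .v → f ≠ .val → f ≠ .lit → f ≠ .outV →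
      β₃ p i f = β p i f := by
    intro p i f h1 h2 h3 h4 h5 h6
    rw [← hrest₁ p i f h1 h2 h3 h5, ← hrest₂ p i f h1 h2 h3 h4]
    simp [hβ₃, stepProg, evalList, Instr.eval, h1, h6]
  have hzero : ∀ p i, β₂ p i .zero = false := fun p i => by
    rw [hrest₂ _ _ _ (by simp) (by simp) (by simp) (by simp),
      hrest₁ _ _ _ (by simp) (by simp) (by simp) (by simp), h.zero]
  have hsink : ∀ p i, β₂ p i .sink = isSink x m n p := fun p i => by
    rw [hrest₂ _ _ _ (by simp) (by simp) (by simp) (by simp),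
      hrest₁ _ _ _ (by simp) (by simp) (by simp) (by simp), h.sink]
  have hA := isArgEnd_of_length_le (x := x) le_rfl
  have hI := isInput_of_length_le (x := x) (n := n) le_rfl
  refine ⟨⟨?_, ?_, ?_⟩, ⟨?_, ?_, ?_, ?_, ?_, ?_, ?_, ?_, ?_, ?_, ?_, ?_, ?_, ?_, ?_⟩, ?_⟩
  · refine ⟨⟨x.length, by omega, fun i _ => ?_⟩, trivial, trivial, trivial, trivial, trivial⟩
    rw [h.nodeK, h.nnodeK, nodeKey, nodeKeyNeg, hA, hI]; simp
  · refine ⟨⟨x.length, by omega, fun i _ => ?_⟩, trivial, trivial, trivial, trivial, trivial, trivial⟩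
    rw [hgq, hngq, hA]; simp
  · refine ⟨trivial, ⟨x.length, by omega, fun i _ => ?_⟩, trivial⟩
    simp [Instr.eval, hzero]
  all_goals intro p i
  · rw [hrest _ _ _ (by simp) (by simp) (by simp) (by simp) (by simp) (by simp), h.argR]
  · rw [hrest _ _ _ (by simp) (by simp) (by simp) (by simp) (by simp) (by simp), h.gateR]
  · rw [hrest _ _ _ (by simp) (by simp) (by simp) (by simp) (by simp) (by simp), h.argE]
  · rw [hrest _ _ _ (by simp) (by simp) (by simp) (by simp) (by simp) (by simp), h.aq]
  · rw [hrest _ _ _ (by simp) (by simp) (by simp) (by simp) (by simp) (by simp), h.naq]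
  · rw [hrest _ _ _ (by simp) (by simp) (by simp) (by simp) (by simp) (by simp), h.gq]
  · rw [hrest _ _ _ (by simp) (by simp) (by simp) (by simp) (by simp) (by simp), h.ngq]
  · rw [hrest _ _ _ (by simp) (by simp) (by simp) (by simp) (by simp) (by simp), h.inpOne]
  · rw [hrest _ _ _ (by simp) (by simp) (by simp) (by simp) (by simp) (by simp), h.nodeK]
  · rw [hrest _ _ _ (by simp) (by simp) (by simp) (by simp) (by simp) (by simp), h.nnodeK]
  · rw [hrest _ _ _ (by simp) (by simp) (by simp) (by simp) (by simp) (by simp), h.negIn]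
  · rw [hrest _ _ _ (by simp) (by simp) (by simp) (by simp) (by simp) (by simp), h.negOut]
  · rw [hrest _ _ _ (by simp) (by simp) (by simp) (by simp) (by simp) (by simp), h.sink]
  · rw [hrest _ _ _ (by simp) (by simp) (by simp) (by simp) (by simp) (by simp), h.zero]
  · rw [← hval p i]; simp [hβ₃, stepProg, evalList, Instr.eval]
  · simp [hβ₃, stepProg, evalList, Instr.eval, source, Matches, hzero, hsink, hval]

theorem tokFlag_of_bit (b : Bool) :
    tokFlag .bit (some (Tok.bit b)) = true ∧ tokFlag .one (some (Tok.bit b)) = b ∧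
    tokFlag .hash (some (Tok.bit b)) = false ∧ tokFlag .mark (some (Tok.bit b)) = false ∧
    tokFlag .bitHash (some (Tok.bit b)) = true ∧ tokFlag .isAnd (some (Tok.bit b)) = false ∧
    tokFlag .isNeg (some (Tok.bit b)) = false ∧ tokFlag .ampBit (some (Tok.bit b)) = true := by
  cases b <;> simp [Tok.bit, tokFlag]

/-! ### The registers on a serialized circuit. -/

namespace Circuit

variable {n : ℕ} (C : Circuit n) (w : Fin n → Bool)

/-- All positions of the input, with their role. -/
theorem position_cases' {p : ℕ} (hp : p < (C.instanceOf w).length) :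
    (∃ i : Fin n, p = i) ∨ (n ≤ p ∧ p < 2 * n) ∨ (∃ g, p = C.gateStart g) ∨
    ∃ (g : Fin C.size) (k : Fin (C.args g).length), p = C.argStart g k ∨
      (∃ i < C.ptrWidth, p = C.argEnd g k - i) ∨ p = C.argEnd g k + 1 ∨
      ∃ i < C.ptrWidth, p = C.argEnd g k + 1 + C.ptrWidth - i := by
  rcases C.position_cases w hp with h | h | h | ⟨g, k, r, hr, h⟩
  · exact Or.inl ⟨⟨p, h⟩, rfl⟩
  · exact Or.inr (Or.inl h)
  · exact Or.inr (Or.inr (Or.inl h))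
  · refine Or.inr (Or.inr (Or.inr ⟨g, k, ?_⟩))
    rw [argEnd_eq]
    by_cases h0 : r = 0
    · left; omega
    by_cases h1 : r ≤ C.ptrWidth
    · right; left; exact ⟨C.ptrWidth - r, by omega, by omega⟩
    by_cases h2 : r = C.ptrWidth + 1
    · right; right; left; omega
    · right; right; right; exact ⟨2 * C.ptrWidth + 1 - r, by omega, by omega⟩

variable {w}

theorem tk_input (f : Fld) (i : Fin n) : tk (C.instanceOf w) f i = tokFlag f (some (Tok.bit (w i))) := by
  rw [tk, instanceOf_input]

theorem tk_X (f : Fld) {p : ℕ} (h₁ : n ≤ p) (h₂ : p < 2 * n) :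
    tk (C.instanceOf w) f p = tokFlag f (some .X) := by
  rw [tk, C.instanceOf_X w h₁ h₂]

theorem tk_gateStart (f : Fld) (g : Fin C.size) :
    tk (C.instanceOf w) f (C.gateStart g) = tokFlag f (some (Tok.gate (C.kind g))) := by
  rw [tk, instanceOf_gateStart]

variable (g : Fin C.size) (k : Fin (C.args g).length)

theorem tk_amp (f : Fld) : tk (C.instanceOf w) f (C.argStart g k) = tokFlag f (some .amp) := by
  rw [tk, instanceOf_amp]

theorem tk_hash (f : Fld) : tk (C.instanceOf w) f (C.argEnd g k + 1) = tokFlag f (some .hash) := by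
  rw [tk, instanceOf_hash]

theorem tk_argBit (f : Fld) {i : ℕ} (hi : i < C.ptrWidth) :
    tk (C.instanceOf w) f (C.argEnd g k - i) =
      tokFlag f (some (Tok.bit ((C.index ((C.args g).get k)).testBit i))) := by
  rw [tk, C.instanceOf_argBit w g k hi]

theorem tk_gateBit (f : Fld) {i : ℕ} (hi : i < C.ptrWidth) :
    tk (C.instanceOf w) f (C.argEnd g k + 1 + C.ptrWidth - i) =
      tokFlag f (some (Tok.bit ((C.index (Sum.inr g)).testBit i))) := by
  rw [tk, C.instanceOf_gateBit w g k hi]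

theorem isArgEnd_argEnd : isArgEnd (C.instanceOf w) (C.argEnd g k) = true := by
  have := C.tk_argBit (w := w) g k .bit (i := 0) C.one_le_ptrWidth
  rw [Nat.sub_zero] at this
  rw [isArgEnd, this, tk_hash, (tokFlag_of_bit _).1]
  rfl

/-- No other bit is followed by `#`: inside a pointer another bit follows, after an input bit a bit
or `X`, and after a gate pointer `&`, a type symbol, or padding. -/
theorem isArgEnd_iff {p : ℕ} : isArgEnd (C.instanceOf w) p = true ↔
    ∃ (g : Fin C.size) (k : Fin (C.args g).length), p = C.argEnd g k := by
  constructor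
  swap
  · rintro ⟨g, k, rfl⟩; exact C.isArgEnd_argEnd g k
  intro h
  have hp : p < (C.instanceOf w).length := by
    by_contra h'; rw [isArgEnd_of_length_le (not_lt.1 h')] at h; simp at h
  have hW := C.one_le_ptrWidth
  rw [isArgEnd, Bool.and_eq_true] at h
  obtain ⟨h1, h2⟩ := h
  rcases C.position_cases' w hp with ⟨i, rfl⟩ | ⟨ha, hb⟩ | ⟨g, rfl⟩ | ⟨g, k, rfl | ⟨i, hi, rfl⟩ | rfl | ⟨i, hi, rfl⟩⟩
  · by_cases hi : (i : ℕ) + 1 < n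
    · have := C.tk_input (w := w) .hash ⟨i + 1, hi⟩
      rw [(tokFlag_of_bit _).2.2.1] at this
      rw [this] at h2; simp at h2
    · rw [C.tk_X _ (by omega) (by omega)] at h2; simp [tokFlag] at h2
  · rw [C.tk_X _ ha hb] at h1; simp [tokFlag] at h1
  · rw [tk_gateStart] at h1
    cases hk : C.kind g <;> simp [hk, Tok.gate, tokFlag] at h1
  · rw [tk_amp] at h1; simp [tokFlag] at h1
  · rcases i with _ | i
    · exact ⟨g, k, by simp⟩
    · have hle : C.ptrWidth ≤ C.argEnd g k := by rw [argEnd_eq]; omega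
      rw [show C.argEnd g k - (i + 1) + 1 = C.argEnd g k - i by omega,
        C.tk_argBit g k _ (by omega), (tokFlag_of_bit _).2.2.1] at h2
      simp at h2
  · rw [tk_hash] at h1; simp [tokFlag] at h1
  · rcases i with _ | i
    · have := C.instanceOf_after w g k
      rw [show C.argEnd g k + 1 + C.ptrWidth - 0 + 1 = C.argEnd g k + C.ptrWidth + 2 by omega, tk] at h2
      rcases this with h | h | ⟨κ, h⟩ <;> rw [h] at h2
      · simp [tokFlag] at h2
      · simp [tokFlag] at h2
      · cases κ <;> simp [tokFlag, Tok.gate] at h2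
    · rw [show C.argEnd g k + 1 + C.ptrWidth - (i + 1) + 1 = C.argEnd g k + 1 + C.ptrWidth - i by
        omega, C.tk_gateBit g k _ (by omega), (tokFlag_of_bit _).2.2.1] at h2
      simp at h2

theorem testBit_index_of_le {a : Fin n ⊕ Fin C.size} {i : ℕ} (h : C.ptrWidth ≤ i) :
    (C.index a).testBit i = false :=
  Nat.testBit_eq_false_of_lt ((C.index_lt a).trans_le (Nat.pow_le_pow_right (by norm_num) h))

variable {n' : ℕ} (hn : 2 * C.ptrWidth + 1 ≤ n')

-- The `&` in front of the pointer stops the reading, so the blocks beyond the pointer hold zeros.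
include hn in
theorem readBits_argEnd (i : ℕ) : readBits (C.instanceOf w) n' (C.argEnd g k) i =
    (C.index ((C.args g).get k)).testBit i := by
  have hle : C.ptrWidth ≤ C.argEnd g k := by rw [argEnd_eq]; omega
  by_cases hi : i < C.ptrWidth
  · rw [readBits_eq (by omega) (by omega), C.tk_argBit g k _ hi, (tokFlag_of_bit _).2.1]
    intro l hl
    rw [C.tk_argBit g k _ (by omega), (tokFlag_of_bit _).1]
  · rw [C.testBit_index_of_le (not_lt.1 hi), readBits_eq_false C.ptrWidth (not_lt.1 hi) hle]
    rw [show C.argEnd g k - C.ptrWidth = C.argStart g k by rw [argEnd_eq]; omega, tk_amp]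
    rfl

theorem isGateEnd_gateEnd :
    isGateEnd (C.instanceOf w) (C.argEnd g k + 1 + C.ptrWidth) = true := by
  have hW := C.one_le_ptrWidth
  have h1 := C.tk_gateBit (w := w) g k .bit (i := 0) hW
  rw [Nat.sub_zero] at h1
  have := C.instanceOf_after w g k
  rw [isGateEnd, h1, (tokFlag_of_bit _).1, show C.argEnd g k + 1 + C.ptrWidth + 1 =
    C.argEnd g k + C.ptrWidth + 2 by omega, tk]
  rcases this with h | h | ⟨κ, h⟩ <;> rw [h]
  · simp [tokFlag]
  · simp [tokFlag]
  · cases κ <;> simp [tokFlag, Tok.gate]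

theorem isInner_of_lt {l : ℕ} (hl : l < C.ptrWidth + 1) :
    isInner (C.instanceOf w) (C.argEnd g k + l) = true := by
  have h0 := C.argEnd_lt w g k
  have hW := C.one_le_ptrWidth
  have : isGateEnd (C.instanceOf w) (C.argEnd g k + l) = false := by
    rw [isGateEnd]
    rcases l with _ | _ | l
    · rw [Nat.add_zero, tk_hash]; simp [tokFlag]
    · rw [Nat.zero_add, tk_hash]; simp [tokFlag]
    · have := C.tk_gateBit (w := w) g k .bitHash (i := C.ptrWidth - (l + 2)) (by omega)
      rw [(tokFlag_of_bit _).2.2.2.2.1] at this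
      rw [show C.argEnd g k + (l + 1 + 1) + 1 =
        C.argEnd g k + 1 + C.ptrWidth - (C.ptrWidth - (l + 2)) by omega, this]
      simp
  rw [isInner, this]
  simp only [Bool.not_false, Bool.true_and, decide_eq_true_eq]
  omega

-- The gate pointer ends `C.ptrWidth + 1` places to the right. Carrying over this distance and
-- reading `C.ptrWidth` bits accounts for the bound on the number of rounds.
include hn in
theorem readGate_argEnd (i : ℕ) : readGate (C.instanceOf w) n' (C.argEnd g k) i =
    (C.index (Sum.inr g)).testBit i := by
  rw [readGate_eq (C.ptrWidth + 1) (by have := C.one_le_ptrWidth; omega)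
    (fun l hl => C.isInner_of_lt g k hl)
    (by have := C.isGateEnd_gateEnd (w := w) g k
        rwa [show C.argEnd g k + (C.ptrWidth + 1) = C.argEnd g k + 1 + C.ptrWidth by ring])]
  rw [show C.argEnd g k + (C.ptrWidth + 1) = C.argEnd g k + 1 + C.ptrWidth by ring]
  by_cases hi : i < C.ptrWidth
  · rw [readBits_eq (by omega) (by omega), C.tk_gateBit g k _ hi, (tokFlag_of_bit _).2.1]
    intro l hl
    rw [C.tk_gateBit g k _ (by omega), (tokFlag_of_bit _).1]
  · rw [C.testBit_index_of_le (not_lt.1 hi), readBits_eq_false C.ptrWidth (not_lt.1 hi) (by omega)]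
    rw [show C.argEnd g k + 1 + C.ptrWidth - C.ptrWidth = C.argEnd g k + 1 by omega, tk_hash]
    rfl

-- To the left of a pointer bit there is `&` or `#` with only bits in between, whereas the run of
-- bits that contains an input reaches back to the beginning of the string.
include hn in
theorem isInput_iff {p : ℕ} : isInput (C.instanceOf w) n' p = true ↔ p < n := by
  have hW := C.one_le_ptrWidth
  constructor
  swap
  · intro hp
    have h1 : spread (tk (C.instanceOf w) .mark) (tk (C.instanceOf w) .bit) n' p = false := by
      refine spread_eq_false (p + 1) (fun h => by omega) fun l _ hl => ?_
      have := C.tk_input (w := w) .mark ⟨p - l, by omega⟩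
      rw [(tokFlag_of_bit _).2.2.2.1] at this
      exact this
    rw [isInput, h1]
    have := C.tk_input (w := w) .bit ⟨p, hp⟩
    rw [(tokFlag_of_bit _).1] at this
    rw [this]; rfl
  intro h
  have hp : p < (C.instanceOf w).length := isInput_lt h
  rw [isInput, Bool.and_eq_true, Bool.not_eq_true'] at h
  obtain ⟨h1, h2⟩ := h
  rcases C.position_cases' w hp with ⟨i, rfl⟩ | ⟨ha, hb⟩ | ⟨g, rfl⟩ | ⟨g, k, rfl | ⟨i, hi, rfl⟩ | rfl | ⟨i, hi, rfl⟩⟩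
  · exact i.2
  · rw [C.tk_X _ ha hb] at h1; simp [tokFlag] at h1
  · rw [tk_gateStart] at h1
    cases hk : C.kind g <;> simp [hk, Tok.gate, tokFlag] at h1
  · rw [tk_amp] at h1; simp [tokFlag] at h1
  · have hle : C.ptrWidth ≤ C.argEnd g k := by rw [argEnd_eq]; omega
    rw [spread_eq_true (C.ptrWidth - i) (by omega) (by omega)] at h2
    · simp at h2
    · rw [show C.argEnd g k - i - (C.ptrWidth - i) = C.argStart g k by rw [argEnd_eq]; omega, tk_amp]
      rfl
    · intro l hl
      rw [Nat.sub_sub, C.tk_argBit g k _ (by omega), (tokFlag_of_bit _).1]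
  · rw [tk_hash] at h1; simp [tokFlag] at h1
  · rw [spread_eq_true (C.ptrWidth - i) (by omega) (by omega)] at h2
    · simp at h2
    · rw [show C.argEnd g k + 1 + C.ptrWidth - i - (C.ptrWidth - i) = C.argEnd g k + 1 by omega,
        tk_hash]
      rfl
    · intro l hl
      rw [Nat.sub_sub, C.tk_gateBit g k _ (by omega), (tokFlag_of_bit _).1]

/-- The kind of a gate, read at the end of its first argument pointer. -/
theorem spread_kind {f : Fld} (hf₁ : ∀ b, tokFlag f (some (Tok.bit b)) = false)
    (hf₂ : tokFlag f (some .amp) = false) (hf₃ : tokFlag f (some .hash) = false)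
    (hn : 2 * C.ptrWidth + 1 ≤ n') :
    spread (tk (C.instanceOf w) f) (tk (C.instanceOf w) .ampBit) n' (C.argEnd g k) =
      (decide ((k : ℕ) = 0) && tokFlag f (some (Tok.gate (C.kind g)))) := by
  have hW := C.one_le_ptrWidth
  have hle : C.argEnd g k = C.argStart g k + C.ptrWidth := rfl
  have hbits : ∀ l ≤ C.ptrWidth, tk (C.instanceOf w) f (C.argEnd g k - l) = false ∧
      tk (C.instanceOf w) .ampBit (C.argEnd g k - l) = true := by
    intro l hl
    by_cases h : l < C.ptrWidth
    · rw [C.tk_argBit g k _ h, C.tk_argBit g k _ h, hf₁]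
      exact ⟨rfl, (tokFlag_of_bit _).2.2.2.2.2.2.2⟩
    · rw [show C.argEnd g k - l = C.argStart g k by omega, tk_amp, tk_amp, hf₂]
      exact ⟨rfl, rfl⟩
  by_cases hk : (k : ℕ) = 0
  · have hs : C.argEnd g k - (C.ptrWidth + 1) = C.gateStart g := by
      rw [hle, argStart, hk]; omega
    have hs' : C.ptrWidth + 1 ≤ C.argEnd g k := by rw [hle, argStart]; omega
    rw [decide_eq_true hk, Bool.true_and]
    rcases hv : tokFlag f (some (Tok.gate (C.kind g))) with _ | _
    · refine spread_eq_false (C.ptrWidth + 1) (fun _ => ?_) fun l hl _ => ?_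
      · rw [hs, tk_gateStart]
        cases C.kind g <;> rfl
      · by_cases h : l ≤ C.ptrWidth
        · exact (hbits l h).1
        · rw [show l = C.ptrWidth + 1 by omega, hs, tk_gateStart, hv]
    · refine spread_eq_true (C.ptrWidth + 1) (by omega) hs' ?_ fun l hl => (hbits l (by omega)).2
      rw [hs, tk_gateStart, hv]
  · rw [decide_eq_false hk, Bool.false_and]
    obtain ⟨j, hj⟩ : ∃ j, (k : ℕ) = j + 1 := ⟨k - 1, by omega⟩
    have hlt : j < (C.args g).length := by have := k.2; omega
    have hs : C.argEnd g k = C.argEnd g j + 2 * C.ptrWidth + 2 := by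
      have := C.argStart_succ g ⟨j, hlt⟩; dsimp only at this; rw [hle, hj, this]; ring
    refine spread_eq_false (2 * C.ptrWidth + 1) (fun _ => ?_) fun l hl _ => ?_
    -- The `#` of the preceding argument lies at this distance and does not pass the flag on.
    · rw [hs, show C.argEnd g j + 2 * C.ptrWidth + 2 - (2 * C.ptrWidth + 1) = C.argEnd g j + 1 by
        omega]
      rw [C.tk_hash g ⟨j, hlt⟩]; rfl
    · by_cases h : l ≤ C.ptrWidth
      · exact (hbits l h).1
      · rw [hs]
        by_cases h' : l = 2 * C.ptrWidth + 1
        · rw [show C.argEnd g j + 2 * C.ptrWidth + 2 - l = C.argEnd g j + 1 by omega,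
            C.tk_hash g ⟨j, hlt⟩, hf₃]
        · rw [show C.argEnd g j + 2 * C.ptrWidth + 2 - l =
            C.argEnd g j + 1 + C.ptrWidth - (l - C.ptrWidth - 1) by omega,
            C.tk_gateBit g ⟨j, hlt⟩ _ (by omega), hf₁]

end Circuit

/-! ### Correctness of the evaluation. -/

namespace Circuit

variable {n : ℕ} (C : Circuit n)

/-- The node that position `p` represents in the evaluation. -/
def IsNodeAt (p : ℕ) : Fin n ⊕ Fin C.size → Prop
  | .inl i => p = i
  | .inr g => ∃ k : Fin (C.args g).length, p = C.argEnd g k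

/-- The positions carry the values `v` of the nodes. -/
structure Carries (V : ℕ → Bool) (v : Fin n ⊕ Fin C.size → Bool) : Prop where
  exists_node : ∀ p, V p = true → ∃ a, C.IsNodeAt p a
  eq : ∀ p a, C.IsNodeAt p a → V p = v a

/-- Simultaneous evaluation of all gates. -/
def update (w : Fin n → Bool) (v : Fin n ⊕ Fin C.size → Bool) : Fin n ⊕ Fin C.size → Bool :=
  Sum.elim w fun g => (C.kind g).op ((C.args g).map v)

theorem nodeDepth_le_gateDepth {g : Fin C.size} {a : Fin n ⊕ Fin C.size} (ha : a ∈ C.args g) :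
    C.nodeDepth a + 1 ≤ C.gateDepth g := by
  have h : ∀ (l : List ℕ) (y : ℕ), y ∈ l → y ≤ l.foldr max 0 := by
    intro l
    induction l with
    | nil => simp
    | cons z l ih =>
      intro y hy
      rcases List.mem_cons.1 hy with rfl | hy
      · simp
      · simp [ih y hy]
  rw [gateDepth_eq]
  have := h _ _ (List.mem_map_of_mem (f := C.nodeDepth) ha)
  omega

theorem one_le_depth : 1 ≤ C.depth := by
  rw [depth, gateDepth_eq]; omega

/-- Induction on `t`: the arguments of a gate have smaller depth, so they are already correct one
step earlier. The initial values of the gates do not matter, and steps beyond the depth do no harm.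
-/
theorem update_iterate (w : Fin n → Bool) (v : Fin n ⊕ Fin C.size → Bool)
    (hv : ∀ i, v (.inl i) = w i) (t : ℕ) (a : Fin n ⊕ Fin C.size) (ha : C.nodeDepth a ≤ t) :
    (C.update w)^[t] v a = C.nodeVal w a := by
  induction t generalizing a with
  | zero =>
    rcases a with i | g
    · exact hv i
    · have : 1 ≤ C.gateDepth g := by rw [gateDepth_eq]; omega
      simp only [nodeDepth, Sum.elim_inr] at ha
      omega
  | succ t ih =>
    rw [Function.iterate_succ_apply']
    rcases a with i | g
    · rfl
    · change (C.kind g).op _ = C.gateVal w g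
      rw [gateVal_eq]
      congr 1
      refine List.map_congr_left fun a ha' => ih a ?_
      have := C.nodeDepth_le_gateDepth ha'
      simp only [nodeDepth, Sum.elim_inr] at ha
      simp only [nodeDepth] at this ⊢
      omega

variable (w : Fin n → Bool) {m n' : ℕ} (hn : 2 * C.ptrWidth + 1 ≤ n') (hm : C.ptrWidth ≤ m)

theorem index_eq_iff {a b : Fin n ⊕ Fin C.size} (hm : C.ptrWidth ≤ m) :
    (∀ i < m, (C.index a).testBit i = (C.index b).testBit i) ↔ a = b := by
  constructor
  · intro h
    have hp := Nat.pow_le_pow_right (n := 2) (by norm_num) hm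
    exact C.index_injective (eq_of_testBit_lt ((C.index_lt a).trans_le hp)
      ((C.index_lt b).trans_le hp) h)
  · rintro rfl _ _; rfl

include hn in
theorem isNodeAt_of_isInput {p : ℕ} (h : isInput (C.instanceOf w) n' p = true) :
    ∃ i : Fin n, p = i :=
  ⟨⟨p, (C.isInput_iff hn).1 h⟩, rfl⟩

variable (g : Fin C.size) (k : Fin (C.args g).length)

theorem argEnd_lt_length_succ : C.argEnd g k < (C.instanceOf w).length + 1 := by
  have := C.argEnd_lt w g k; omega

theorem not_lt_of_argEnd : ¬ C.argEnd g k < n := by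
  rw [argEnd_eq, argStart]
  have := C.gateStart_ge g
  omega

include hn in
theorem isInput_argEnd : isInput (C.instanceOf w) n' (C.argEnd g k) = false := by
  rw [← Bool.not_eq_true, C.isInput_iff hn]
  exact C.not_lt_of_argEnd g k

theorem isArgEnd_of_lt {p : ℕ} (hp : p < n) : isArgEnd (C.instanceOf w) p = false := by
  rw [← Bool.not_eq_true, isArgEnd_iff]
  rintro ⟨g, k, rfl⟩
  exact C.not_lt_of_argEnd g k hp

-- An input is numbered by its position, a gate by the pointer read at its argument ends; the two
-- cases exclude each other, so both kinds of nodes share one pair of key registers.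
include hn in
theorem nodeKey_eq {p : ℕ} {a : Fin n ⊕ Fin C.size} (h : C.IsNodeAt p a) (i : ℕ) :
    nodeKey (C.instanceOf w) n' p i = (C.index a).testBit i ∧
    nodeKeyNeg (C.instanceOf w) n' p i = !(C.index a).testBit i := by
  rcases a with j | g
  · cases h
    rw [nodeKey, nodeKeyNeg, C.isArgEnd_of_lt w j.2, (C.isInput_iff hn).2 j.2]
    simp [index]
  · obtain ⟨k, rfl⟩ := h
    rw [nodeKey, nodeKeyNeg, C.isInput_argEnd w hn, isArgEnd_argEnd, C.readGate_argEnd g k hn]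
    simp

include hn hm in
theorem someArg_argEnd (S : ℕ → Bool) : SomeArg (C.instanceOf w) m n' S (C.argEnd g k) ↔
    ∃ k' : Fin (C.args g).length, S (C.argEnd g k') = true := by
  constructor
  · rintro ⟨j, -, h1, h2, h3⟩
    obtain ⟨g', k', rfl⟩ := C.isArgEnd_iff.1 h1
    simp only [C.readGate_argEnd _ _ hn] at h3
    obtain rfl : g = g' := by
      have := (C.index_eq_iff hm).1 h3
      simpa using this
    exact ⟨k', h2⟩
  · rintro ⟨k', h⟩
    refine ⟨C.argEnd g k', C.argEnd_lt_length_succ w g k', C.isArgEnd_argEnd g k', h, fun i _ => ?_⟩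
    rw [C.readGate_argEnd _ _ hn, C.readGate_argEnd _ _ hn]

theorem args_length_pos : 0 < (C.args g).length := List.length_pos_of_ne_nil (C.args_ne_nil g)

open Classical in
include hn hm in
theorem negatesIn_argEnd : negatesIn (C.instanceOf w) m n' (C.argEnd g k) =
    tokFlag .isAnd (some (Tok.gate (C.kind g))) := by
  have h := fun k => C.spread_kind (w := w) g k (f := .isAnd)
    (fun b => (tokFlag_of_bit b).2.2.2.2.2.1) rfl rfl hn
  rw [negatesIn, isArgEnd_argEnd, Bool.true_and, Bool.eq_iff_iff, decide_eq_true_eq,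
    C.someArg_argEnd w hn hm]
  simp only [h, Bool.and_eq_true, decide_eq_true_eq]
  -- The type is visible only at argument `0`, which exists because every gate has arguments.
  exact ⟨fun ⟨_, _, h⟩ => h, fun h => ⟨⟨0, C.args_length_pos g⟩, rfl, h⟩⟩

open Classical in
include hn hm in
theorem negatesOut_argEnd : negatesOut (C.instanceOf w) m n' (C.argEnd g k) =
    tokFlag .isNeg (some (Tok.gate (C.kind g))) := by
  have h := fun k => C.spread_kind (w := w) g k (f := .isNeg)
    (fun b => (tokFlag_of_bit b).2.2.2.2.2.2.1) rfl rfl hn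
  rw [negatesOut, isArgEnd_argEnd, Bool.true_and, Bool.eq_iff_iff, decide_eq_true_eq,
    C.someArg_argEnd w hn hm]
  simp only [h, Bool.and_eq_true, decide_eq_true_eq]
  exact ⟨fun ⟨_, _, h⟩ => h, fun h => ⟨⟨0, C.args_length_pos g⟩, rfl, h⟩⟩

-- A node that is not excluded has the number of the pointer and hence is the argument. Positions
-- without a node match too, but `Carries.exists_node` rules out that they hold the value one.
include hn hm in
theorem argTrue_argEnd {V : ℕ → Bool} {v : Fin n ⊕ Fin C.size → Bool} (hV : C.Carries V v) :
    ArgTrue (C.instanceOf w) m n' V (C.argEnd g k) ↔ v ((C.args g).get k) = true := by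
  have key : ∀ j b, C.IsNodeAt j b → ((∀ i < m,
      ¬(readBits (C.instanceOf w) n' (C.argEnd g k) i = true ∧
        nodeKeyNeg (C.instanceOf w) n' j i = true) ∧
      ¬(readBits (C.instanceOf w) n' (C.argEnd g k) i = false ∧
        nodeKey (C.instanceOf w) n' j i = true)) ↔ (C.args g).get k = b) := by
    intro j b hb
    rw [← C.index_eq_iff hm]
    refine forall_congr' fun i => imp_congr_right fun _ => ?_
    rw [(C.nodeKey_eq w hn hb i).1, (C.nodeKey_eq w hn hb i).2, C.readBits_argEnd g k hn]
    cases (C.index ((C.args g).get k)).testBit i <;> cases (C.index b).testBit i <;> simp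
  constructor
  · rintro ⟨j, _, h1, h2⟩
    obtain ⟨b, hb⟩ := hV.exists_node j h2
    rw [(key j b hb).1 h1, ← hV.eq j b hb, h2]
  · intro h
    obtain ⟨j, hj, hjb⟩ : ∃ j < (C.instanceOf w).length + 1,
        C.IsNodeAt j ((C.args g).get k) := by
      rcases (C.args g).get k with i | g'
      · have := C.size_le_length w
        exact ⟨i, by omega, rfl⟩
      · exact ⟨C.argEnd g' 0, C.argEnd_lt_length_succ w g' ⟨0, C.args_length_pos g'⟩,
          ⟨0, C.args_length_pos g'⟩, rfl⟩
    exact ⟨j, hj, (key j _ hjb).2 rfl, by rw [hV.eq j _ hjb, h]⟩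

-- De Morgan: AND is the negated disjunction of the negated arguments, NOT the negated disjunction
-- of its arguments, OR the plain one.
include hn hm in
theorem stepVal_argEnd {V : ℕ → Bool} {v : Fin n ⊕ Fin C.size → Bool} (hV : C.Carries V v) :
    stepVal (C.instanceOf w) m n' V (C.argEnd g k) = C.update w v (.inr g) := by
  have hlit : ∀ k' : Fin (C.args g).length, literal (C.instanceOf w) m n' V (C.argEnd g k') =
      (v ((C.args g).get k') ^^ tokFlag .isAnd (some (Tok.gate (C.kind g)))) := by
    intro k'
    rw [literal, isArgEnd_argEnd, C.negatesIn_argEnd w hn hm]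
    simp only [C.argTrue_argEnd w hn hm g k' hV, Bool.true_and, Bool.decide_eq_true]
  rw [stepVal, isArgEnd_argEnd, C.isInput_argEnd w hn, C.negatesOut_argEnd w hn hm]
  simp only [C.someArg_argEnd w hn hm, hlit, Bool.true_and, Bool.false_and, Bool.or_false, update,
    Sum.elim_inr]
  cases C.kind g
  · simp only [Tok.gate, tokFlag, GateKind.op, Bool.xor_true, Bool.not_eq_true']
    rw [Bool.eq_iff_iff]
    simp [List.forall_mem_iff_get]
  · simp only [Tok.gate, tokFlag, GateKind.op, Bool.xor_false]
    rw [Bool.eq_iff_iff]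
    simp [List.exists_mem_iff_get]
  · simp only [Tok.gate, tokFlag, GateKind.op, Bool.xor_false]
    rw [Bool.eq_iff_iff]
    simp [List.forall_mem_iff_get]

include hn hm in
theorem carries_step {V : ℕ → Bool} {v : Fin n ⊕ Fin C.size → Bool} (hV : C.Carries V v) :
    C.Carries (stepVal (C.instanceOf w) m n' V) (C.update w v) := by
  refine ⟨fun p hp => ?_, ?_⟩
  · rw [stepVal, Bool.or_eq_true, Bool.and_eq_true, Bool.and_eq_true] at hp
    rcases hp with ⟨h, -⟩ | ⟨h, -⟩
    · obtain ⟨g, k, rfl⟩ := C.isArgEnd_iff.1 h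
      exact ⟨.inr g, k, rfl⟩
    · obtain ⟨i, rfl⟩ := C.isNodeAt_of_isInput w hn h
      exact ⟨.inl i, rfl⟩
  · rintro p (i | g) h
    · cases h
      rw [stepVal, C.isArgEnd_of_lt w i.2, (C.isInput_iff hn).2 i.2, tk_input,
        (tokFlag_of_bit _).2.1]
      simp [update]
    · obtain ⟨k, rfl⟩ := h
      exact C.stepVal_argEnd w hn hm g k hV

include hn in
theorem carries_inputs : C.Carries
    (fun p => isInput (C.instanceOf w) n' p && tk (C.instanceOf w) .one p)
    (Sum.elim w fun _ => false) := by
  refine ⟨fun p hp => ?_, ?_⟩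
  · rw [Bool.and_eq_true] at hp
    obtain ⟨i, rfl⟩ := C.isNodeAt_of_isInput w hn hp.1
    exact ⟨.inl i, rfl⟩
  · rintro p (i | g) h
    · cases h
      rw [(C.isInput_iff hn).2 i.2, tk_input, (tokFlag_of_bit _).2.1]
      simp
    · obtain ⟨k, rfl⟩ := h
      rw [C.isInput_argEnd w hn]
      simp

-- A pointer with the number of a gate makes this gate an argument of another one, and by `out_sink`
-- only the output is an argument of none.
include hn hm in
theorem isSink_iff {p : ℕ} : isSink (C.instanceOf w) m n' p = true ↔
    ∃ k : Fin (C.args C.out).length, p = C.argEnd C.out k := by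
  have key : ∀ (g : Fin C.size) (k : Fin (C.args g).length),
      IsUsed (C.instanceOf w) m n' (C.argEnd g k) ↔ ¬ g = C.out := by
    intro g k
    rw [← C.out_sink, IsUsed]
    push Not
    constructor
    · rintro ⟨j, -, h1, h2⟩
      obtain ⟨h, k', rfl⟩ := C.isArgEnd_iff.1 h1
      simp only [C.readBits_argEnd _ _ hn, C.readGate_argEnd _ _ hn] at h2
      rw [C.index_eq_iff hm] at h2
      exact ⟨h, h2 ▸ List.get_mem _ _⟩
    · rintro ⟨h, hg⟩
      obtain ⟨k', hk'⟩ := List.get_of_mem hg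
      refine ⟨C.argEnd h k', C.argEnd_lt_length_succ w h k', C.isArgEnd_argEnd h k', fun i _ => ?_⟩
      rw [C.readBits_argEnd _ _ hn, C.readGate_argEnd _ _ hn, hk']
  rw [isSink, Bool.and_eq_true, Bool.not_eq_true', decide_eq_false_iff_not]
  constructor
  · rintro ⟨h1, h2⟩
    obtain ⟨g, k, rfl⟩ := C.isArgEnd_iff.1 h1
    rw [key, not_not] at h2
    subst h2
    exact ⟨k, rfl⟩
  · rintro ⟨k, rfl⟩
    exact ⟨C.isArgEnd_argEnd _ _, by rw [key]; simp⟩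

include hn hm in
theorem carries_iterate (t : ℕ) : C.Carries
    ((stepVal (C.instanceOf w) m n')^[t]
      fun p => isInput (C.instanceOf w) n' p && tk (C.instanceOf w) .one p)
    ((C.update w)^[t] (Sum.elim w fun _ => false)) := by
  induction t with
  | zero => exact C.carries_inputs w hn
  | succ t ih =>
    rw [Function.iterate_succ_apply', Function.iterate_succ_apply']
    exact C.carries_step w hn hm ih

open Classical in
include hn hm in
theorem exists_sink_iff {t : ℕ} (ht : C.depth ≤ t) :
    (∃ j < (C.instanceOf w).length + 1, isSink (C.instanceOf w) m n' j = true ∧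
      (stepVal (C.instanceOf w) m n')^[t]
        (fun p => isInput (C.instanceOf w) n' p && tk (C.instanceOf w) .one p) j = true) ↔
    C.eval w = true := by
  have h1 : ∀ k : Fin (C.args C.out).length, (stepVal (C.instanceOf w) m n')^[t]
        (fun p => isInput (C.instanceOf w) n' p && tk (C.instanceOf w) .one p)
        (C.argEnd C.out k) = C.eval w := by
    intro k
    rw [(C.carries_iterate w hn hm t).eq _ (.inr C.out) ⟨k, rfl⟩,
      C.update_iterate w _ (fun _ => rfl) t (.inr C.out) ht]
    rfl
  constructor
  · rintro ⟨j, -, h2, h3⟩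
    obtain ⟨k, rfl⟩ := (C.isSink_iff w hn hm).1 h2
    rw [← h1 k, h3]
  · intro h
    have hk := C.args_length_pos C.out
    exact ⟨_, C.argEnd_lt_length_succ w C.out ⟨0, hk⟩, (C.isSink_iff w hn hm).2 ⟨⟨0, hk⟩, rfl⟩,
      by rw [h1, h]⟩

end Circuit

/-! ### The transformers -/

/-- The mantissas of the positional encoding in one block, given the bits of the position and of its
successor, and whether the block is the first one. -/
def posTable (b b' first : Bool) : Slot → ℤ
  | (some .pos, s) => if b then 4 * litSign s else 0
  | (some .nxt, s) => if b' then 4 * litSign s else 0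
  | (some .first, s) => if first then 4 * litSign s else 0
  | _ => 0

theorem abs_posTable_le (b b' first : Bool) (s : Slot) : |posTable b b' first s| ≤ 15 := by
  obtain ⟨_ | f, s⟩ := s
  · simp [posTable]
  · cases f <;> cases s <;> cases b <;> cases b' <;> cases first <;> simp [posTable, litSign]

/-- The transformer that runs programs, each of them in a loop. -/
noncomputable def ofPrograms (m : ℕ) (blocks : List (ℕ × List Instr)) : Transformer 2 (m * slots) where
  embed := fun o => blockVec m (slotVal fun f => tokFlag f o)
  pos := fun p x => Fixed.ofMant (posTable (p.testBit ((coord m).symm x).1)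
    ((p + 1).testBit ((coord m).symm x).1) (decide ((((coord m).symm x).1 : ℕ) = 0))
    ((coord m).symm x).2)
  blocks := blocks.map fun B => (B.1, layersOf m B.2)
  outWeight := blockVec m fun s => if s = (some .t, true) then 4 else 0
  outBias := Fixed.ofMant 0
  τ := Fixed.ofMant 1
  τ_pos := by rw [Fixed.val_eq, Fixed.mant_ofMant (by simp)]; norm_num
  ε := Fixed.ofMant 1
  ε_pos := by rw [Fixed.val_eq, Fixed.mant_ofMant (by simp)]; norm_num
  pad := 1

theorem comp_ofPrograms (m : ℕ) (blocks : List (ℕ × List Instr)) (is : List Instr) (t : ℕ) :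
    (ofPrograms m blocks).comp (ofPrograms m [(1, is)]) t = ofPrograms m (blocks ++ [(t, is)]) := by
  simp [Transformer.comp, ofPrograms, Transformer.layerSeq]

/-- Symbol and position fill different registers, so the rounded sum of the two encodings is exact.
The resting value of the accumulator comes from the symbol embedding. -/
theorem encodes_init (m : ℕ) (blocks : List (ℕ × List Instr)) (x : List Tok) :
    Encodes (initState x) ((ofPrograms m blocks).init x) := by
  rintro p i ⟨f, s⟩
  rw [Transformer.init, Fixed.mant_add]
  simp only [ofPrograms]
  rw [blockVec_coord _ _ (abs_slotVal_le _ _), Equiv.symm_apply_apply, Fixed.mant_ofMant (abs_posTable_le _ _ _ _)]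
  have key : slotVal (fun f => tokFlag f x[(p : ℕ)]?) (f, s) + posTable ((p : ℕ).testBit i)
      (((p : ℕ) + 1).testBit i) (decide ((i : ℕ) = 0)) (f, s) = slotVal (initState x p i) (f, s) := by
    rcases f with _ | f
    · simp [posTable, slotVal]
    · have h : tokFlag .pos x[(p : ℕ)]? = false ∧ tokFlag .nxt x[(p : ℕ)]? = false ∧
          tokFlag .first x[(p : ℕ)]? = false := by
        rcases x[(p : ℕ)]? with _ | _ <;> simp [tokFlag]
      cases f <;> simp [posTable, slotVal, initState, posFlag, tk, h]
  rw [key, Fixed.clamp_of_abs_le (abs_slotVal_le _ _)]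

/-- The classifier adds `t` over all blocks. The terms are nonnegative, so the sum saturates but is
positive iff `t` holds, provided that there is a block. -/
theorem classify_ofPrograms {m : ℕ} (hm : 0 < m) (blocks : List (ℕ × List Instr)) {P : ℕ}
    {β : State} {H : Hidden 2 (m * slots) P} (hH : Encodes β H) (p : Fin P) (v : Bool)
    (ht : ∀ i, β p i .t = v) : (ofPrograms m blocks).classify (H p) = v := by
  have hw : ∀ c, ∃ z : ℤ, (Fixed.mul (H p c) ((ofPrograms m blocks).outWeight c)).mant = z ∧
      z = if ((coord m).symm c).2 = (some .t, true) then (if v then 4 else 0) else 0 := by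
    intro c
    obtain ⟨⟨i, s⟩, rfl⟩ := (coord m).surjective c
    refine ⟨_, rfl, ?_⟩
    rw [Equiv.symm_apply_apply]
    simp only [ofPrograms]
    by_cases hs : s = (some .t, true)
    · have h1 := hH p i s
      subst hs
      rw [Fixed.mant_mul_int (c := 1), if_pos rfl, mul_one,
        Fixed.clamp_of_abs_le (Fixed.mant_abs_le _), h1]
      · simp [slotVal, ht, litSign]
      · rw [blockVec_coord _ _ (by simp)]; simp
    · rw [if_neg hs, Fixed.mant_mul_comm, Fixed.mul_zero_left]
      rw [blockVec_coord _ _ (by simp [hs])]; simp [hs]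
  have hsum : (Fixed.dot (H p) (ofPrograms m blocks).outWeight).mant =
      min 15 (∑ c, (Fixed.mul (H p c) ((ofPrograms m blocks).outWeight c)).mant) := by
    apply Fixed.mant_sum_nonneg
    intro c
    obtain ⟨z, h1, h2⟩ := hw c
    rw [h1, h2]; split_ifs <;> simp
  have hb := Fixed.mant_abs_le (Fixed.dot (H p) (ofPrograms m blocks).outWeight)
  have hout : (Fixed.add (Fixed.dot (H p) (ofPrograms m blocks).outWeight)
      (ofPrograms m blocks).outBias).mant =
      (Fixed.dot (H p) (ofPrograms m blocks).outWeight).mant := by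
    rw [Fixed.mant_add, show (ofPrograms m blocks).outBias.mant = 0 from
      Fixed.mant_ofMant (by simp), add_zero, Fixed.clamp_of_abs_le hb]
  rw [Transformer.classify, Bool.eq_iff_iff, decide_eq_true_eq, Fixed.val_eq, hout, hsum]
  have hsum' : ∑ c, (Fixed.mul (H p c) ((ofPrograms m blocks).outWeight c)).mant =
      ∑ c, if ((coord m).symm c).2 = (some .t, true) then (if v then (4 : ℤ) else 0) else 0 := by
    refine Finset.sum_congr rfl fun c _ => ?_
    obtain ⟨z, h1, h2⟩ := hw c
    rw [h1, h2]
  rw [hsum']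
  cases v
  · simp
  · have : (4 : ℤ) ≤ ∑ c, if ((coord m).symm c).2 = (some .t, true) then (if true then (4 : ℤ) else 0) else 0 := by
      refine le_trans (by simp) (Finset.single_le_sum (f := fun c =>
        if ((coord m).symm c).2 = (some .t, true) then (if true then (4 : ℤ) else 0) else 0)
        (fun c _ => by split_ifs <;> simp)
        (Finset.mem_univ (coord m (⟨0, hm⟩, some .t, true))))
    simp only [iff_true]
    have h4 : (0 : ℤ) < min 15 (∑ c, if ((coord m).symm c).2 = (some .t, true) then
      (if true then (4 : ℤ) else 0) else 0) := by omega
    have : (0 : ℝ) < ((min 15 (∑ c, if ((coord m).symm c).2 = (some .t, true) then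
      (if true then (4 : ℤ) else 0) else 0) : ℤ) : ℝ) := by exact_mod_cast h4
    positivity

/-- The blocks that read the pointers. -/
def readBlocks (m : ℕ) : List (ℕ × List Instr) := [(1, initProg), (3 * m, loopProg), (1, finProg)]

theorem Transformer.run_cons {b D : ℕ} (T : Transformer b D) (κ : AttnKind) {m : ℕ}
    (B : ℕ × List (Layer b D)) (Bs : List (ℕ × List (Layer b D))) (H : Hidden b D m) :
    (B :: Bs).foldlM (fun H B => T.runLoop κ B.2 B.1 H) H =
      (T.runLoop κ B.2 B.1 H).bind fun H => Bs.foldlM (fun H B => T.runLoop κ B.2 B.1 H) H := rfl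

theorem Transformer.runLoop_one {b D : ℕ} (T : Transformer b D) (κ : AttnKind) {m : ℕ}
    (ls : List (Layer b D)) (H : Hidden b D m) : T.runLoop κ ls 1 H = T.runLayers κ ls H := by
  simp [Transformer.runLoop]

section Hidden

variable (κ : AttnKind) {x : List Tok} {m : ℕ} (hm : x.length < 2 ^ m)
include hm

theorem exists_run_read (T : Transformer 2 (m * slots)) (hτ : T.τ.mant = 1) (hε : T.ε.mant = 1)
    {H : Hidden 2 (m * slots) (x.length + 1)} (hH : Encodes (initState x) H) :
    ∃ H' β, ((readBlocks m).map fun B => (B.1, layersOf m B.2)).foldlM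
      (fun H B => T.runLoop κ B.2 B.1 H) H = some H' ∧ Encodes β H' ∧
      Ready x m (3 * m) (fun p => isInput x (3 * m) p && tk x .one p) β := by
  obtain ⟨H₁, β₁, h1, h2, h3⟩ := exists_runLayers T κ hτ hε (triple_init hm) rfl hH
  have h3' : Reading x 0 β₁ := by
    obtain ⟨hs, h⟩ := h3
    exact ⟨hs, fun p i => h _ (by simp) p i, fun p i => h _ (by simp) p i,
      fun p i => h _ (by simp) p i, fun p i => h _ (by simp) p i, fun p i => h _ (by simp) p i⟩
  obtain ⟨H₂, β₂, h4, h5, h6⟩ := exists_runLoop T κ hτ hε (triple_loop hm) (3 * m) h3' h2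
  rw [Nat.zero_add] at h6
  obtain ⟨H₃, β₃, h7, h8, h9⟩ := exists_runLayers T κ hτ hε (triple_fin x m (3 * m)) h6 h5
  refine ⟨H₃, β₃, ?_, h8, h9⟩
  simp only [readBlocks, List.map_cons, List.map_nil, Transformer.run_cons,
    Transformer.runLoop_one, h1, h4, h7, Option.bind_some, List.foldlM_nil]
  rfl

theorem exists_hidden_read : ∃ H β, (ofPrograms m (readBlocks m)).hidden κ x = some H ∧
    Encodes β H ∧ Ready x m (3 * m) (fun p => isInput x (3 * m) p && tk x .one p) β :=
  exists_run_read κ hm (ofPrograms m (readBlocks m)) (Fixed.mant_ofMant (by simp))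
    (Fixed.mant_ofMant (by simp)) (encodes_init m (readBlocks m) x)

open Classical in
theorem exists_hidden_comp (t : ℕ) : ∃ H β,
    (ofPrograms m (readBlocks m ++ [(t, stepProg)])).hidden κ x = some H ∧ Encodes β H ∧
    (1 ≤ t → ∀ p i, β p i .t = decide (∃ j < x.length + 1, isSink x m (3 * m) j = true ∧
      (stepVal x m (3 * m))^[t] (fun p => isInput x (3 * m) p && tk x .one p) j = true)) := by
  set T := ofPrograms m (readBlocks m ++ [(t, stepProg)]) with hT
  have hτ : T.τ.mant = 1 := Fixed.mant_ofMant (by simp)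
  have hε : T.ε.mant = 1 := Fixed.mant_ofMant (by simp)
  obtain ⟨H₁, β₁, h1, h2, h3⟩ := exists_run_read κ hm T hτ hε (encodes_init m _ x)
  set V₀ : ℕ → Bool := fun p => isInput x (3 * m) p && tk x .one p with hV₀
  obtain ⟨H₂, β₂, h4, h5, h6⟩ := exists_runLoop T κ hτ hε (is := stepProg)
    -- The register `t` holds the output only after a step, hence the clause `1 ≤ s`.
    (Φ := fun s β => Ready x m (3 * m) ((stepVal x m (3 * m))^[s] V₀) β ∧
      (1 ≤ s → ∀ p i, β p i .t = decide (∃ j < x.length + 1, isSink x m (3 * m) j = true ∧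
        (stepVal x m (3 * m))^[s] V₀ j = true)))
    (fun s β hβ => by
      have := triple_step x m (3 * m) ((stepVal x m (3 * m))^[s] V₀) β hβ.1
      rw [Function.iterate_succ_apply']
      exact ⟨this.1, this.2.1, fun _ => this.2.2⟩) t (t := 0) ⟨h3, by simp⟩ h2
  refine ⟨H₂, β₂, ?_, h5, by rw [Nat.zero_add] at h6; exact h6.2⟩
  unfold Transformer.hidden Transformer.run
  rw [show T.blocks = ((readBlocks m).map fun B => (B.1, layersOf m B.2)) ++
    [(t, layersOf m stepProg)] by simp [hT, ofPrograms], List.foldlM_append]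
  erw [h1]
  simp only [Option.bind_eq_bind, Transformer.run_cons, List.foldlM_nil]
  change (T.runLoop κ (layersOf m stepProg) t H₁).bind (fun H => pure H) = some H₂
  rw [h4]
  rfl

end Hidden

theorem output_comp (κ : AttnKind) {n : ℕ} (C : Circuit n) (w : Fin n → Bool) {m t : ℕ}
    (hm : (C.instanceOf w).length < 2 ^ m) (ht : C.depth ≤ t) :
    (ofPrograms m (readBlocks m ++ [(t, stepProg)])).output κ (C.instanceOf w) =
      some (C.eval w) := by
  classical
  have h1 := C.size_le_length w
  have hW : C.ptrWidth ≤ m := Nat.clog_le_of_le_pow (by omega)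
  have hW1 := C.one_le_ptrWidth
  obtain ⟨H, β, hH, hE, hβ⟩ := exists_hidden_comp κ hm t
  have hpos : 0 < (ofPrograms m (readBlocks m ++ [(t, stepProg)])).paddedLength
    (C.instanceOf w) := Nat.succ_pos _
  rw [Transformer.output, dif_pos hpos, hH, Option.map_some]
  congr 1
  refine classify_ofPrograms (by omega) _ hE _ _ fun i => ?_
  rw [hβ (C.one_le_depth.trans ht)]
  -- `3 * m` rounds of reading are enough because `1 ≤ C.ptrWidth ≤ m`.
  simp only [C.exists_sink_iff w (n' := 3 * m) (by omega) hW ht, Bool.decide_eq_true]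

theorem readsPointers_read (κ : AttnKind) (m : ℕ → ℕ) (hm : ∀ N, N < 2 ^ m N) :
    Family.ReadsPointers (D := fun N => m N * slots) (b := fun _ => 2)
      (fun N => ofPrograms (m N) (readBlocks (m N))) κ := by
  have hle : ∀ N, Nat.clog 2 N ≤ m N := fun N => Nat.clog_le_of_le_pow (hm N).le
  refine ⟨fun N => Sum.elim (fun i => coord (m N) (⟨i, i.2.trans_le (hle N)⟩, some .argR, true))
    (fun i => coord (m N) (⟨i, i.2.trans_le (hle N)⟩, some .gateR, true)), ?_, ?_⟩
  · rintro N (i | i) (j | j) h <;> simp [Fin.ext_iff] at h ⊢ <;> exact h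
  · intro n C w x
    have h1 := C.size_le_length w
    have hW : C.ptrWidth ≤ m x.length :=
      Nat.clog_le_of_le_pow (h1.trans (hm x.length).le)
    have hW1 := C.one_le_ptrWidth
    obtain ⟨H, β, hH, hE, hβ⟩ := exists_hidden_read κ (hm x.length)
    refine ⟨H, hH, fun g k => ⟨⟨C.argEnd g k, C.argEnd_lt_length_succ w g k⟩, rfl, fun i => ?_⟩⟩
    have hone : (1 : Fixed 2).mant = 4 := Fixed.mant_one
    have hzero : (0 : Fixed 2).mant = 0 := Fixed.mant_zero
    constructor
    · ext
      simp only [Sum.elim_inl]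
      rw [hE]
      simp only [slotVal, hβ.argR, litSign]
      rw [C.readBits_argEnd g k (by omega)]
      split_ifs <;> simp_all
    · ext
      simp only [Sum.elim_inr]
      rw [hE]
      simp only [slotVal, hβ.gateR, litSign]
      rw [C.readGate_argEnd g k (by omega)]
      split_ifs <;> simp_all

/-! ### Structured programs for Turing machines -/

/-- What a machine with `k` work tapes over the alphabet `W` sees. -/
structure Obs (k : ℕ) (W : Type) where
  input : Option TapeSym
  work : Fin k → W

/-- What a machine does in one step. -/
structure Act (k : ℕ) (W : Type) where
  move : Move
  work : Fin k → W × Move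
  out : Option TapeSym

/-- A configuration without the state. -/
@[ext]
structure Store (k : ℕ) (W : Type) where
  inputHead : ℕ
  heads : Fin k → ℕ
  tapes : Fin k → ℕ → W
  out : List TapeSym

namespace Store

variable {k : ℕ} {W : Type} (x : List TapeSym) (c : Store k W)

/-- What is seen in a configuration. -/
def obs : Obs k W := ⟨Machine.inputAt x c.inputHead, fun i => c.tapes i (c.heads i)⟩

/-- The effect of one step. -/
def apply (a : Act k W) : Store k W where
  inputHead := min (a.move.apply c.inputHead) (x.length + 1)
  heads := fun i => (a.work i).2.apply (c.heads i)
  tapes := fun i => Function.update (c.tapes i) (c.heads i) (a.work i).1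
  out := c.out ++ a.out.toList

/-- All heads are in the allowed ranges. -/
def Bounded (s : ℕ) : Prop := c.inputHead ≤ x.length + 1 ∧ ∀ i, c.heads i < s

end Store

/-- A program fragment: a machine that is left when `δ` gives no new state. -/
structure Frag (k : ℕ) (W : Type) where
  State : Type
  [finite : Finite State]
  start : State
  δ : State → Obs k W → Option State × Act k W

attribute [instance] Frag.finite

/-- From state `p` and configuration `c`, the fragment is left in configuration `d`, with all heads in
the allowed ranges. -/
inductive Frag.Exec {k : ℕ} {W : Type} (F : Frag k W) (x : List TapeSym) (s : ℕ) :
    F.State → Store k W → Store k W → Prop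
  | exit {p : F.State} {c : Store k W} {a : Act k W} (h : F.δ p (c.obs x) = (none, a))
      (hc : c.Bounded x s) : Exec F x s p c (c.apply x a)
  | step {p p' : F.State} {c d : Store k W} {a : Act k W} (h : F.δ p (c.obs x) = (some p', a))
      (hc : c.Bounded x s) (hd : Exec F x s p' (c.apply x a) d) : Exec F x s p c d

namespace Frag

variable {k : ℕ} {W : Type} {x : List TapeSym} {s : ℕ}

/-- The fragment leads from `c` to `d`. -/
def Runs (F : Frag k W) (x : List TapeSym) (s : ℕ) (c d : Store k W) : Prop :=
  F.Exec x s F.start c d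

/-- The machine that runs a fragment. -/
def toMachine [Finite W] (F : Frag k W) (blank : W) : Machine where
  State := Option F.State
  Work := W
  k := k
  start := some F.start
  blank := blank
  δ := fun p i w => p.map fun p => ((F.δ p ⟨i, w⟩).1, (F.δ p ⟨i, w⟩).2.move,
    (F.δ p ⟨i, w⟩).2.work, (F.δ p ⟨i, w⟩).2.out)

section ToMachine

variable [Finite W] (F : Frag k W) (blank : W)

/-- Configurations of the machine of a fragment. -/
def cfg (p : Option F.State) (c : Store k W) : (F.toMachine blank).Cfg :=
  ⟨p, c.inputHead, c.heads, c.tapes, c.out⟩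

theorem step_cfg (p : F.State) (c : Store k W) : (F.toMachine blank).step x (F.cfg blank (some p) c) =
    some (F.cfg blank (F.δ p (c.obs x)).1 (c.apply x (F.δ p (c.obs x)).2)) := rfl

theorem step_cfg_none (c : Store k W) : (F.toMachine blank).step x (F.cfg blank none c) = none := rfl

theorem Exec.reaches {F : Frag k W} {p : F.State} {c d : Store k W} (h : F.Exec x s p c d) :
    Relation.ReflTransGen (fun c₁ c₂ => (F.toMachine blank).step x c₁ = some c₂)
      (F.cfg blank (some p) c) (F.cfg blank none d) := by
  induction h with
  | exit h _ => exact Relation.ReflTransGen.single (by rw [step_cfg, h])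
  | step h _ _ ih => exact Relation.ReflTransGen.head (by rw [step_cfg, h]) ih

/-- The machine is deterministic, so every reachable configuration lies on the run that `Exec`
records, and `Exec` demands the bound at each step. -/
theorem Exec.heads_lt {F : Frag k W} {p : F.State} {c d : Store k W} (h : F.Exec x s p c d)
    (hd : d.Bounded x s) (e : (F.toMachine blank).Cfg)
    (he : Relation.ReflTransGen (fun c₁ c₂ => (F.toMachine blank).step x c₁ = some c₂)
      (F.cfg blank (some p) c) e) (i : Fin k) : e.heads i < s := by
  induction h with
  | exit h hc =>
    rcases he.cases_head with rfl | ⟨e', h1, h2⟩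
    · exact hc.2 i
    rw [step_cfg, h] at h1
    obtain rfl := Option.some.inj h1
    rcases h2.cases_head with rfl | ⟨e', h1, h2⟩
    · exact hd.2 i
    · rw [step_cfg_none] at h1; cases h1
  | step h hc _ ih =>
    rcases he.cases_head with rfl | ⟨e', h1, h2⟩
    · exact hc.2 i
    rw [step_cfg, h] at h1
    obtain rfl := Option.some.inj h1
    exact ih hd h2

theorem Runs.outputsInSpace {F : Frag k W} {d : Store k W} {y : List TapeSym}
    (h : F.Runs x s ⟨1, fun _ => 0, fun _ _ => blank, []⟩ d) (hd : d.Bounded x s) (hy : d.out = y) :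
    (F.toMachine blank).OutputsInSpace s x y :=
  ⟨fun e he i => Exec.heads_lt blank h hd e he i, _, Exec.reaches blank h, rfl, hy⟩

end ToMachine

/-- A single step. -/
def act (f : Obs k W → Act k W) : Frag k W where
  State := Unit
  start := ()
  δ := fun _ o => (none, f o)

/-- Doing nothing. -/
def noop (o : Obs k W) : Act k W := ⟨.stay, fun i => (o.work i, .stay), none⟩

theorem apply_noop {c : Store k W} (hc : c.Bounded x s) : c.apply x (noop (c.obs x)) = c := by
  ext
  · simp [Store.apply, noop, Move.apply, hc.1]
  · rfl
  · simp [Store.apply, noop, Store.obs]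
  · simp [Store.apply, noop]

/-- Sequential composition. -/
def seq (F G : Frag k W) : Frag k W where
  State := F.State ⊕ G.State
  start := .inl F.start
  δ := fun p o => match p with
    | .inl p => (some ((F.δ p o).1.elim (.inr G.start) .inl), (F.δ p o).2)
    | .inr p => ((G.δ p o).1.map .inr, (G.δ p o).2)

/-- Repetition while a condition holds. -/
def loop (cond : Obs k W → Bool) (F : Frag k W) : Frag k W where
  State := Option F.State
  start := none
  δ := fun p o => match p with
    | none => (if cond o then some (some F.start) else none, noop o)
    | some p => (some (F.δ p o).1, (F.δ p o).2)

/-- Conditional execution. -/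
def when (cond : Obs k W → Bool) (F : Frag k W) : Frag k W where
  State := Option F.State
  start := none
  δ := fun p o => match p with
    | none => (if cond o then some (some F.start) else none, noop o)
    | some p => ((F.δ p o).1.map some, (F.δ p o).2)

theorem runs_act {f : Obs k W → Act k W} {c : Store k W} (hc : c.Bounded x s) :
    (act f).Runs x s c (c.apply x (f (c.obs x))) :=
  Exec.exit rfl hc

theorem Exec.seq_right {F G : Frag k W} {p : G.State} {c d : Store k W} (h : G.Exec x s p c d) :
    (F.seq G).Exec x s (.inr p) c d := by
  induction h with
  | exit h hc => exact Exec.exit (by simp [seq, h]) hc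
  | step h hc _ ih => exact Exec.step (by simp only [seq, h]; rfl) hc ih

theorem Runs.seq {F G : Frag k W} {c d e : Store k W} (h : F.Runs x s c d) (h' : G.Runs x s d e) :
    (F.seq G).Runs x s c e := by
  unfold Runs at h
  suffices ∀ p, F.Exec x s p c d → (F.seq G).Exec x s (.inl p) c e from this _ h
  intro p hp
  clear h
  induction hp with
  | exit h hc => exact Exec.step (p' := (Sum.inr G.start : F.State ⊕ G.State)) (by simp only [Frag.seq, h]; rfl) hc h'.seq_right
  | step h hc _ ih => exact Exec.step (by simp only [Frag.seq, h]; rfl) hc (ih h')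

theorem runs_loop_false {cond : Obs k W → Bool} {F : Frag k W} {c : Store k W}
    (hc : c.Bounded x s) (h : cond (c.obs x) = false) : (F.loop cond).Runs x s c c := by
  have : (F.loop cond).Exec x s none c (c.apply x (noop (c.obs x))) :=
    Exec.exit (by simp [Frag.loop, h]) hc
  rwa [apply_noop hc] at this

theorem Runs.bounded {F : Frag k W} {c d : Store k W} (h : F.Runs x s c d) : c.Bounded x s := by
  cases h <;> assumption

theorem runs_loop_true {cond : Obs k W → Bool} {F : Frag k W} {c d e : Store k W}
    (h : cond (c.obs x) = true) (hF : F.Runs x s c d) (hw : (F.loop cond).Runs x s d e) :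
    (F.loop cond).Runs x s c e := by
  have hc := hF.bounded
  refine Exec.step (p' := some F.start) (by simp only [Frag.loop, h]; rfl) hc ?_
  rw [apply_noop hc]
  unfold Runs at hF
  suffices ∀ p, F.Exec x s p c d → (F.loop cond).Exec x s (some p) c e from this _ hF
  intro p hp
  clear h hF hc
  induction hp with
  | @exit p c a h hc =>
    exact Exec.step (p' := (F.loop cond).start) (by simp only [Frag.loop, h]) hc hw
  | step h hc _ ih => exact Exec.step (by simp only [Frag.loop, h]) hc (ih hw)

theorem runs_when_false {cond : Obs k W → Bool} {F : Frag k W} {c : Store k W}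
    (hc : c.Bounded x s) (h : cond (c.obs x) = false) : (F.when cond).Runs x s c c := by
  have : (F.when cond).Exec x s none c (c.apply x (noop (c.obs x))) :=
    Exec.exit (by simp [Frag.when, h]) hc
  rwa [apply_noop hc] at this

theorem runs_when_true {cond : Obs k W → Bool} {F : Frag k W} {c d : Store k W}
    (h : cond (c.obs x) = true) (hF : F.Runs x s c d) : (F.when cond).Runs x s c d := by
  have hc := hF.bounded
  refine Exec.step (p' := some F.start) (by simp only [Frag.when, h]; rfl) hc ?_
  rw [apply_noop hc]
  unfold Runs at hF
  suffices ∀ p, F.Exec x s p c d → (F.when cond).Exec x s (some p) c d from this _ hF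
  intro p hp
  clear h hF hc
  induction hp with
  | exit h hc => exact Exec.exit (by simp only [Frag.when, h]; rfl) hc
  | step h hc _ ih => exact Exec.step (by simp only [Frag.when, h]; rfl) hc ih

/-- Writing symbols to the output that depend on what is seen. -/
def emit : List (Obs k W → TapeSym) → Frag k W
  | [] => act noop
  | f :: l => (act fun o => { noop o with out := some (f o) }).seq (emit l)

theorem runs_emit (l : List (Obs k W → TapeSym)) {c : Store k W} (hc : c.Bounded x s) :
    (emit l).Runs x s c { c with out := c.out ++ l.map fun f => f (c.obs x) } := by
  induction l generalizing c with
  | nil =>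
    have := runs_act (f := noop) hc
    rw [apply_noop hc] at this
    change (act noop).Runs x s c _
    simpa using this
  | cons f l ih =>
    have h1 := runs_act (f := fun o => { noop o with out := some (f o) }) hc
    have h2 : c.apply x { noop (c.obs x) with out := some (f (c.obs x)) } =
        { c with out := c.out ++ [f (c.obs x)] } := by
      have := apply_noop hc
      rw [Store.ext_iff] at this ⊢
      exact ⟨this.1, this.2.1, this.2.2.1, by simp [Store.apply]⟩
    rw [h2] at h1
    have h3 := h1.seq (ih (c := { c with out := c.out ++ [f (c.obs x)] }) hc)
    simp only [List.append_assoc, List.singleton_append] at h3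
    exact h3

/-- Fragments one after the other. -/
def seqList : List (Frag k W) → Frag k W
  | [] => act noop
  | F :: l => F.seq (seqList l)

end Frag

/-! ### A machine for the positional encoding -/

/-- The slots in the order of their coordinates. -/
noncomputable def slotList : List Slot := List.ofFn slotEquiv.symm

/-- Coordinates are numbered block by block, so vectors can be described in a loop over the blocks.
-/
theorem ofFn_coord {α : Type*} {m : ℕ} (f : Fin (m * slots) → α) :
    List.ofFn f = (List.finRange m).flatMap fun i => slotList.map fun s => f (coord m (i, s)) := by
  rw [List.ofFn_mul, List.flatMap_def, ← List.ofFn_eq_map]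
  congr 2
  funext i
  rw [slotList, List.map_ofFn]
  congr 1
  funext j
  have h : coord m (i, slotEquiv.symm j) = finProdFinEquiv (i, j) := by simp [coord]
  rw [Function.comp_apply, h]
  refine congrArg f (Fin.ext ?_)
  rw [finProdFinEquiv_apply_val]
  exact (add_comm _ _).trans (congrArg _ (mul_comm _ _))

theorem length_descFixed (x : Fixed 2) : (descFixed x).length = 5 := by
  simp [descFixed, binary]

namespace Frag

variable {k : ℕ} {W : Type} {x : List TapeSym} {s : ℕ}

/-- Writing a string of length `L` that depends on what is seen. -/
def emitStr (L : ℕ) (g : Obs k W → List TapeSym) : Frag k W :=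
  emit ((List.range L).map fun j o => (g o).getD j .sep)

theorem runs_emitStr {L : ℕ} {g : Obs k W → List TapeSym} {c : Store k W} (hc : c.Bounded x s)
    (hg : (g (c.obs x)).length = L) :
    (emitStr L g).Runs x s c { c with out := c.out ++ g (c.obs x) } := by
  have := runs_emit ((List.range L).map fun j o => (g o).getD j .sep) hc
  have e : ((List.range L).map fun j (o : Obs k W) => (g o).getD j .sep).map (fun f => f (c.obs x)) =
      g (c.obs x) := by
    apply List.ext_getElem
    · simp [hg]
    · intro j h1 h2; simp [h2]
  rwa [e] at this

end Frag

/-- The second summand is the carry into bit `i`, which the machine keeps in its work cell. -/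
theorem testBit_succ_eq (p i : ℕ) :
    (p + 1).testBit i = (p.testBit i ^^ decide (∀ j < i, p.testBit j = true)) := by
  induction i generalizing p with
  | zero =>
    rw [Nat.testBit_zero, Nat.testBit_zero]
    rcases Nat.mod_two_eq_zero_or_one p with h | h <;> simp [Nat.add_mod, h]
  | succ i ih =>
    rw [Nat.testBit_succ, Nat.testBit_succ]
    have hall : (∀ j < i + 1, p.testBit j = true) ↔
        p % 2 = 1 ∧ ∀ j < i, (p / 2).testBit j = true := by
      constructor
      · intro h
        refine ⟨by simpa [Nat.testBit_zero] using h 0 (by omega), fun j hj => ?_⟩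
        rw [← Nat.testBit_succ]; exact h _ (by omega)
      · rintro ⟨h1, h2⟩ j hj
        rcases j with _ | j
        · simpa [Nat.testBit_zero] using h1
        · rw [Nat.testBit_succ]; exact h2 j (by omega)
    rcases Nat.mod_two_eq_zero_or_one p with h | h
    · rw [show (p + 1) / 2 = p / 2 by omega]
      rw [decide_eq_false (mt hall.1 (by simp [h])), Bool.xor_false]
    · rw [show (p + 1) / 2 = p / 2 + 1 by omega, ih]
      simp only [hall, h, true_and]

/-- With one padding symbol a position is given by `Nat.clog 2 (N + 1)` bits; this equality makes
them correspond to the blocks one by one. -/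
theorem clog_succ_eq_size (N : ℕ) : Nat.clog 2 (N + 1) = Nat.size N := by
  apply le_antisymm
  · rw [Nat.clog_le_iff_le_pow (by norm_num)]; exact Nat.lt_size_self N
  · rw [Nat.size_le]; exact Nat.le_pow_clog (by norm_num) (N + 1)

/-- The description of the positional encoding in one block. -/
noncomputable def posBlock (b b' first : Bool) : List TapeSym :=
  slotList.flatMap fun s => descFixed (Fixed.ofMant (posTable b b' first s))

theorem length_posBlock (b b' first : Bool) : (posBlock b b' first).length = slots * 5 := by
  rw [posBlock, List.length_flatMap]
  simp only [length_descFixed, List.map_const', List.sum_replicate, slotList, List.length_ofFn,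
    smul_eq_mul]

theorem descVec_pos (m : ℕ) (blocks : List (ℕ × List Instr)) (p : ℕ) :
    descVec ((ofPrograms m blocks).pos p) = (List.range m).flatMap fun i =>
      posBlock (p.testBit i) ((p + 1).testBit i) (decide (i = 0)) := by
  rw [descVec, ofFn_coord, List.flatMap_assoc, ← List.map_coe_finRange_eq_range, List.flatMap_map]
  congr 1
  funext i
  rw [List.flatMap_map, posBlock]
  simp only [ofPrograms, Equiv.symm_apply_apply]

/-- The memory of the machine for the positional encoding: the carry, and whether the current
bit is the first one. -/
abbrev PosMem := Bool × Bool

/-- Whether the scanned input symbol is a bit. -/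
def scansBit (o : Obs 1 PosMem) : Bool :=
  match o.input with
  | some .zero => true
  | some .one => true
  | _ => false

/-- The scanned bit. -/
def scannedBit (o : Obs 1 PosMem) : Bool :=
  match o.input with
  | some .one => true
  | _ => false

/-- The loop of the program for the positional encoding. -/
noncomputable def posLoop : Frag 1 PosMem :=
  Frag.loop scansBit <|
    (Frag.emitStr (slots * 5) fun o =>
      posBlock (scannedBit o) (scannedBit o ^^ (o.work 0).1) (o.work 0).2).seq <|
    Frag.act fun o =>
      ⟨.left, fun _ => (((o.work 0).1 && scannedBit o, false), .stay), none⟩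

/-- The program for the positional encoding: the bits of the position are read from right to left. -/
noncomputable def posProg : Frag 1 PosMem :=
  (Frag.loop (fun o => o.input.isSome) (Frag.act fun o => { Frag.noop o with move := .right })).seq <|
  (Frag.act fun o => { Frag.noop o with move := .left }).seq posLoop

section PosProg

variable (x : List TapeSym) (s : ℕ)

/-- A configuration of the program for the positional encoding. -/
def posStore (h : ℕ) (v : PosMem) (out : List TapeSym) : Store 1 PosMem :=
  ⟨h, fun _ => 0, fun _ => Function.update (fun _ => (true, true)) 0 v, out⟩

variable {x s}

theorem posStore_bounded (hs : 0 < s) {h : ℕ} (hh : h ≤ x.length + 1) (v : PosMem)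
    (out : List TapeSym) : (posStore h v out).Bounded x s := ⟨hh, fun _ => hs⟩

theorem obs_posStore (h : ℕ) (v : PosMem) (out : List TapeSym) :
    (posStore h v out).obs x = ⟨Machine.inputAt x h, fun _ => v⟩ := by
  simp [posStore, Store.obs]

theorem apply_posStore (h : ℕ) (v v' : PosMem) (out : List TapeSym) (mv : Move) :
    (posStore h v out).apply x ⟨mv, fun _ => (v', .stay), none⟩ =
      posStore (min (mv.apply h) (x.length + 1)) v' out := by
  simp [posStore, Store.apply, Move.apply]

theorem noop_posStore (h : ℕ) (v : PosMem) (out : List TapeSym) (mv : Move) :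
    { Frag.noop ((posStore h v out).obs x) with move := mv } =
      (⟨mv, fun _ => (v, .stay), none⟩ : Act 1 PosMem) := by
  simp [obs_posStore, Frag.noop]

theorem runs_toEnd (hs : 0 < s) (v : PosMem) (out : List TapeSym) (j : ℕ) (hj : j ≤ x.length) :
    (Frag.loop (fun o => o.input.isSome) (Frag.act fun o => { Frag.noop o with move := .right })).Runs
      x s (posStore (x.length + 1 - j) v out) (posStore (x.length + 1) v out) := by
  induction j with
  | zero =>
    refine Frag.runs_loop_false (posStore_bounded hs (by omega) _ _) ?_
    rw [obs_posStore]
    simp [Machine.inputAt]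
  | succ j ih =>
    refine Frag.runs_loop_true ?_ (Frag.runs_act (posStore_bounded hs (by omega) _ _)) ?_
    · rw [obs_posStore]
      simp only [Machine.inputAt]
      rw [if_neg (by omega), List.getElem?_eq_getElem (by omega)]
      rfl
    · rw [noop_posStore, apply_posStore, Move.apply]
      rw [show min (x.length + 1 - (j + 1) + 1) (x.length + 1) = x.length + 1 - j by omega]
      exact ih (by omega)

end PosProg

/-- The blank symbol is `(true, true)`, so the carry of the increment and the flag of the first
block are set without any preparation. The scan from right to left ends at the separator behind the
unary `N`. -/
theorem runs_posProg (N W p s : ℕ) (hs : 0 < s) :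
    let x := descNat N ++ (binary (W) p).map TapeSym.bit
    posProg.Runs x s ⟨1, fun _ => 0, fun _ _ => (true, true), []⟩
      (posStore (N + 1) (decide (∀ j < W, p.testBit j = true), decide (W = 0))
        ((List.range (W)).flatMap fun i =>
          posBlock (p.testBit i) ((p + 1).testBit i) (decide (i = 0)))) := by
  intro x
  have hlen : x.length = N + 1 + W := by simp [x, descNat, binary]; ring
  have hinit : (⟨1, fun _ => 0, fun _ _ => (true, true), []⟩ : Store 1 PosMem) =
      posStore (x.length + 1 - x.length) (true, true) [] := by
    rw [posStore, Nat.add_sub_cancel_left]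
    congr 1
    funext _; exact (Function.update_eq_self 0 _).symm
  rw [hinit]
  refine (runs_toEnd hs _ _ _ le_rfl).seq ((Frag.runs_act (posStore_bounded hs le_rfl _ _)).seq ?_)
  rw [noop_posStore, apply_posStore, Move.apply]
  have hbit : ∀ i < W, Machine.inputAt x (N + 1 + W - i) = some (TapeSym.bit (p.testBit i)) := by
    intro i hi
    rw [Machine.inputAt, if_neg (by omega)]
    simp only [x]
    rw [List.getElem?_append_right (by simp [descNat]; omega)]
    have h : N + 1 + W - i - 1 - (N + 1) = W - 1 - i := by omega
    simp [descNat, h, binary, show W - 1 - i < W by omega, show W - 1 - (W - 1 - i) = i by omega]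
  have hsep : Machine.inputAt x (N + 1) = some .sep := by
    rw [Machine.inputAt, if_neg (by omega)]
    simp only [x]
    rw [List.getElem?_append_left (by simp [descNat])]
    simp [descNat]
  -- `i` bits have been processed, and `j` bits remain to the left.
  suffices ∀ j ≤ W, ∀ i, i + j = W → posLoop.Runs x s
      (posStore (N + 1 + W - i) (decide (∀ j < i, p.testBit j = true), decide (i = 0))
        ((List.range i).flatMap fun i =>
          posBlock (p.testBit i) ((p + 1).testBit i) (decide (i = 0))))
      (posStore (N + 1) (decide (∀ j < W, p.testBit j = true), decide (W = 0))
        ((List.range W).flatMap fun i =>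
          posBlock (p.testBit i) ((p + 1).testBit i) (decide (i = 0)))) by
    have := this W le_rfl 0 (by omega)
    simpa [hlen] using this
  intro j
  induction j with
  | zero =>
    intro _ i hi
    obtain rfl : i = W := by omega
    rw [Nat.add_sub_cancel]
    refine Frag.runs_loop_false (posStore_bounded hs (by omega) _ _) ?_
    rw [obs_posStore, hsep]
    rfl
  | succ j ih =>
    intro hj i hi
    have hb := hbit i (by omega)
    have hscan : ∀ v : PosMem, scannedBit ⟨some (TapeSym.bit (p.testBit i)), fun _ => v⟩ = p.testBit i := by
      intro v; cases p.testBit i <;> rfl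
    have hbd := fun v out => posStore_bounded (x := x) hs (h := N + 1 + W - i) (by omega) v out
    refine Frag.runs_loop_true ?_ ((Frag.runs_emitStr (hbd _ _) (length_posBlock _ _ _)).seq
      (Frag.runs_act (hbd _ _))) ?_
    · rw [obs_posStore, hb]
      cases p.testBit i <;> rfl
    · have e : ∀ (v : PosMem) out out', ({ posStore (N + 1 + W - i) v out with out := out' } : Store 1 PosMem) =
        posStore (N + 1 + W - i) v out' := fun _ _ _ => rfl
      simp only [e, obs_posStore, hb, hscan]
      rw [apply_posStore, Move.apply]
      have h1 : min (N + 1 + W - i - 1) (x.length + 1) = N + 1 + W - (i + 1) := by omega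
      have h2 : (decide (∀ j < i, p.testBit j = true) && p.testBit i) =
          decide (∀ j < i + 1, p.testBit j = true) := by
        rw [Bool.eq_iff_iff]
        simp only [Bool.and_eq_true, decide_eq_true_eq, Nat.lt_succ_iff_lt_or_eq, or_imp,
          forall_and, forall_eq]
      rw [h1, h2, ← testBit_succ_eq, ← List.flatMap_singleton (f := fun i =>
        posBlock (p.testBit i) ((p + 1).testBit i) (decide (i = 0))) (x := i),
        show ∀ v out, (posStore (N + 1 + W - i) v out).out = out from fun _ _ => rfl,
        ← List.flatMap_append, ← List.range_succ]
      exact ih (by omega) (i + 1) (by omega)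

theorem logspace_pos (spec : ℕ → List (ℕ × List Instr)) : LogspaceOutputs
    (fun i : (N : ℕ) × Fin (N + (ofPrograms (Nat.size N) (spec N)).pad) =>
      descNat i.1 ++ (binary (Nat.clog 2 (i.1 + (ofPrograms (Nat.size i.1) (spec i.1)).pad))
        i.2).map TapeSym.bit)
    (fun i => descVec ((ofPrograms (Nat.size i.1) (spec i.1)).pos i.2)) := by
  -- Only one work cell is ever visited.
  refine ⟨posProg.toMachine (true, true), 1, fun i => ?_⟩
  obtain ⟨N, p⟩ := i
  have h := runs_posProg N (Nat.size N) p
  rw [← clog_succ_eq_size] at h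
  refine Frag.Runs.outputsInSpace _ (h _ (by omega)) (posStore_bounded (by omega) ?_ _ _) ?_
  · simp [descNat]
  · dsimp only; rw [descVec_pos, ← clog_succ_eq_size]; rfl

/-! ### Machines whose work tapes hold a ruler -/

/-- The alphabet of the work tapes: blank, the mark of the first cell, and bits. -/
abbrev Cell := Option (Option Bool)

/-- The tape with a mark in the first cell, followed by a list of bits. -/
def ruler (l : List Bool) : ℕ → Cell
  | 0 => some none
  | i + 1 => l[i]?.map some

namespace Frag

variable {k : ℕ}

/-- Whether work head `t` scans a bit. -/
def onBit (t : Fin k) (o : Obs k Cell) : Bool :=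
  match o.work t with
  | some (some _) => true
  | _ => false

/-- Whether work head `t` is not on the first cell. -/
def offStart (t : Fin k) (o : Obs k Cell) : Bool :=
  match o.work t with
  | some none => false
  | _ => true

/-- Moving one work head. -/
def move (t : Fin k) (mv : Move) : Frag k Cell :=
  act fun o => { noop o with work := fun i => (o.work i, if i = t then mv else .stay) }

/-- Writing a string. -/
def put (w : List TapeSym) : Frag k Cell := emit (w.map fun a _ => a)

/-- The fragment moves the work heads from `h` to `h'` and writes `w`, while the work tapes hold the
ruler `l`. -/
def Leads (x : List TapeSym) (s : ℕ) (l : List Bool) (F : Frag k Cell) (h : Fin k → ℕ)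
    (w : List TapeSym) (h' : Fin k → ℕ) : Prop :=
  ∀ o, F.Runs x s ⟨x.length + 1, h, fun _ => ruler l, o⟩ ⟨x.length + 1, h', fun _ => ruler l, o ++ w⟩

variable {x : List TapeSym} {s : ℕ} {l : List Bool}

theorem Leads.seq {F G : Frag k Cell} {h h' h'' : Fin k → ℕ} {w w' : List TapeSym}
    (hF : Leads x s l F h w h') (hG : Leads x s l G h' w' h'') :
    Leads x s l (F.seq G) h (w ++ w') h'' := fun o => by
  have := (hF o).seq (hG (o ++ w))
  rwa [List.append_assoc] at this

theorem leads_put (w : List TapeSym) {h : Fin k → ℕ} (hh : ∀ i, h i < s) :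
    Leads x s l (put w) h w h := fun o => by
  have := runs_emit (w.map fun a (_ : Obs k Cell) => a)
    (c := ⟨x.length + 1, h, fun _ => ruler l, o⟩) (x := x) (s := s) ⟨le_rfl, hh⟩
  rw [List.map_map] at this
  simpa [put, Function.comp_def] using this

theorem leads_move (t : Fin k) (mv : Move) {h : Fin k → ℕ} (hh : ∀ i, h i < s) :
    Leads x s l (move t mv) h [] (Function.update h t (mv.apply (h t))) := fun o => by
  have := runs_act (x := x) (s := s) (f := fun o : Obs k Cell =>
    { noop o with work := fun i => (o.work i, if i = t then mv else .stay) })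
    (c := ⟨x.length + 1, h, fun _ => ruler l, o⟩) ⟨le_rfl, hh⟩
  rw [List.append_nil]
  refine Eq.mp (congrArg _ ?_) this
  refine Store.ext ?_ ?_ ?_ ?_
  · simp [Store.apply, noop, Move.apply]
  · funext i
    by_cases hi : i = t
    · subst hi; simp [Store.apply]
    · simp [Store.apply, hi, Move.apply]
  · simp [Store.apply, Store.obs]
  · simp [Store.apply, noop]

/-- Repetition along a sequence of head positions. -/
theorem leads_loop {cond : Obs k Cell → Bool} {F : Frag k Cell} (n : ℕ) (g : ℕ → Fin k → ℕ)
    (w : ℕ → List TapeSym) (hF : ∀ j < n, Leads x s l F (g j) (w j) (g (j + 1)))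
    (ht : ∀ j < n, cond ⟨Machine.inputAt x (x.length + 1), fun i => ruler l (g j i)⟩ = true)
    (hf : cond ⟨Machine.inputAt x (x.length + 1), fun i => ruler l (g n i)⟩ = false)
    (hs : ∀ i, g n i < s) :
    Leads x s l (F.loop cond) (g 0) ((List.range n).flatMap w) (g n) := by
  induction n generalizing g w with
  | zero =>
    intro o
    simp only [List.range_zero, List.flatMap_nil, List.append_nil]
    exact runs_loop_false ⟨le_rfl, hs⟩ hf
  | succ n ih =>
    intro o
    have h1 := ih (fun j => g (j + 1)) (fun j => w (j + 1)) (fun j hj => hF (j + 1) (by omega))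
      (fun j hj => ht (j + 1) (by omega)) hf hs (o ++ w 0)
    have h2 := runs_loop_true (cond := cond)
      (c := ⟨x.length + 1, g 0, fun _ => ruler l, o⟩) (ht 0 (by omega)) (hF 0 (by omega) o) h1
    rw [List.range_succ_eq_map, List.flatMap_cons, List.flatMap_map, ← List.append_assoc]
    exact h2

theorem leads_when_true {cond : Obs k Cell → Bool} {F : Frag k Cell} {h h' : Fin k → ℕ}
    {w : List TapeSym}
    (ht : cond ⟨Machine.inputAt x (x.length + 1), fun i => ruler l (h i)⟩ = true)
    (hF : Leads x s l F h w h') : Leads x s l (F.when cond) h w h' :=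
  fun o => runs_when_true ht (hF o)

theorem leads_when_false {cond : Obs k Cell → Bool} {F : Frag k Cell} {h : Fin k → ℕ}
    (hf : cond ⟨Machine.inputAt x (x.length + 1), fun i => ruler l (h i)⟩ = false)
    (hs : ∀ i, h i < s) : Leads x s l (F.when cond) h [] h := fun o => by
  rw [List.append_nil]
  exact runs_when_false ⟨le_rfl, hs⟩ hf

theorem onBit_ruler (t : Fin k) (y : Option TapeSym) (h : Fin k → ℕ) :
    onBit t ⟨y, fun i => ruler l (h i)⟩ = decide (1 ≤ h t ∧ h t ≤ l.length) := by
  rcases hh : h t with _ | i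
  · simp [onBit, hh, ruler]
  · by_cases hi : i < l.length
    · simp only [onBit, hh, ruler, List.getElem?_eq_getElem hi, Option.map_some]
      simp; omega
    · simp only [onBit, hh, ruler, List.getElem?_eq_none (not_lt.1 hi), Option.map_none]
      simp; omega

theorem offStart_ruler (t : Fin k) (y : Option TapeSym) (h : Fin k → ℕ) :
    offStart t ⟨y, fun i => ruler l (h i)⟩ = decide (h t ≠ 0) := by
  rcases hh : h t with _ | i
  · simp [offStart, hh, ruler]
  · rcases hi : l[i]? with _ | b <;> simp [offStart, hh, ruler, hi]

/-- Repetition for all bits of the ruler. -/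
def forAll (t : Fin k) (F : Frag k Cell) : Frag k Cell :=
  (move t .right).seq <| (Frag.loop (onBit t) (F.seq (move t .right))).seq <|
    (move t .left).seq (Frag.loop (offStart t) (move t .left))

theorem flatMap_nil' {α β : Type*} (l : List α) : (l.flatMap fun _ => ([] : List β)) = [] := by
  simp

variable (hs : l.length + 1 < s)
include hs

theorem update_lt {h : Fin k → ℕ} (hh : ∀ i, h i ≤ l.length + 1) (t : Fin k) {a : ℕ}
    (ha : a ≤ l.length + 1) (i : Fin k) : Function.update h t a i < s := by
  have := hh i
  by_cases hi : i = t
  · subst hi; rw [Function.update_self]; omega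
  · rw [Function.update_of_ne hi]; omega

/-- Head `t` visits the cells `1, …, l.length` and is rewound. The body may test the position of the
head but has to restore it, so loops on different tapes can be nested. -/
theorem leads_forAll {t : Fin k} {F : Frag k Cell} {h : Fin k → ℕ} (hh : ∀ i, h i ≤ l.length + 1)
    (ht : h t = 0) (w : ℕ → List TapeSym) (hF : ∀ i < l.length,
      Leads x s l F (Function.update h t (i + 1)) (w i) (Function.update h t (i + 1))) :
    Leads x s l (forAll t F) h ((List.range l.length).flatMap w) h := by
  have h0 : h = Function.update h t 0 := by rw [← ht, Function.update_eq_self]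
  have hmv : ∀ mv a, a ≤ l.length + 1 → Leads x s l (move t mv) (Function.update h t a) []
      (Function.update h t (mv.apply a)) := by
    intro mv a ha
    have := leads_move (x := x) (l := l) t mv (update_lt hs hh t ha)
    rwa [Function.update_self, Function.update_idem] at this
  have h1 : Leads x s l (move t .right) h [] (Function.update h t 1) := by
    have := hmv .right 0 (by omega)
    rwa [← h0] at this
  have h2 := leads_loop (cond := onBit t) (F := F.seq (move t .right)) (x := x) (s := s) (l := l)
    l.length (fun j => Function.update h t (j + 1)) w
    (fun j hj => by
      have := (hF j hj).seq (hmv .right (j + 1) (by omega))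
      rw [List.append_nil] at this
      exact this)
    (fun j hj => by rw [onBit_ruler]; simp; omega) (by rw [onBit_ruler]; simp)
    (update_lt hs hh t le_rfl)
  have h3 := leads_loop (cond := offStart t) (F := move t .left) (x := x) (s := s) (l := l)
    l.length (fun j => Function.update h t (l.length - j)) (fun _ => [])
    (fun j hj => hmv .left (l.length - j) (by omega))
    (fun j hj => by rw [offStart_ruler]; simp; omega) (by rw [offStart_ruler]; simp)
    (update_lt hs hh t (by omega))
  have h4 := h1.seq (h2.seq ((hmv .left (l.length + 1) le_rfl).seq h3))
  simp only [Nat.sub_self, ← h0, flatMap_nil', List.nil_append, List.append_nil] at h4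
  exact h4

end Frag

/-! ### Counting with two heads on the ruler. -/

namespace Frag

variable {k : ℕ} {x : List TapeSym} {s : ℕ} {l : List Bool}

/-- Writing a string as often as there are bits of the ruler to the left of head `A`; head `B` has to
be on the first cell. -/
def below (A B : Fin k) (w : List TapeSym) : Frag k Cell :=
  (move A .left).seq <|
    (Frag.loop (offStart A) ((put w).seq ((move A .left).seq (move B .right)))).seq <|
    (move A .right).seq <| Frag.loop (offStart B) ((move B .left).seq (move A .right))

/-- Writing strings for the bits of the ruler to the right of head `A`: the string `w` for the first
one and `z` for the other ones; head `B` has to be on the first cell. -/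
def above (A B : Fin k) (w z : List TapeSym) : Frag k Cell :=
  (move A .right).seq <|
    (Frag.when (onBit A) <| (put w).seq <| (move A .right).seq <| (move B .right).seq <|
      Frag.loop (onBit A) ((put z).seq ((move A .right).seq (move B .right)))).seq <|
    (Frag.loop (offStart B) ((move B .left).seq (move A .left))).seq (move A .left)

/-- Changing the positions of two heads. -/
def set2 (h : Fin k → ℕ) (A B : Fin k) (a b : ℕ) : Fin k → ℕ :=
  Function.update (Function.update h A a) B b

section Set2

variable {h : Fin k → ℕ} {A B : Fin k} (hAB : A ≠ B) (hh : ∀ i, h i ≤ l.length + 1)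
  (hs : l.length + 1 < s)

include hh hs in
theorem set2_lt {a b : ℕ} (ha : a ≤ l.length + 1) (hb : b ≤ l.length + 1) (i : Fin k) :
    set2 h A B a b i < s := by
  refine update_lt hs (fun j => ?_) B hb i
  by_cases hj : j = A
  · subst hj; rwa [Function.update_self]
  · rw [Function.update_of_ne hj]; exact hh j

theorem set2_right (a b : ℕ) : set2 h A B a b B = b := Function.update_self ..

include hAB in
theorem set2_left (a b : ℕ) : set2 h A B a b A = a := by
  rw [set2, Function.update_of_ne hAB, Function.update_self]

include hAB in
theorem update_set2_left (a b a' : ℕ) : Function.update (set2 h A B a b) A a' = set2 h A B a' b := by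
  rw [set2, Function.update_comm hAB.symm, Function.update_idem, set2]

theorem update_set2_right (a b b' : ℕ) : Function.update (set2 h A B a b) B b' = set2 h A B a b' :=
  Function.update_idem ..

theorem set2_self : set2 h A B (h A) (h B) = h := by
  rw [set2, Function.update_eq_self, Function.update_eq_self]

include hAB hh hs

theorem leads_move_left {a b : ℕ} (ha : a ≤ l.length + 1) (hb : b ≤ l.length + 1) (mv : Move) :
    Leads x s l (move A mv) (set2 h A B a b) [] (set2 h A B (mv.apply a) b) := by
  have := leads_move (x := x) (l := l) A mv (set2_lt (A := A) (B := B) hh hs ha hb)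
  rwa [set2_left hAB, update_set2_left hAB] at this

theorem leads_move_right {a b : ℕ} (ha : a ≤ l.length + 1) (hb : b ≤ l.length + 1) (mv : Move) :
    Leads x s l (move B mv) (set2 h A B a b) [] (set2 h A B a (mv.apply b)) := by
  have := leads_move (x := x) (l := l) B mv (set2_lt (A := A) (B := B) hh hs ha hb)
  rwa [set2_right, update_set2_right] at this

/-- Head `B` advances while `A` retreats, and thereby remembers how far `A` has to return. -/
theorem leads_below {i : ℕ} (hi : i < l.length) (hA : h A = i + 1) (hB : h B = 0)
    (w : List TapeSym) :
    Leads x s l (below A B w) h ((List.range i).flatMap fun _ => w) h := by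
  have e : set2 h A B (i + 1) 0 = h := by rw [← hA, ← hB, set2_self]
  have h1 := leads_move_left (x := x) (s := s) (l := l) hAB hh hs (a := i + 1) (b := 0) (by omega)
    (by omega) .left
  have h2 := leads_loop (cond := offStart A)
    (F := (put w).seq ((move A .left).seq (move B .right))) (x := x) (s := s) (l := l)
    i (fun j => set2 h A B (i - j) j) (fun _ => w)
    (fun j hj => by
      have := (leads_put (x := x) (l := l) w
        (set2_lt (A := A) (B := B) hh hs (a := i - j) (b := j) (by omega) (by omega))).seq
        ((leads_move_left hAB hh hs (by omega) (by omega) .left).seq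
          (leads_move_right hAB hh hs (a := i - j - 1) (by omega) (by omega) .right))
      simp only [List.append_nil] at this
      exact this)
    (fun j hj => by rw [offStart_ruler, set2_left hAB]; simp; omega)
    (by rw [offStart_ruler, set2_left hAB]; simp)
    (set2_lt hh hs (by omega) (by omega))
  have h3 := leads_move_left (x := x) (s := s) (l := l) hAB hh hs (a := 0) (b := i) (by omega)
    (by omega) .right
  have h4 := leads_loop (cond := offStart B)
    (F := (move B .left).seq (move A .right)) (x := x) (s := s) (l := l)
    i (fun j => set2 h A B (j + 1) (i - j)) (fun _ => [])
    (fun j hj => by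
      exact ((leads_move_right hAB hh hs (by omega) (by omega) .left).seq
          (leads_move_left hAB hh hs (b := i - j - 1) (by omega) (by omega) .right)))
    (fun j hj => by rw [offStart_ruler, set2_right]; simp; omega)
    (by rw [offStart_ruler, set2_right]; simp)
    (set2_lt hh hs (by omega) (by omega))
  rw [Nat.sub_self] at h2 h4
  have := h1.seq (h2.seq (h3.seq h4))
  simp only [e, flatMap_nil', List.nil_append, List.append_nil] at this
  exact this

/-- The first cell to the right of `A` stands for the block above the diagonal; the conditional
covers the last row, which has none. `A` runs to the blank behind the ruler, and `B` counts the way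
back. -/
theorem leads_above {i : ℕ} (hi : i < l.length) (hA : h A = i + 1) (hB : h B = 0)
    (w z : List TapeSym) :
    Leads x s l (above A B w z) h
      (if i + 1 < l.length then w ++ (List.range (l.length - (i + 2))).flatMap fun _ => z else []) h := by
  have e : set2 h A B (i + 1) 0 = h := by rw [← hA, ← hB, set2_self]
  have h1 := leads_move_left (x := x) (s := s) (l := l) hAB hh hs (a := i + 1) (b := 0) (by omega)
    (by omega) .right
  have h2 : Leads x s l (Frag.when (onBit A) <| (put w).seq <| (move A .right).seq <|
      (move B .right).seq <| Frag.loop (onBit A) ((put z).seq ((move A .right).seq (move B .right))))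
      (set2 h A B (i + 2) 0)
      (if i + 1 < l.length then w ++ (List.range (l.length - (i + 2))).flatMap fun _ => z else [])
      (set2 h A B (l.length + 1) (l.length - (i + 1))) := by
    split_ifs with hi'
    · have g1 := leads_put (x := x) (l := l) w
        (set2_lt (A := A) (B := B) hh hs (a := i + 2) (b := 0) (by omega) (by omega))
      have g2 := leads_move_left (x := x) (s := s) (l := l) hAB hh hs (a := i + 2) (b := 0)
        (by omega) (by omega) .right
      have g3 := leads_move_right (x := x) (s := s) (l := l) hAB hh hs (a := i + 3) (b := 0)
        (by omega) (by omega) .right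
      have g4 := leads_loop (cond := onBit A)
        (F := (put z).seq ((move A .right).seq (move B .right))) (x := x) (s := s) (l := l)
        (l.length - (i + 2)) (fun j => set2 h A B (i + 3 + j) (1 + j)) (fun _ => z)
        (fun j hj => by
          have := (leads_put (x := x) (l := l) z (set2_lt (A := A) (B := B) hh hs
            (a := i + 3 + j) (b := 1 + j) (by omega) (by omega))).seq
            ((leads_move_left hAB hh hs (by omega) (by omega) .right).seq
              (leads_move_right hAB hh hs (a := i + 3 + j + 1) (by omega) (by omega) .right))
          simp only [List.append_nil] at this
          exact this)
        (fun j hj => by rw [onBit_ruler, set2_left hAB]; simp; omega)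
        (by rw [onBit_ruler, set2_left hAB]; simp; omega)
        (set2_lt hh hs (by omega) (by omega))
      have := g1.seq (g2.seq (g3.seq g4))
      rw [show i + 3 + (l.length - (i + 2)) = l.length + 1 by omega,
        show 1 + (l.length - (i + 2)) = l.length - (i + 1) by omega] at this
      exact leads_when_true (by rw [onBit_ruler, set2_left hAB]; simp; omega) this
    · have : i + 1 = l.length := by omega
      rw [show l.length + 1 = i + 2 by omega, show l.length - (i + 1) = 0 by omega]
      exact leads_when_false (by rw [onBit_ruler, set2_left hAB]; simp; omega)
        (set2_lt hh hs (by omega) (by omega))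
  have h3 := leads_loop (cond := offStart B)
    (F := (move B .left).seq (move A .left)) (x := x) (s := s) (l := l)
    (l.length - (i + 1)) (fun j => set2 h A B (l.length + 1 - j) (l.length - (i + 1) - j))
    (fun _ => [])
    (fun j hj => by
      exact ((leads_move_right hAB hh hs (by omega) (by omega) .left).seq
          (leads_move_left hAB hh hs (b := l.length - (i + 1) - j - 1) (by omega) (by omega) .left)))
    (fun j hj => by rw [offStart_ruler, set2_right]; simp; omega)
    (by rw [offStart_ruler, set2_right]; simp)
    (set2_lt hh hs (by omega) (by omega))
  rw [show l.length + 1 - (l.length - (i + 1)) = i + 2 by omega, Nat.sub_self] at h3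
  have h4 := leads_move_left (x := x) (s := s) (l := l) hAB hh hs (a := i + 2) (b := 0) (by omega)
    (by omega) .left
  have := h1.seq (h2.seq (h3.seq h4))
  simp only [Move.apply, Nat.add_sub_cancel, show i + 2 - 1 = i + 1 by omega, e, flatMap_nil',
    List.nil_append, List.append_nil] at this
  exact this

end Set2

/-- Writing `c * m ^ e` ones, where `m` is the length of the ruler. -/
def power (t : ℕ → Fin k) (c : ℕ) : ℕ → Frag k Cell
  | 0 => put (List.replicate c .one)
  | e + 1 => forAll (t e) (power t c e)

/-- These are `e` nested loops; since `t` is injective, the inner loops find their own heads at the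
start whatever the outer ones do. -/
theorem leads_power (hs : l.length + 1 < s) {t : ℕ → Fin k} (c e : ℕ)
    (ht : ∀ i < e, ∀ j < e, t i = t j → i = j)
    {h : Fin k → ℕ} (hh : ∀ i, h i ≤ l.length + 1) (h0 : ∀ i < e, h (t i) = 0) :
    Leads x s l (power t c e) h (List.replicate (c * l.length ^ e) .one) h := by
  induction e generalizing h with
  | zero =>
    rw [pow_zero, mul_one]
    exact leads_put _ fun i => (hh i).trans_lt hs
  | succ e ih =>
    have hrep : List.replicate (c * l.length ^ (e + 1)) TapeSym.one =
        (List.range l.length).flatMap fun _ => List.replicate (c * l.length ^ e) .one := by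
      symm
      rw [List.eq_replicate_iff]
      constructor
      · simp [List.length_flatMap]; ring
      · intro a ha
        simp only [List.mem_flatMap, List.mem_replicate] at ha
        exact ha.choose_spec.2.2
    rw [hrep]
    refine leads_forAll hs hh (h0 e (by omega)) _ fun i hi => ?_
    refine ih (fun a ha b hb => ht a (by omega) b (by omega)) (fun j => ?_) fun j hj => ?_
    · by_cases hj : j = t e
      · subst hj; rw [Function.update_self]; omega
      · rw [Function.update_of_ne hj]; exact hh j
    · rw [Function.update_of_ne, h0 j (by omega)]
      intro h
      have := ht _ (by omega) _ (by omega) h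
      omega

theorem leads_seqList (hs : l.length + 1 < s) {h : Fin k → ℕ} (hh : ∀ i, h i ≤ l.length + 1)
    {α : Type*} (L : List α)
    {F : α → Frag k Cell} {w : α → List TapeSym} (hF : ∀ a ∈ L, Leads x s l (F a) h (w a) h) :
    Leads x s l (seqList (L.map F)) h (L.flatMap w) h := by
  induction L with
  | nil => exact leads_put (x := x) (l := l) [] fun i => (hh i).trans_lt hs
  | cons a L ih =>
    exact (hF a (by simp)).seq (ih fun b hb => hF b (by simp [hb]))

end Frag

/-! ### Building the ruler -/

/-- The successor of a number in binary, least significant bit first. -/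
def incr : List Bool → List Bool
  | [] => [true]
  | false :: l => true :: l
  | true :: l => false :: incr l

theorem bits_succ (n : ℕ) : (n + 1).bits = incr n.bits := by
  induction n using Nat.strong_induction_on with
  | _ n ih =>
    obtain ⟨a, rfl | rfl⟩ := n.even_or_odd'
    · by_cases ha : a = 0
      · subst ha; simp [incr]
      · rw [Nat.bit1_bits, Nat.bit0_bits _ ha, incr]
    · rw [show 2 * a + 1 + 1 = 2 * (a + 1) by ring, Nat.bit0_bits _ (by omega), Nat.bit1_bits, incr,
        ih a (by omega)]

theorem ruler_append (l l' : List Bool) : ruler (l ++ l') (l.length + 1) = l'.head?.map some := by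
  rw [ruler, List.getElem?_append_right le_rfl, Nat.sub_self, List.head?_eq_getElem?]

theorem update_ruler (l l' : List Bool) (b : Bool) :
    Function.update (ruler (l ++ l')) (l.length + 1) (some (some b)) = ruler (l ++ b :: l'.tail) := by
  funext i
  rcases i with _ | i
  · simp [ruler]
  rcases lt_trichotomy i l.length with h | h | h
  · rw [Function.update_of_ne (by omega)]
    simp [ruler, List.getElem?_append_left h]
  · subst h; simp [ruler]
  · rw [Function.update_of_ne (by omega)]
    obtain ⟨j, rfl⟩ : ∃ j, i = l.length + (j + 1) := ⟨i - l.length - 1, by omega⟩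
    rw [ruler, ruler, List.getElem?_append_right (by omega), List.getElem?_append_right (by omega),
      Nat.add_sub_cancel_left, List.getElem?_cons_succ, List.getElem?_tail]

namespace Frag

variable {k : ℕ}

/-- Moving all work heads. -/
def moveAll (mv : Move) : Frag k Cell :=
  act fun o => { noop o with work := fun i => (o.work i, mv) }

/-- Writing a symbol to all work tapes, and moving their heads. -/
def writeAll (a : Cell) (mv : Move) : Frag k Cell :=
  act fun o => { noop o with work := fun _ => (a, mv) }

/-- Moving the input head to the right. -/
def inputRight : Frag k Cell := act fun o => { noop o with move := .right }

/-- Clearing trailing ones. -/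
def carryLoop (t : Fin k) : Frag k Cell :=
  Frag.loop (fun o => o.work t == some (some true)) (writeAll (some (some false)) .right)

/-- Moving all work heads back to the first cell. -/
def rewind (t : Fin k) : Frag k Cell := Frag.loop (offStart t) (moveAll .left)

/-- Counting the symbols of the input in binary on all work tapes. -/
def buildRuler (t : Fin k) : Frag k Cell :=
  (writeAll (some none) .stay).seq <| Frag.loop (fun o => o.input.isSome) <|
    (moveAll .right).seq <| (carryLoop t).seq <| (writeAll (some (some true)) .stay).seq <|
    (rewind t).seq inputRight

/-- All work tapes hold the same ruler, and their heads are at the same position. -/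
def rulerStore (k ih p : ℕ) (l : List Bool) : Store k Cell := ⟨ih, fun _ => p, fun _ => ruler l, []⟩

variable {x : List TapeSym} {s ih : ℕ} (hih : ih ≤ x.length + 1)

include hih in
theorem rulerStore_bounded {p : ℕ} (hp : p < s) (l : List Bool) :
    (rulerStore k ih p l).Bounded x s := ⟨hih, fun _ => hp⟩

include hih in
theorem runs_moveAll (mv : Move) {p : ℕ} (hp : p < s) (l : List Bool) :
    (moveAll mv).Runs x s (rulerStore k ih p l) (rulerStore k ih (mv.apply p) l) := by
  refine Eq.mp (congrArg _ ?_) (runs_act (rulerStore_bounded (k := k) hih hp l))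
  refine Store.ext ?_ ?_ ?_ ?_
  · simpa [Store.apply, noop, Move.apply, rulerStore] using hih
  · simp [Store.apply, rulerStore]
  · simp [Store.apply, Store.obs, rulerStore]
  · simp [Store.apply, noop, rulerStore]

include hih in
theorem runs_writeAll (b : Bool) (mv : Move) (l l' : List Bool) (hp : l.length + 1 < s) :
    (writeAll (some (some b)) mv).Runs x s (rulerStore k ih (l.length + 1) (l ++ l'))
      (rulerStore k ih (mv.apply (l.length + 1)) (l ++ b :: l'.tail)) := by
  refine Eq.mp (congrArg _ ?_) (runs_act (rulerStore_bounded (k := k) hih hp (l ++ l')))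
  refine Store.ext ?_ ?_ ?_ ?_
  · simpa [Store.apply, noop, Move.apply, rulerStore] using hih
  · simp [Store.apply, rulerStore]
  · simp [Store.apply, rulerStore, update_ruler]
  · simp [Store.apply, noop, rulerStore]

-- `l` consists of the digits already cleared, `l'` of those still to be incremented. The loop stops
-- at the first digit that is not one, or at the blank behind all digits, and the write that follows
-- puts a one there.
include hih in
theorem runs_carryLoop (t : Fin k) (l' l : List Bool) (hp : (l ++ incr l').length + 1 < s) :
    ∃ d p, (carryLoop t).Runs x s (rulerStore k ih (l.length + 1) (l ++ l')) d ∧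
      (writeAll (some (some true)) .stay).Runs x s d (rulerStore k ih p (l ++ incr l')) ∧
      p ≤ (l ++ incr l').length := by
  have hfalse : ∀ l' : List Bool, l.length + 1 < s → l'.head? ≠ some true →
      (carryLoop t).Runs x s (rulerStore k ih (l.length + 1) (l ++ l'))
        (rulerStore k ih (l.length + 1) (l ++ l')) := by
    intro l' hp h
    refine runs_loop_false (rulerStore_bounded hih hp _) ?_
    simp only [Store.obs, rulerStore, ruler_append]
    rcases h' : l'.head? with _ | _ | _
    · rfl
    · rfl
    · exact absurd h' h
  induction l' generalizing l with
  | nil =>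
    simp only [incr, List.length_append, List.length_singleton] at hp ⊢
    exact ⟨_, _, hfalse [] (by omega) (by simp),
      runs_writeAll hih true .stay l [] (by omega), le_rfl⟩
  | cons b l' ih' =>
    rcases b with _ | _
    · simp only [incr, List.length_append, List.length_cons] at hp ⊢
      exact ⟨_, _, hfalse (false :: l') (by omega) (by simp),
        runs_writeAll hih true .stay l (false :: l') (by omega), by simp only [Move.apply]; omega⟩
    · rw [incr, List.append_cons] at hp
      have hlen : l.length + 1 < s := by simp only [List.length_append, List.length_cons] at hp; omega
      obtain ⟨d, p, h1, h2, h3⟩ := ih' (l ++ [false]) hp (fun l'' h4 h5 => by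
        refine runs_loop_false (rulerStore_bounded hih h4 _) ?_
        simp only [Store.obs, rulerStore, ruler_append]
        rcases h' : l''.head? with _ | _ | _
        · rfl
        · rfl
        · exact absurd h' h5)
      rw [← List.append_cons] at h2 h3
      refine ⟨d, p, ?_, h2, h3⟩
      have h4 := runs_writeAll (k := k) hih false .right l (true :: l') hlen
      refine runs_loop_true ?_ h4 ?_
      · simp [Store.obs, rulerStore, ruler_append]
      · have e : (l ++ [false]).length + 1 = Move.right.apply (l.length + 1) := by
          simp [Move.apply]
        rw [e, ← List.append_cons] at h1
        exact h1

include hih in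
theorem runs_rewind (t : Fin k) (p : ℕ) (l : List Bool) (hp : p < s) :
    (rewind t).Runs x s (rulerStore k ih p l) (rulerStore k ih 0 l) := by
  induction p with
  | zero =>
    exact runs_loop_false (rulerStore_bounded hih hp _) (offStart_ruler (l := l) t _ fun _ => 0)
  | succ p ih' =>
    exact runs_loop_true ((offStart_ruler (l := l) t _ fun _ => p + 1).trans (by simp))
      (runs_moveAll hih .left hp l) (ih' (by omega))

/-- A binary counter, least significant digit first, is incremented for each input symbol. `N` has
`Nat.size N` digits, so the final tape has one digit for each block; the values of the digits are
not needed afterwards. -/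
theorem runs_buildRuler (t : Fin k) (N : ℕ) (hs : Nat.size N + 1 < s) :
    (buildRuler t).Runs (List.replicate N .one) s ⟨1, fun _ => 0, fun _ _ => none, []⟩
      (rulerStore k (N + 1) 0 N.bits) := by
  set x := List.replicate N TapeSym.one with hx
  have hlen : x.length = N := by simp [hx]
  have h1 : (writeAll (some none) .stay).Runs x s ⟨1, fun _ => 0, fun _ _ => none, []⟩
      (rulerStore k 1 0 (Nat.bits 0)) := by
    refine Eq.mp (congrArg _ ?_) (runs_act (c := ⟨1, fun _ => 0, fun _ _ => none, []⟩)
      ⟨by simp, fun _ => by dsimp only; omega⟩)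
    refine Store.ext ?_ ?_ ?_ ?_
    · simp [Store.apply, noop, Move.apply, rulerStore]
    · simp [Store.apply, rulerStore, Move.apply]
    · funext i j
      rcases j with _ | j <;> simp [Store.apply, rulerStore, ruler]
    · simp [Store.apply, noop, rulerStore]
  refine h1.seq ?_
  suffices ∀ j ≤ N, ∀ n, n + j = N → (Frag.loop _ _).Runs x s (rulerStore k (n + 1) 0 n.bits)
      (rulerStore k (N + 1) 0 N.bits) from this N le_rfl 0 (by omega)
  intro j
  induction j with
  | zero =>
    intro _ n hn
    obtain rfl : n = N := by omega
    refine runs_loop_false (rulerStore_bounded (by omega) (by omega) _) ?_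
    simp [Store.obs, rulerStore, Machine.inputAt, hlen]
  | succ j ih' =>
    intro hj n hn
    have hih : n + 1 ≤ x.length + 1 := by omega
    -- The counter stays at or below `N`, which bounds the space at all times.
    have hsize : (incr n.bits).length ≤ Nat.size N := by
      rw [← bits_succ, Nat.size_eq_bits_len]; exact Nat.size_le_size (by omega)
    obtain ⟨d, p, h2, h3, h4⟩ := runs_carryLoop (k := k) (s := s) hih t n.bits [] (by simp; omega)
    simp only [List.nil_append, List.length_nil] at h2 h3 h4
    have h5 : inputRight.Runs x s (rulerStore k (n + 1) 0 (incr n.bits))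
        (rulerStore k (n + 1 + 1) 0 (incr n.bits)) := by
      refine Eq.mp (congrArg _ ?_)
        (runs_act (rulerStore_bounded (k := k) (p := 0) hih (by omega) (incr n.bits)))
      refine Store.ext ?_ ?_ ?_ ?_
      · simp [Store.apply, noop, Move.apply, rulerStore]; omega
      · simp [Store.apply, rulerStore, Move.apply, noop]
      · simp [Store.apply, Store.obs, rulerStore, noop]
      · simp [Store.apply, noop, rulerStore]
    refine runs_loop_true ?_ ((runs_moveAll hih .right (by omega) _).seq (h2.seq (h3.seq
      ((runs_rewind hih t p _ (by omega)).seq h5)))) ?_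
    · simp [Store.obs, rulerStore, Machine.inputAt, hlen]; omega
    · rw [← bits_succ]
      exact ih' (by omega) (n + 1) (by omega)

end Frag

/-! ### A machine for the description -/

namespace Frag

/-- Tape `e`. -/
def tape (K e : ℕ) : Fin (K + 2) := Fin.ofNat (K + 2) e

variable (K : ℕ)

/-- A matrix with constant blocks on and above the diagonal. -/
noncomputable def matFrag (T T' : Slot → Slot → ℤ) : Frag (K + 2) Cell :=
  forAll 0 <| seqList <| slotList.map fun s =>
    ((below 0 1 (slotList.flatMap fun _ => descFixed (0 : Fixed 2))).seq
      (put (slotList.flatMap fun s' => descFixed (Fixed.ofMant (T s s'))))).seq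
      (above 0 1 (slotList.flatMap fun s' => descFixed (Fixed.ofMant (T' s s')))
        (slotList.flatMap fun _ => descFixed (0 : Fixed 2)))

/-- A vector with constant blocks. -/
noncomputable def vecFrag (v : Slot → ℤ) : Frag (K + 2) Cell :=
  forAll 0 (put (slotList.flatMap fun s => descFixed (Fixed.ofMant (v s))))

/-- The partition for layer normalization. -/
noncomputable def partFrag : Frag (K + 2) Cell :=
  forAll 0 <| seqList <| slotList.map fun s =>
    (below 0 1 (List.replicate slots .one)).seq (put (descNat (slotEquiv (s.1, true))))

/-- A layer. -/
noncomputable def layerFrag (T : LayerTable) : Frag (K + 2) Cell :=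
  (((((((matFrag K T.q fun _ _ => 0).seq (matFrag K T.k fun _ _ => 0)).seq
    (matFrag K T.v T.vShift)).seq (matFrag K T.w₁ fun _ _ => 0)).seq (vecFrag K T.b₁)).seq
    (matFrag K T.w₂ fun _ _ => 0)).seq (vecFrag K T.b₂)).seq (partFrag K)

/-- A block of layers. -/
noncomputable def blockFrag (B : ℕ × ℕ × List Instr) : Frag (K + 2) Cell :=
  (((power (tape K) B.1 B.2.1).seq (put [.sep])).seq (put (descNat B.2.2.length))).seq
    (seqList (B.2.2.map fun I => layerFrag K I.table))

/-- A transformer. -/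
noncomputable def descFrag (spec : List (ℕ × ℕ × List Instr)) : Frag (K + 2) Cell :=
  ((((((((((put (descNat 2)).seq ((forAll 0 (put (List.replicate slots .one))).seq (put [.sep]))).seq
    (put (descNat 1))).seq (put (descFixed (Fixed.ofMant 1)))).seq
    (put (descFixed (Fixed.ofMant 1)))).seq (vecFrag K (slotVal fun f => tokFlag f none))).seq
    (seqList (Tok.all.map fun a => vecFrag K (slotVal fun f => tokFlag f (some a))))).seq
    (put (descNat spec.length))).seq (seqList (spec.map (blockFrag K)))).seq
    (vecFrag K fun s => if s = (some .t, true) then 4 else 0)).seq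
    (put (descFixed (Fixed.ofMant 0)))

end Frag

/-- The numbers of iterations `c * m ^ e` of blocks. -/
def programs (m : ℕ) (spec : List (ℕ × ℕ × List Instr)) : List (ℕ × List Instr) :=
  spec.map fun B => (B.1 * m ^ B.2.1, B.2.2)

/-- The three summands of a block row of a matrix are what `below`, `put` and `above` write. -/
theorem flatMap_range_three {α : Type*} (a b z : List α) {i m : ℕ} (hi : i < m) :
    ((List.range m).flatMap fun j => if j = i then a else if j = i + 1 then b else z) =
      ((List.range i).flatMap fun _ => z) ++ a ++
        (if i + 1 < m then b ++ (List.range (m - (i + 2))).flatMap fun _ => z else []) := by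
  obtain ⟨r, rfl⟩ : ∃ r, m = i + (1 + r) := ⟨m - i - 1, by omega⟩
  have h1 : ((List.range i).flatMap fun j => if j = i then a else if j = i + 1 then b else z) =
      (List.range i).flatMap fun _ => z := by
    rw [List.flatMap_def, List.flatMap_def]
    congr 1
    refine List.map_congr_left fun j hj => ?_
    rw [List.mem_range] at hj
    rw [if_neg (by omega), if_neg (by omega)]
  rw [List.range_add, List.flatMap_append, h1, List.append_assoc, Nat.add_comm 1 r,
    List.range_succ_eq_map, List.map_cons, List.flatMap_cons, if_pos (by omega)]
  congr 2
  rcases r with _ | r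
  · simp
  · rw [List.range_succ_eq_map, List.map_cons, List.map_cons, List.flatMap_cons, if_neg (by omega),
      if_pos (by omega), if_pos (by omega)]
    congr 1
    rw [show i + (r + 1 + 1) - (i + 2) = r by omega]
    simp only [List.flatMap_map, List.map_map]
    rw [List.flatMap_def, List.flatMap_def]
    congr 1
    refine List.map_congr_left fun j _ => ?_
    simp only [Function.comp_apply]
    rw [if_neg (by omega), if_neg (by omega)]

theorem flatMap_finRange {α : Type*} {m : ℕ} (f : ℕ → List α) :
    ((List.finRange m).flatMap fun i : Fin m => f i) = (List.range m).flatMap f := by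
  rw [← List.map_coe_finRange_eq_range, List.flatMap_map]

theorem descVec_coord {m : ℕ} (v : Fin (m * slots) → Fixed 2) : descVec v =
    (List.finRange m).flatMap fun i => slotList.flatMap fun s => descFixed (v (coord m (i, s))) := by
  rw [descVec, ofFn_coord, List.flatMap_assoc]
  simp only [List.flatMap_map]

theorem descVec_blockVec (m : ℕ) (v : Slot → ℤ) : descVec (blockVec m v) =
    (List.range m).flatMap fun _ => slotList.flatMap fun s => descFixed (Fixed.ofMant (v s)) := by
  rw [descVec_coord, ← flatMap_finRange]
  simp only [blockVec, Equiv.symm_apply_apply]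

theorem descVec_blockMat {m : ℕ} (T T' : Slot → Slot → ℤ) (i : Fin m) (s : Slot) :
    descVec (blockMat m T T' (coord m (i, s))) = (List.range m).flatMap fun j : ℕ =>
      if j = (i : ℕ) then slotList.flatMap fun s' => descFixed (Fixed.ofMant (T s s'))
      else if j = (i : ℕ) + 1 then slotList.flatMap fun s' => descFixed (Fixed.ofMant (T' s s'))
      else slotList.flatMap fun _ => descFixed (0 : Fixed 2) := by
  rw [descVec_coord, ← flatMap_finRange]
  congr 1
  funext j
  simp only [blockMat, Equiv.symm_apply_apply, Fin.ext_iff]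
  split_ifs <;> rfl

theorem descMat_blockMat (m : ℕ) (T T' : Slot → Slot → ℤ) : descMat (blockMat m T T') =
    (List.range m).flatMap fun i => slotList.flatMap fun s => (List.range m).flatMap fun j : ℕ =>
      if j = (i : ℕ) then slotList.flatMap fun s' => descFixed (Fixed.ofMant (T s s'))
      else if j = i + 1 then slotList.flatMap fun s' => descFixed (Fixed.ofMant (T' s s'))
      else slotList.flatMap fun _ => descFixed (0 : Fixed 2) := by
  rw [descMat, ofFn_coord, List.flatMap_assoc, ← flatMap_finRange]
  simp only [List.flatMap_map, descVec_blockMat]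

/-- Lets a machine write the unary index `slotEquiv s + slots * i` of a coordinate, and the width,
by counting blocks on the ruler. -/
theorem descNat_mul_add (i a c : ℕ) :
    descNat (a + c * i) = ((List.range i).flatMap fun _ => List.replicate c TapeSym.one) ++ descNat a := by
  induction i with
  | zero => simp
  | succ i ih =>
    rw [List.range_succ_eq_map, List.flatMap_cons, List.flatMap_map, List.append_assoc, ← ih]
    unfold descNat
    rw [← List.append_assoc, List.replicate_append_replicate]
    congr 2; ring

theorem coord_val {m : ℕ} (i : Fin m) (s : Slot) :
    (coord m (i, s) : ℕ) = slotEquiv s + slots * i := by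
  rw [coord, Equiv.trans_apply, finProdFinEquiv_apply_val]; rfl

theorem desc_part (T : LayerTable) (m : ℕ) :
    (List.ofFn (T.layer m).part).flatMap (fun i => descNat i) =
      (List.range m).flatMap fun i => slotList.flatMap fun s =>
        ((List.range i).flatMap fun _ => List.replicate slots TapeSym.one) ++
          descNat (slotEquiv (s.1, true)) := by
  simp only [List.bind_eq_flatMap, List.pure_def, List.flatMap_assoc, List.flatMap_singleton]
  rw [ofFn_coord, List.flatMap_assoc, ← flatMap_finRange]
  simp only [List.flatMap_map, LayerTable.layer, Equiv.symm_apply_apply, coord_val, descNat_mul_add]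

namespace Frag

variable {K : ℕ} {x : List TapeSym} {s : ℕ} {l : List Bool} (hs : l.length + 1 < s)
include hs

theorem leads_forAll_zero {F : Frag (K + 2) Cell} (w : ℕ → List TapeSym)
    (hF : ∀ i < l.length, ∀ h : Fin (K + 2) → ℕ, (∀ j, h j ≤ l.length + 1) → h 0 = i + 1 →
      h 1 = 0 → Leads x s l F h (w i) h) :
    Leads x s l (forAll 0 F) (fun _ => 0) ((List.range l.length).flatMap w) (fun _ => 0) := by
  refine leads_forAll hs (fun _ => by omega) rfl w fun i hi => hF i hi _ (fun j => ?_) ?_ ?_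
  · by_cases hj : j = 0
    · subst hj; rw [Function.update_self]; omega
    · rw [Function.update_of_ne hj]; omega
  · rw [Function.update_self]
  · rw [Function.update_of_ne (by simp)]

theorem leads_matFrag (T T' : Slot → Slot → ℤ) :
    Leads x s l (matFrag K T T') (fun _ => 0) (descMat (blockMat l.length T T')) fun _ => 0 := by
  rw [descMat_blockMat]
  refine leads_forAll_zero hs _ fun i hi h hh h0 h1 => leads_seqList hs hh _ fun t _ => ?_
  rw [flatMap_range_three _ _ _ hi]
  exact ((leads_below (by simp) hh hs hi h0 h1 _).seq (leads_put _ fun j => (hh j).trans_lt hs)).seq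
    (leads_above (by simp) hh hs hi h0 h1 _ _)

theorem leads_vecFrag (v : Slot → ℤ) :
    Leads x s l (vecFrag K v) (fun _ => 0) (descVec (blockVec l.length v)) fun _ => 0 := by
  rw [descVec_blockVec]
  exact leads_forAll_zero hs _ fun i hi h hh _ _ => leads_put _ fun j => (hh j).trans_lt hs

theorem leads_partFrag (T : LayerTable) : Leads x s l (partFrag K) (fun _ => 0)
    ((List.ofFn (T.layer l.length).part).flatMap fun i => descNat i) fun _ => 0 := by
  rw [desc_part]
  refine leads_forAll_zero hs _ fun i hi h hh h0 h1 => leads_seqList hs hh _ fun t _ => ?_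
  exact (leads_below (by simp) hh hs hi h0 h1 _).seq (leads_put _ fun j => (hh j).trans_lt hs)

theorem leads_layerFrag (T : LayerTable) :
    Leads x s l (layerFrag K T) (fun _ => 0) (descLayer (T.layer l.length)) fun _ => 0 :=
  (((((((leads_matFrag hs _ _).seq (leads_matFrag hs _ _)).seq (leads_matFrag hs _ _)).seq
    (leads_matFrag hs _ _)).seq (leads_vecFrag hs _)).seq (leads_matFrag hs _ _)).seq
    (leads_vecFrag hs _)).seq (leads_partFrag hs T)

theorem leads_put_zero (w : List TapeSym) :
    Leads x s l (put w : Frag (K + 2) Cell) (fun _ => 0) w fun _ => 0 := leads_put _ fun _ => by omega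

theorem leads_blockFrag (B : ℕ × ℕ × List Instr) (hB : B.2.1 ≤ K) :
    Leads x s l (blockFrag K B) (fun _ => 0)
      (descBlock (B.1 * l.length ^ B.2.1, layersOf l.length B.2.2)) fun _ => 0 := by
  -- The loops use the tapes below `B.2.1 ≤ K`, and these are distinct since there are `K + 2`
  -- tapes.
  have h1 := leads_power (x := x) hs (t := tape K) B.1 B.2.1 (fun i hi j hj h => by
    simp only [tape, Fin.ofNat, Fin.mk.injEq] at h
    rwa [Nat.mod_eq_of_lt (by omega), Nat.mod_eq_of_lt (by omega)] at h)
    (h := fun _ => 0) (fun _ => by omega) (fun _ _ => rfl)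
  have h2 := leads_seqList (k := K + 2) (x := x) hs (h := fun _ => 0) (fun _ => by omega) B.2.2
    (F := fun I => layerFrag K I.table) fun I _ => leads_layerFrag hs I.table
  have := ((h1.seq (leads_put_zero hs [.sep])).seq (leads_put_zero hs (descNat B.2.2.length))).seq h2
  simpa [descBlock, layersOf, List.flatMap_map, descNat, blockFrag] using this

theorem leads_descFrag (spec : List (ℕ × ℕ × List Instr)) (hspec : ∀ B ∈ spec, B.2.1 ≤ K) :
    Leads x s l (descFrag K spec) (fun _ => 0)
      (ofPrograms l.length (programs l.length spec)).desc fun _ => 0 := by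
  have hz : ∀ i : Fin (K + 2), (fun _ => 0 : Fin (K + 2) → ℕ) i ≤ l.length + 1 := fun _ => by
    simp
  have hD : Leads x s l ((forAll 0 (put (List.replicate slots .one)) : Frag (K + 2) Cell).seq
      (put [.sep])) (fun _ => 0) (descNat (l.length * slots)) (fun _ => 0) := by
    have h1 := (leads_forAll_zero (K := K) (x := x) hs (F := put (List.replicate slots .one))
      (fun _ => List.replicate slots TapeSym.one)
      fun i hi h hh _ _ => leads_put _ fun j => (hh j).trans_lt hs).seq (leads_put_zero hs (descNat 0))
    rw [← descNat_mul_add, zero_add, mul_comm] at h1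
    exact h1
  have hE := leads_seqList (x := x) hs hz Tok.all (F := fun a => vecFrag K
    (slotVal fun f => tokFlag f (some a))) fun a _ => leads_vecFrag hs _
  have hB := leads_seqList (x := x) hs hz spec (F := blockFrag K)
    fun B h => leads_blockFrag hs B (hspec B h)
  have := ((((((((((leads_put_zero (K := K) (x := x) hs (descNat 2)).seq hD).seq
    (leads_put_zero hs (descNat 1))).seq (leads_put_zero hs (descFixed (Fixed.ofMant 1)))).seq
    (leads_put_zero hs (descFixed (Fixed.ofMant 1)))).seq (leads_vecFrag hs
      (slotVal fun f => tokFlag f none))).seq hE).seq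
    (leads_put_zero hs (descNat spec.length))).seq hB).seq (leads_vecFrag hs
      fun s => if s = (some .t, true) then 4 else 0)).seq
    (leads_put_zero hs (descFixed (Fixed.ofMant 0)))
  refine Eq.mp ?_ this
  congr 1
  simp only [Transformer.desc, ofPrograms, programs, List.length_map, List.map_map,
    List.flatMap_map, Function.comp_def]

end Frag

theorem logspace_desc (spec : List (ℕ × ℕ × List Instr)) :
    LogspaceOutputs (fun N : ℕ => List.replicate N TapeSym.one)
      (fun N => (ofPrograms (Nat.size N) (programs (Nat.size N) spec)).desc) := by
  -- Any common bound for the exponents will do; it does not depend on `N`, so the number of tapes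
  -- is fixed.
  set K := (spec.map fun B => B.2.1).sum with hK
  have hspec : ∀ B ∈ spec, B.2.1 ≤ K := fun B hB =>
    List.single_le_sum (by simp) _ (List.mem_map_of_mem (f := fun B : ℕ × ℕ × List Instr => B.2.1) hB)
  -- The heads visit the mark, at most `Nat.log 2 N + 1` digits, and the blank behind them, which
  -- fits into `3 * (Nat.log 2 N + 1)` cells.
  refine ⟨((Frag.buildRuler 0).seq (Frag.descFrag K spec)).toMachine none, 3, fun N => ?_⟩
  have hsize : Nat.size N ≤ Nat.log 2 N + 1 := by
    rw [Nat.size_le]; exact Nat.lt_pow_succ_log_self (by norm_num) N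
  have hs : Nat.size N + 1 < 3 * (Nat.log 2 (List.replicate N TapeSym.one).length + 1) := by
    rw [List.length_replicate]; omega
  have h1 := Frag.runs_buildRuler (k := K + 2) 0 N hs
  have h2 := Frag.leads_descFrag (x := List.replicate N TapeSym.one) (l := N.bits) (by rwa [Nat.size_eq_bits_len])
    spec hspec []
  have hlen : N + 1 = (List.replicate N TapeSym.one).length + 1 := by rw [List.length_replicate]
  rw [hlen] at h1
  refine (h1.seq h2).outputsInSpace none ⟨le_rfl, fun _ => Nat.zero_lt_of_lt hs⟩ ?_
  change (ofPrograms N.bits.length (programs N.bits.length spec)).desc = _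
  rw [Nat.size_eq_bits_len]

/-! ### The families -/

/-- The family of transformers that run given programs, `c * (size N) ^ e` times each. -/
noncomputable def ofSpec (spec : List (ℕ × ℕ × List Instr)) :
    Family (fun _ => 2) (fun N => Nat.size N * slots) :=
  fun N => ofPrograms (Nat.size N) (programs (Nat.size N) spec)

/-- The programs that read the pointers. -/
def readSpec : List (ℕ × ℕ × List Instr) := [(1, 0, initProg), (3, 1, loopProg), (1, 0, finProg)]

theorem programs_readSpec (m : ℕ) : programs m readSpec = readBlocks m := by
  simp [programs, readSpec, readBlocks]

theorem comp_ofSpec (N t : ℕ) : (ofSpec readSpec N).comp (ofSpec [(1, 0, stepProg)] N) t =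
    ofPrograms (Nat.size N) (readBlocks (Nat.size N) ++ [(t, stepProg)]) := by
  rw [← programs_readSpec, ← comp_ofPrograms]
  simp [ofSpec, programs]

/-- The composed family is again given by a list of programs, so its uniformity and its loop count
are covered by `isLPT_ofSpec`. -/
theorem comp_ofSpec_pow (c d : ℕ) :
    (fun N => (ofSpec readSpec N).comp (ofSpec [(1, 0, stepProg)] N) (c * Nat.size N ^ d)) =
      ofSpec (readSpec ++ [(c, d, stepProg)]) := by
  funext N
  rw [comp_ofSpec, ofSpec, ← programs_readSpec]
  simp [programs]

theorem log_le_size (N : ℕ) : Real.log N ≤ Nat.size N * Real.log 2 := by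
  rcases Nat.eq_zero_or_pos N with rfl | hN
  · simp
  · rw [← Real.log_pow]
    exact Real.log_le_log (by exact_mod_cast hN) (by exact_mod_cast (Nat.lt_size_self N).le)

theorem logb_le_size (N : ℕ) : Real.logb 2 N ≤ Nat.size N := by
  rw [Real.logb, div_le_iff₀ (Real.log_pos (by norm_num))]
  exact log_le_size N

theorem size_le_log {N : ℕ} (hN : 2 ≤ N) : (Nat.size N : ℝ) ≤ 2 / Real.log 2 * Real.log N := by
  have h2 : 1 < Nat.size N := by rw [Nat.lt_size]; omega
  have h : 2 ^ (Nat.size N - 1) ≤ N := by rw [← Nat.lt_size]; omega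
  have h' : ((Nat.size N - 1 : ℕ) : ℝ) * Real.log 2 ≤ Real.log N := by
    rw [← Real.log_pow]
    exact Real.log_le_log (by positivity) (by exact_mod_cast h)
  rw [Nat.cast_sub (by omega)] at h'
  have h2' : (2 : ℝ) ≤ Nat.size N := by exact_mod_cast h2
  have hl : 0 < Real.log 2 := Real.log_pos (by norm_num)
  rw [div_mul_eq_mul_div, le_div_iff₀ hl]
  push_cast at h'
  nlinarith

theorem size_isTheta_log : (fun N : ℕ => (Nat.size N : ℝ)) =Θ[atTop] fun N => Real.log N := by
  constructor
  · refine IsBigO.of_bound (2 / Real.log 2) ?_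
    filter_upwards [eventually_ge_atTop 2] with N hN
    have : 0 ≤ Real.log N := Real.log_natCast_nonneg N
    rw [Real.norm_of_nonneg (by positivity), Real.norm_of_nonneg this]
    exact size_le_log hN
  · refine IsBigO.of_bound (Real.log 2) (Eventually.of_forall fun N => ?_)
    have : 0 ≤ Real.log N := Real.log_natCast_nonneg N
    rw [Real.norm_of_nonneg this, Real.norm_of_nonneg (Nat.cast_nonneg _)]
    exact (log_le_size N).trans_eq (mul_comm _ _)

theorem loopCount_ofSpec (spec : List (ℕ × ℕ × List Instr)) (N : ℕ) :
    (ofSpec spec N).loopCount = (spec.map fun B => B.1 * Nat.size N ^ B.2.1).sum := by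
  simp [ofSpec, Transformer.loopCount, ofPrograms, programs, Function.comp_def]

/-- The loop count is the sum of the terms `c * Nat.size N ^ e`. The largest exponent decides its
order, and one term with this exponent and a positive coefficient gives the lower bound. -/
theorem isLPT_ofSpec (spec : List (ℕ × ℕ × List Instr)) (d : ℕ) (hle : ∀ B ∈ spec, B.2.1 ≤ d)
    (hd : ∃ B ∈ spec, B.2.1 = d ∧ 1 ≤ B.1) : (ofSpec spec).IsLPT d where
  uniform := ⟨logspace_desc spec, logspace_pos fun N => programs (Nat.size N) spec⟩
  precision := by
    simp only [ConstantPrecision]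
    exact isTheta_const_const (by norm_num) (by norm_num)
  width := by
    have hslots : (slots : ℝ) ≠ 0 := by
      have : 0 < slots := Fintype.card_pos_iff.2 ⟨(none, true)⟩
      exact_mod_cast this.ne'
    simp only [LogWidth, Nat.cast_mul, mul_comm _ (slots : ℝ)]
    exact (isTheta_const_mul_left hslots).2 size_isTheta_log
  padding := ⟨0, by simpa [ofSpec, ofPrograms] using isBigO_refl (fun _ : ℕ => (1 : ℝ)) atTop⟩
  layers := by
    refine ⟨spec.length + (spec.map fun B => B.2.2.length).sum, fun N => ⟨?_, fun B hB => ?_⟩⟩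
    · simp [ofSpec, ofPrograms, programs]
    · simp only [ofSpec, ofPrograms, programs, List.map_map, List.mem_map, Function.comp_apply] at hB
      obtain ⟨B', hB', rfl⟩ := hB
      have := List.single_le_sum (l := spec.map fun B => B.2.2.length) (by simp) _
        (List.mem_map_of_mem (f := fun B : ℕ × ℕ × List Instr => B.2.2.length) hB')
      simp only [layersOf, List.length_map]
      omega
  loops := by
    refine IsTheta.trans ?_ (size_isTheta_log.pow d)
    obtain ⟨B₀, hB₀, rfl, h1⟩ := hd
    constructor
    · refine IsBigO.of_bound ((spec.map fun B => B.1).sum : ℕ) ?_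
      filter_upwards [eventually_ge_atTop 1] with N hN
      have hs : 1 ≤ Nat.size N := Nat.size_pos.2 hN
      have : (ofSpec spec N).loopCount ≤ (spec.map fun B => B.1).sum * Nat.size N ^ B₀.2.1 := by
        rw [loopCount_ofSpec, ← List.sum_map_mul_right]
        exact List.sum_le_sum fun B hB =>
          Nat.mul_le_mul_left _ (Nat.pow_le_pow_right hs (hle B hB))
      rw [Real.norm_of_nonneg (by positivity), Real.norm_of_nonneg (by positivity)]
      exact_mod_cast this
    · refine IsBigO.of_bound 1 (Eventually.of_forall fun N => ?_)
      have : Nat.size N ^ B₀.2.1 ≤ (ofSpec spec N).loopCount := by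
        rw [loopCount_ofSpec]
        refine le_trans ?_ (List.single_le_sum (by simp) _ (List.mem_map_of_mem
          (f := fun B : ℕ × ℕ × List Instr => B.1 * Nat.size N ^ B.2.1) hB₀))
        exact Nat.le_mul_of_pos_left _ h1
      rw [Real.norm_of_nonneg (by positivity), Real.norm_of_nonneg (by positivity), one_mul]
      exact_mod_cast this

/-! ### Circuits of bounded depth and wide circuits. -/

theorem length_instanceOf_eq {n : ℕ} (C : Circuit n) (w : Fin n → Bool) :
    (C.instanceOf w).length = C.inputLength := by
  simp [Circuit.instanceOf, Circuit.inputLength]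

/-- `Nat.size N` bounds `Real.logb 2 N` from above, so the loop is long enough. The coefficient is
`c + 1` so that it stays positive for `c = 0`, as the lower bound for the loop count requires. -/
theorem recognizes_boundedDepth (κ : AttnKind) (c d : ℕ) :
    Family.Recognizes (ofSpec (readSpec ++ [(c + 1, d, stepProg)])) κ
      (boundedDepthEvaluation c d) := by
  rintro x y ⟨n, C, w, hC, rfl, rfl⟩
  rw [← comp_ofSpec_pow]
  dsimp only
  rw [comp_ofSpec]
  refine output_comp κ C w (Nat.lt_size_self _) ?_
  rw [length_instanceOf_eq]
  have h0 : 0 ≤ Real.logb 2 C.inputLength :=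
    div_nonneg (Real.log_natCast_nonneg _) (Real.log_nonneg (by norm_num))
  have h1 : (C.depth : ℝ) ≤ (c + 1) * (Nat.size C.inputLength : ℝ) ^ d :=
    hC.trans (mul_le_mul (by simp) (pow_le_pow_left₀ h0 (logb_le_size _) d) (by positivity)
      (by positivity))
  exact_mod_cast h1

/-- One logarithm absorbs the constant: `n ^ c ≤ C.size ≤ N` gives `c * log n ≤ log N`. The other `d
- 1` factors grow with the passage from `n` to `N`. -/
theorem Circuit.IsWide.depth_le {n d : ℕ} {C : Circuit n} (hd : 1 ≤ d) (h : C.IsWide d) :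
    (C.depth : ℝ) ≤ ((1 : ℕ) : ℝ) * Real.logb 2 C.inputLength ^ d := by
  obtain ⟨c, hc, h1, h2⟩ := h
  have hsize := C.size_le_length fun _ => false
  rw [length_instanceOf_eq] at hsize
  have hdepth : (1 : ℝ) ≤ C.depth := by exact_mod_cast C.one_le_depth
  have hn : 0 < n := by
    rcases Nat.eq_zero_or_pos n with rfl | hn
    -- The logarithm of zero is zero by convention, so `n = 0` would force depth zero.
    · rw [Nat.cast_zero, Real.logb_zero, zero_pow (by omega), mul_zero] at h1
      linarith
    · exact hn
  have hn' : (0 : ℝ) < n := by exact_mod_cast hn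
  have hL : 0 ≤ Real.logb 2 n :=
    div_nonneg (Real.log_natCast_nonneg _) (Real.log_nonneg (by norm_num))
  have h3 : c * Real.logb 2 n ≤ Real.logb 2 C.inputLength := by
    rw [← Real.logb_rpow_eq_mul_logb_of_pos hn']
    refine Real.logb_le_logb_of_le (by norm_num) (Real.rpow_pos_of_pos hn' c) (h2.trans ?_)
    exact_mod_cast (by omega : C.size ≤ C.inputLength)
  have h4 : Real.logb 2 n ≤ Real.logb 2 C.inputLength :=
    Real.logb_le_logb_of_le (by norm_num) hn' (by exact_mod_cast (by omega : n ≤ C.inputLength))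
  obtain ⟨e, rfl⟩ : ∃ e, d = e + 1 := ⟨d - 1, by omega⟩
  rw [pow_succ', ← mul_assoc] at h1
  rw [Nat.cast_one, one_mul, pow_succ']
  exact h1.trans (mul_le_mul h3 (pow_le_pow_left₀ hL h4 e) (by positivity) (hL.trans h4))

end LPT

theorem mainTheorem10 (κ : AttnKind) :
    (∃ (b D : ℕ → ℕ) (read step : Family b D),
      read.IsLPT 1 ∧ step.IsLPT 0 ∧
      (∀ N, (read N).τ = (step N).τ ∧ (read N).ε = (step N).ε) ∧
      read.ReadsPointers κ ∧
      (∀ (n : ℕ) (C : Circuit n) (w : Fin n → Bool) (N t : ℕ),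
        N = (C.instanceOf w).length → C.depth ≤ t →
        ((read N).comp (step N) t).output κ (C.instanceOf w) = some (C.eval w)) ∧
      (∀ d : ℕ, 1 ≤ d → ∀ c : ℕ, ∃ t : ℕ → ℕ,
        Family.IsLPT (fun N => (read N).comp (step N) (t N)) d ∧
        Family.Recognizes (fun N => (read N).comp (step N) (t N)) κ
          (boundedDepthEvaluation c d))) ∧
    (∀ d : ℕ, 1 ≤ d →
      ∃ (b D : ℕ → ℕ) (T : Family b D),
        T.IsLPT d ∧ T.Recognizes κ (wideACEvaluation d)) := by
  have hread : (ofSpec readSpec).IsLPT 1 :=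
    isLPT_ofSpec _ _ (by simp [readSpec]) ⟨(3, 1, loopProg), by simp [readSpec], rfl, by simp⟩
  have hstep : (ofSpec [(1, 0, stepProg)]).IsLPT 0 :=
    isLPT_ofSpec _ _ (by simp) ⟨(1, 0, stepProg), by simp, rfl, by simp⟩
  have hcomp : ∀ d : ℕ, 1 ≤ d → ∀ c : ℕ,
      (ofSpec (readSpec ++ [(c + 1, d, stepProg)])).IsLPT d := fun d hd c =>
    isLPT_ofSpec _ _ (by simp [readSpec, hd]) ⟨(c + 1, d, stepProg), by simp, rfl, by simp⟩
  refine ⟨⟨_, _, ofSpec readSpec, ofSpec [(1, 0, stepProg)], hread, hstep, fun N => ⟨rfl, rfl⟩, ?_,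
    ?_, fun d hd c => ⟨fun N => (c + 1) * Nat.size N ^ d, ?_⟩⟩, fun d hd => ⟨_, _, _, hcomp d hd 1,
    ?_⟩⟩
  · have := readsPointers_read κ Nat.size Nat.lt_size_self
    simp only [← programs_readSpec] at this
    exact this
  · rintro n C w N t rfl ht
    rw [comp_ofSpec]
    exact output_comp κ C w (Nat.lt_size_self _) ht
  · rw [comp_ofSpec_pow]
    exact ⟨hcomp d hd c, recognizes_boundedDepth κ c d⟩
  -- The constant `1` serves all wide circuits at once, although each of them has its own `c`.
  · rintro x y ⟨n, C, w, hC, hx, hy⟩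
    exact recognizes_boundedDepth κ 1 d x y ⟨n, C, w, hC.depth_le hd, hx, hy⟩
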